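/- Let $d\ge 1$, $\nu>0$ and $\mathbb T^d=\mathbb R^d/2\pi\mathbb Z^d$. For $f:\mathbb T^d\to\mathbb R$ in $L^2$ put $\hat f(k)=\int_{\mathbb T^d} f(x)e^{-ik\cdot x}\,dx$, and for $s\ge 0$ let $H^s(\mathbb T^d)$ be the space of those $f$ with $\|f\|_{H^s}^2=\sum_{k\in\mathbb Z^d}(1+|k|^{2s})|\hat f(k)|^2<\infty$. Consider $$\partial_t h=\nabla\cdot\big((|\nabla h|^2-1)\nabla h\big)-\nu\Delta^2h,\qquad h(0)=h_0. \tag{1}$$ For $T>0$, a mild solution of (1) on $[0,T]$ is a function $h$ with $h(0)=h_0$ and $$h\in C([0,T];H^{d/2}),\qquad t^{1/4}\nabla h\in C([0,T];C(\mathbb T^d)),\qquad t^{1/4}h\in C([0,T];H^{d/2+1})$$ (the two weighted functions being given the value $0$ at $t=0$) such that, for every $0<t\le T$, $$h(t)=e^{-t\nu\Delta^2}h_0+\sum_{j=1}^d\int_0^t\partial_j e^{-(t-s)\nu\Delta^2}\big((|\nabla h|^2-1)\partial_jh\big)(s)\,ds ,$$ where the integrals converge absolutely in $L^2(\mathbb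 T^d)$. Let $T_*\in[0,\infty]$, the maximal lifespan, be the supremum of all $T>0$ such that (1) has a mild solution on $[0,T]$. Theorem. Let $h_0\in H^{d/2}(\mathbb T^d)$. Then: 1. There are $T_0>0$ and a mild solution of (1) on $[0,T_0]$; in particular $T_*>0$. 2. For every $T>0$, any two mild solutions of (1) on $[0,T]$ coincide. 3. There is a function $h$ on $[0,T_*)$ whose restriction to $[0,T]$ is, for every $0<T<T_*$, the mild solution of (1) on $[0,T]$. For all $0<t<T_*$ one has $h(t)\in H^m(\mathbb T^d)$ for every integer $m\ge 0$, and $h(t)\in C^\infty(\mathbb T^d)$. 4. If $h_0$ has mean zero, then $h(t)$ has mean zero for all $0<t<T_*$. -/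

import Mathlib

open MeasureTheory Set Filter
open scoped Topology ENNReal ContDiff

noncomputable section

namespace ThinFilm

/-- The torus `ℝ^d / 2πℤ^d`; its `volume` is Lebesgue measure, of total mass `(2π)^d`. -/
abbrev Torus (d : ℕ) : Type := Fin d → AddCircle (2 * Real.pi)

instance factTwoPi : Fact (0 < 2 * Real.pi) := ⟨Real.two_pi_pos⟩

/-- Real-valued square integrable functions on the torus (modulo null sets). -/
abbrev L2 (d : ℕ) : Type := Lp ℝ 2 (volume : Measure (Torus d))

/-- The character `x ↦ e^{i k·x}` for `k ∈ ℤ^d`. -/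
def character {d : ℕ} (k : Fin d → ℤ) (x : Torus d) : ℂ := ∏ j, fourier (k j) (x j)

/-- The Fourier coefficient `∫ f(x) e^{-i k·x} dx`. -/
def fourierCoef {d : ℕ} (f : Torus d → ℝ) (k : Fin d → ℤ) : ℂ :=
  ∫ x, (f x : ℂ) * character (-k) x

/-- The Euclidean length `|k|` of a frequency. -/
def freqNorm {d : ℕ} (k : Fin d → ℤ) : ℝ := Real.sqrt (∑ j, (k j : ℝ) ^ 2)

/-- `‖f‖_{H^s}² = ∑_k (1 + |k|^{2s}) |f̂(k)|²`, with value `∞` when the sum diverges. -/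
def sobolevNormSq {d : ℕ} (s : ℝ) (f : L2 d) : ℝ≥0∞ :=
  ∑' k : Fin d → ℤ, ENNReal.ofReal ((1 + freqNorm k ^ (2 * s)) * ‖fourierCoef f k‖ ^ 2)

/-- `f ∈ H^s(𝕋^d)`, for `s ≥ 0`. -/
def MemSobolev {d : ℕ} (s : ℝ) (f : L2 d) : Prop := sobolevNormSq s f < ⊤

/-- `u ∈ C^0([0,T]; H^s(𝕋^d))`. -/
def ContInSobolev {d : ℕ} (s T : ℝ) (u : ℝ → L2 d) : Prop :=
  (∀ t ∈ Icc 0 T, MemSobolev s (u t)) ∧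
    ∀ t ∈ Icc 0 T, Tendsto (fun r => sobolevNormSq s (u r - u t)) (𝓝[Icc 0 T] t) (𝓝 0)

/-- The continuous function `g` is the distributional derivative `∂_j f`:
`ĝ(k) = i k_j f̂(k)` for all `k`. -/
def IsWeakDeriv {d : ℕ} (j : Fin d) (f : L2 d) (g : C(Torus d, ℝ)) : Prop :=
  ∀ k : Fin d → ℤ, fourierCoef g k = Complex.I * (k j : ℂ) * fourierCoef f k

open Classical in
/-- The Fourier multiplier operator with symbol `m`: the function in `L²` whose Fourier
coefficients are `m(k) f̂(k)`. It exists whenever `m` is bounded with `m(-k) = conj (m(k))`, as are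
the symbols used below at positive times; where no such function exists the value is `0`. -/
def fourierMul {d : ℕ} (m : (Fin d → ℤ) → ℂ) (f : L2 d) : L2 d :=
  if h : ∃ g : L2 d, ∀ k, fourierCoef g k = m k * fourierCoef f k then h.choose else 0

/-- The semigroup `e^{-τ ν Δ²}`. -/
def biharmonic {d : ℕ} (ν τ : ℝ) : L2 d → L2 d :=
  fourierMul fun k => (Real.exp (-(τ * ν * freqNorm k ^ 4)) : ℂ)

/-- The operator `∂_j e^{-τ ν Δ²}`. -/
def derivBiharmonic {d : ℕ} (ν : ℝ) (j : Fin d) (τ : ℝ) : L2 d → L2 d :=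
  fourierMul fun k => Complex.I * (k j : ℂ) * (Real.exp (-(τ * ν * freqNorm k ^ 4)) : ℂ)

/-- The flux component `(|p|² - 1) p_j` of a continuous vector field `p`. -/
def flux {d : ℕ} (p : Fin d → C(Torus d, ℝ)) (j : Fin d) : C(Torus d, ℝ) :=
  ((∑ i, p i ^ 2) - 1) * p j

/-- `h` is a mild solution on `[0,T]` of `∂_t h = ∇·((|∇h|²-1)∇h) - ν Δ² h`, `h(0) = h₀`, in the
class `h ∈ C_t H^{d/2}`, `t^{1/4} ∇h ∈ C_t C_x`, `t^{1/4} h ∈ C_t H^{d/2+1}` on `[0,T]`.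
Here `p t` is the gradient of `h t` for `0 < t ≤ T`. At `t = 0` the weighted functions are `0`,
which is the only possible value of their limits since `h` is continuous into `H^{d/2}`. -/
def IsMildSolution {d : ℕ} (ν : ℝ) (h₀ : L2 d) (T : ℝ) (h : ℝ → L2 d) : Prop :=
  ContInSobolev ((d : ℝ) / 2) T h ∧
  ContInSobolev ((d : ℝ) / 2 + 1) T (fun t => t ^ (1 / 4 : ℝ) • h t) ∧
  h 0 = h₀ ∧
  ∃ p : ℝ → Fin d → C(Torus d, ℝ),
    (∀ t ∈ Ioc 0 T, ∀ j, IsWeakDeriv j (h t) (p t j)) ∧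
    (∀ j, ContinuousOn (fun t => t ^ (1 / 4 : ℝ) • p t j) (Icc 0 T)) ∧
    ∀ t ∈ Ioc 0 T,
      (∀ j, IntervalIntegrable
        (fun s => derivBiharmonic ν j (t - s) (ContinuousMap.toLp 2 volume ℝ (flux (p s) j)))
        volume 0 t) ∧
      h t = biharmonic ν t h₀ + ∑ j, ∫ s in (0 : ℝ)..t,
        derivBiharmonic ν j (t - s) (ContinuousMap.toLp 2 volume ℝ (flux (p s) j))

/-- The maximal lifespan `T_* ∈ [0,∞]`: the supremum of the `T > 0` such that there is a mild
solution on `[0,T]`. -/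
def lifespan {d : ℕ} (ν : ℝ) (h₀ : L2 d) : ℝ≥0∞ :=
  sSup {τ : ℝ≥0∞ | ∃ T : ℝ, 0 < T ∧ τ = ENNReal.ofReal T ∧ ∃ h, IsMildSolution ν h₀ T h}

/-- `f` agrees almost everywhere with a `C^∞` function on the torus, that is, with a function
whose `2π`-periodic lift to `ℝ^d` is `C^∞`. -/
def IsSmooth {d : ℕ} (f : L2 d) : Prop :=
  ∃ φ : Torus d → ℝ, (f : Torus d → ℝ) =ᵐ[volume] φ ∧
    ContDiff ℝ ∞ fun x : Fin d → ℝ => φ fun j => (x j : AddCircle (2 * Real.pi))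

/-- `f` has mean zero. -/
def MeanZero {d : ℕ} (f : L2 d) : Prop := ∫ x, f x = 0

end ThinFilm

end

namespace ThinFilm

open scoped ComplexConjugate

/-! The equation is parabolic of order four, and up to the lower order term it is invariant under
h(x,t) ↦ h(λx, λ⁴t). Hence H^{d/2} is the critical space: a small time alone does not make the cubic
term small, and smallness has to come from the linear evolution, whose scale invariant norm tends to
0 at t = 0, though without a rate. All estimates are made on the Fourier side, where the mild
formulation is an identity for each frequency (`isMildSolution_iff`).

Existence. The working quantity is a squared norm, `energy N t x` = t^{1/4} Σ |k|² (1+|k|)^{d-1}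
(1+t^{1/4}|k|)^{2N} |x_k|². Three facts make it fit the problem. Linear part: the energy of the
linear flow is at most a multiple of `lowNorm`, which tends to 0 for data in H^{d/2}
(`exists_energy_heat_le`, `tendsto_lowNorm`). Nonlinearity: with a = t^{1/4}, the inverse weight has
lattice sum O(1/a), because shells of radius n hold O(n^{d-1}) points. So the weighted ℓ² space is a
convolution algebra with constant O(1/a), and the flux is Lipschitz with factor s^{-5/4}
(`tsum_wt_conv_le`, `exists_wsum_flux_sub_le`). Duhamel term: passing from the weight at time s to
the weight at time t costs a power of 1+(t-s)^{1/4}|k|, which the exponential absorbs. What remains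
is the integral of t^{1/8} (t-s)^{-1/2} s^{-5/8}, which does not depend on t
(`exists_duhamel_bounds`). The Picard map is therefore a contraction among small energies
(`exists_picard_fixedPoint`), and the limit lies in the solution class
(`isMildSolution_of_fixedPoint`).

Uniqueness. For two solutions, the L² norm of the difference of the gradients satisfies an integral
inequality with kernel (t-s)^{-1/2} A(s). Here A(s) ≤ ε s^{-1/2} + K for every ε > 0, because
t^{1/4}∇h is continuous and vanishes at 0. The singular part is absorbed by choosing ε small and the
bounded part by an exponential weight (`eq_zero_of_singular_gronwall`).

Smoothness. For data in H^{d/2+1} one has `lowNorm` = O(t^{1/4}), so the time of existence with any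
prescribed N is bounded below in terms of that norm. On a compact subset of positive times a mild
solution is bounded in H^{d/2+1}. Given t, restart at t₀ < t close enough that the solution built
with a large N reaches t; by uniqueness it is h, hence h(t) ∈ H^m (`IsMildSolution.memSobolev`).
With all m the Fourier series converges in C^∞. Conservation of the mean is the identity at k = 0,
where the divergence vanishes. -/

/-- The volume of the torus. -/
noncomputable def torusVol (d : ℕ) : ℝ := (2 * Real.pi) ^ d

theorem torusVol_pos (d : ℕ) : 0 < torusVol d := pow_pos Real.two_pi_pos d

/-! ### Fourier basis of the torus, Parseval, and real functions with prescribed coefficients -/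

section Characters

variable {d : ℕ}

/-- The character `e^{i k·x}` as a continuous function. -/
noncomputable def charC (k : Fin d → ℤ) : C(Torus d, ℂ) where
  toFun x := character k x
  continuous_toFun := by unfold character; fun_prop

theorem charC_apply (k : Fin d → ℤ) (x : Torus d) : charC k x = character k x := rfl

theorem character_neg (k : Fin d → ℤ) (x : Torus d) : character (-k) x = conj (character k x) := by
  simp only [character, Pi.neg_apply, fourier_neg, map_prod]

theorem character_add (k l : Fin d → ℤ) (x : Torus d) :
    character (k + l) x = character k x * character l x := by
  simp only [character, Pi.add_apply, fourier_add, ← Finset.prod_mul_distrib]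

theorem character_zero (x : Torus d) : character 0 x = 1 := by
  simp [character]

theorem norm_character (k : Fin d → ℤ) (x : Torus d) : ‖character k x‖ = 1 := by
  simp [character, fourier_apply, norm_prod, Circle.norm_coe]

theorem norm_charC_le (k : Fin d → ℤ) : ‖charC k‖ ≤ 1 :=
  (ContinuousMap.norm_le _ zero_le_one).mpr fun x => (norm_character k x).le

theorem integral_character (k : Fin d → ℤ) :
    ∫ x : Torus d, character k x = if k = 0 then (torusVol d : ℂ) else 0 := by
  have h1 : ∀ n : ℤ, ∫ x : AddCircle (2 * Real.pi), fourier n x =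
      if n = 0 then ((2 * Real.pi : ℝ) : ℂ) else 0 := by
    intro n
    -- Pair the mode n with the constant mode in the normalized Haar measure; the factor 2π then
    -- returns to Lebesgue measure.
    have h := (orthonormal_iff_ite.mp (orthonormal_fourier (T := 2 * Real.pi))) 0 n
    rw [ContinuousMap.inner_toLp, AddCircle.integral_haarAddCircle] at h
    have h2 : ∀ x : AddCircle (2 * Real.pi),
        fourier n x * conj (fourier (0 : ℤ) x) = fourier n x := by
      intro x; simp
    simp only [h2] at h
    have h3 : ((2 * Real.pi : ℝ) : ℂ) ≠ 0 := by exact_mod_cast Real.two_pi_pos.ne'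
    have h4 := congrArg (fun z : ℂ => ((2 * Real.pi : ℝ) : ℂ) * z) h
    simp only [Complex.real_smul, Complex.ofReal_inv, mul_inv_cancel_left₀ h3] at h4
    rw [h4]
    by_cases hn : n = 0
    · simp [hn]
    · simp [hn, Ne.symm hn]
  unfold character
  rw [MeasureTheory.integral_fintype_prod_volume_eq_prod]
  simp only [h1]
  split_ifs with hk
  · subst hk; simp [torusVol]
  · obtain ⟨i, hi⟩ := Function.ne_iff.mp hk
    exact Finset.prod_eq_zero (Finset.mem_univ i) (if_neg hi)

/-- The star subalgebra of `C(𝕋^d, ℂ)` generated by the characters. -/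
noncomputable def charSubalgebra (d : ℕ) : StarSubalgebra ℂ C(Torus d, ℂ) where
  toSubalgebra := Algebra.adjoin ℂ (range charC)
  star_mem' := by
    change Algebra.adjoin ℂ (range charC) ≤ star (Algebra.adjoin ℂ (range charC))
    refine Algebra.adjoin_le ?_
    rintro _ ⟨n, rfl⟩
    refine Algebra.subset_adjoin ⟨-n, ?_⟩
    ext1 x
    simp only [charC_apply, character_neg, starRingEnd_apply, ContinuousMap.star_apply]

theorem charSubalgebra_coe :
    Subalgebra.toSubmodule (charSubalgebra d).toSubalgebra = Submodule.span ℂ (range charC) := by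
  apply Algebra.adjoin_eq_span_of_subset
  refine .trans (fun x ↦ Submonoid.closure_induction (fun _ ↦ id) ⟨0, ?_⟩ ?_) Submodule.subset_span
  · ext z
    simp [charC_apply, character_zero]
  · rintro _ _ _ _ ⟨m, rfl⟩ ⟨n, rfl⟩
    refine ⟨m + n, ?_⟩
    ext z
    simp only [charC_apply, character_add, ContinuousMap.mul_apply]

/-- The character of a coordinate frequency depends on that coordinate alone and is injective in it,
so it separates points that differ there. This is the input for Stone–Weierstrass. -/
theorem charSubalgebra_separatesPoints : (charSubalgebra d).SeparatesPoints := by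
  classical
  intro x y hxy
  rw [Ne, funext_iff, not_forall] at hxy
  obtain ⟨i, hi⟩ := hxy
  refine ⟨_, ⟨charC (Pi.single i 1), Algebra.subset_adjoin ⟨Pi.single i 1, rfl⟩, rfl⟩, ?_⟩
  have key : ∀ z : Torus d, character (Pi.single i 1) z = fourier 1 (z i) := by
    intro z
    unfold character
    rw [Finset.prod_eq_single i]
    · simp
    · intro j _ hj; simp [Pi.single_eq_of_ne hj]
    · simp
  intro h
  replace h : character (Pi.single i 1) x = character (Pi.single i 1) y := h
  rw [key, key, fourier_one, fourier_one] at h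
  exact hi (AddCircle.injective_toCircle Real.two_pi_pos.ne' (Circle.ext h))

theorem span_charC_closure_eq_top :
    (Submodule.span ℂ (range <| charC (d := d))).topologicalClosure = ⊤ := by
  rw [← charSubalgebra_coe]
  exact congr_arg (Subalgebra.toSubmodule <| StarSubalgebra.toSubalgebra ·)
    (ContinuousMap.starSubalgebra_topologicalClosure_eq_top_of_separatesPoints _
      charSubalgebra_separatesPoints)

/-- Complex square integrable functions on the torus. -/
abbrev L2C (d : ℕ) : Type := Lp ℂ 2 (volume : Measure (Torus d))

/-- The normalized characters in `L²`. -/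
noncomputable def charL2 (k : Fin d → ℤ) : L2C d :=
  ((Real.sqrt (torusVol d))⁻¹ : ℂ) • ContinuousMap.toLp (E := ℂ) 2 volume ℂ (charC k)

theorem orthonormal_charL2 : Orthonormal ℂ (charL2 (d := d)) := by
  rw [orthonormal_iff_ite]
  intro m n
  rw [charL2, charL2, inner_smul_left, inner_smul_right, ContinuousMap.inner_toLp]
  have h : ∀ x : Torus d, charC n x * conj (charC m x) = character (n - m) x := by
    intro x
    rw [charC_apply, charC_apply, ← character_neg, ← character_add, sub_eq_add_neg]
  simp only [h, integral_character]
  have hv := torusVol_pos d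
  have hs : ((Real.sqrt (torusVol d) : ℝ) : ℂ) ≠ 0 := by
    exact_mod_cast (Real.sqrt_pos.mpr hv).ne'
  by_cases hmn : m = n
  · subst hmn
    simp only [sub_self, if_true, map_inv₀, Complex.conj_ofReal]
    have : (torusVol d : ℂ) = (Real.sqrt (torusVol d) : ℂ) * (Real.sqrt (torusVol d) : ℂ) := by
      rw [← Complex.ofReal_mul, Real.mul_self_sqrt hv.le]
    rw [this]
    field_simp
  · have : n - m ≠ 0 := sub_ne_zero.mpr (Ne.symm hmn)
    simp [this, hmn]

theorem span_charL2_closure_eq_top :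
    (Submodule.span ℂ (range (charL2 (d := d)))).topologicalClosure = ⊤ := by
  have h := (ContinuousMap.toLp_denseRange (E := ℂ) (p := 2) (μ := (volume : Measure (Torus d))) ℂ
    (by simp)).topologicalClosure_map_submodule (span_charC_closure_eq_top (d := d))
  rw [eq_top_iff, ← h]
  apply Submodule.topologicalClosure_mono
  rw [Submodule.map_span, Submodule.span_le]
  rintro _ ⟨_, ⟨k, rfl⟩, rfl⟩
  have hs : ((Real.sqrt (torusVol d) : ℝ) : ℂ) ≠ 0 := by
    exact_mod_cast (Real.sqrt_pos.mpr (torusVol_pos d)).ne'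
  have : ContinuousMap.toLp (E := ℂ) 2 volume ℂ (charC k) =
      ((Real.sqrt (torusVol d) : ℝ) : ℂ) • charL2 k := by
    rw [charL2, smul_smul, mul_inv_cancel₀ hs, one_smul]
  change ContinuousMap.toLp (E := ℂ) 2 volume ℂ (charC k) ∈ _
  rw [this]
  exact Submodule.smul_mem _ _ (Submodule.subset_span ⟨k, rfl⟩)

/-- The Fourier basis of `L²(𝕋^d, ℂ)`. -/
noncomputable def charBasis (d : ℕ) : HilbertBasis (Fin d → ℤ) ℂ (L2C d) :=
  HilbertBasis.mk orthonormal_charL2 span_charL2_closure_eq_top.ge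

theorem charBasis_apply (k : Fin d → ℤ) : charBasis d k = charL2 k := by
  rw [charBasis, HilbertBasis.coe_mk]

/-- The inclusion of real into complex `L²` functions. -/
noncomputable def complexify : L2 d →L[ℝ] L2C d := Complex.ofRealCLM.compLpL 2 volume

/-- The real part of a complex `L²` function. -/
noncomputable def realPart : L2C d →L[ℝ] L2 d := Complex.reCLM.compLpL 2 volume

theorem complexify_ae (f : L2 d) : (complexify f : Torus d → ℂ) =ᵐ[volume] fun x => (f x : ℂ) :=
  Complex.ofRealCLM.coeFn_compLpL f

theorem realPart_ae (f : L2C d) : (realPart f : Torus d → ℝ) =ᵐ[volume] fun x => (f x).re :=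
  Complex.reCLM.coeFn_compLpL f

theorem realPart_complexify (f : L2 d) : realPart (complexify f) = f := by
  apply Lp.ext
  filter_upwards [realPart_ae (complexify f), complexify_ae f] with x h1 h2
  rw [h1, h2, Complex.ofReal_re]

theorem norm_complexify (f : L2 d) : ‖complexify f‖ = ‖f‖ := by
  rw [Lp.norm_def, Lp.norm_def]
  congr 1
  apply eLpNorm_congr_norm_ae
  filter_upwards [complexify_ae f] with x hx
  rw [hx, Complex.norm_real]

theorem inner_charL2 (f : L2C d) (k : Fin d → ℤ) :
    inner ℂ (charL2 k) f =
      ((Real.sqrt (torusVol d))⁻¹ : ℂ) * ∫ x, f x * character (-k) x := by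
  rw [charL2, inner_smul_left, MeasureTheory.L2.inner_def]
  simp only [map_inv₀, Complex.conj_ofReal]
  congr 1
  apply integral_congr_ae
  filter_upwards [ContinuousMap.coeFn_toLp (p := 2) (𝕜 := ℂ) volume (charC k)] with x hx
  rw [hx, RCLike.inner_apply, character_neg, charC_apply]

/-- The `k`-th Fourier coefficient as a continuous linear functional. -/
noncomputable def coefCLM (k : Fin d → ℤ) : L2 d →L[ℝ] ℂ :=
  Real.sqrt (torusVol d) • ((innerSL ℂ (charL2 k)).restrictScalars ℝ).comp complexify

theorem repr_complexify (f : L2 d) (k : Fin d → ℤ) :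
    (charBasis d).repr (complexify f) k = ((Real.sqrt (torusVol d))⁻¹ : ℂ) * fourierCoef f k := by
  rw [HilbertBasis.repr_apply_apply, charBasis_apply, inner_charL2]
  congr 1
  apply integral_congr_ae
  filter_upwards [complexify_ae f] with x hx
  rw [hx]

theorem coefCLM_apply (k : Fin d → ℤ) (f : L2 d) : coefCLM k f = fourierCoef f k := by
  have h := repr_complexify f k
  rw [HilbertBasis.repr_apply_apply, charBasis_apply] at h
  have hs : ((Real.sqrt (torusVol d) : ℝ) : ℂ) ≠ 0 := by
    exact_mod_cast (Real.sqrt_pos.mpr (torusVol_pos d)).ne'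
  simp only [coefCLM, FunLike.coe_smul, Pi.smul_apply,
    ContinuousLinearMap.coe_comp, Function.comp_apply, ContinuousLinearMap.coe_restrictScalars',
    innerSL_apply_apply]
  rw [h, Complex.real_smul, mul_inv_cancel_left₀ hs]

theorem fourierCoef_add (f g : L2 d) (k : Fin d → ℤ) :
    fourierCoef (f + g : L2 d) k = fourierCoef f k + fourierCoef g k := by
  simp only [← coefCLM_apply, map_add]

theorem fourierCoef_sub (f g : L2 d) (k : Fin d → ℤ) :
    fourierCoef (f - g : L2 d) k = fourierCoef f k - fourierCoef g k := by
  simp only [← coefCLM_apply, map_sub]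

theorem fourierCoef_smul (c : ℝ) (f : L2 d) (k : Fin d → ℤ) :
    fourierCoef (c • f : L2 d) k = (c : ℂ) * fourierCoef f k := by
  simp only [← coefCLM_apply, map_smul, Complex.real_smul]

theorem fourierCoef_neg (f : Torus d → ℝ) (k : Fin d → ℤ) :
    fourierCoef f (-k) = conj (fourierCoef f k) := by
  rw [fourierCoef, fourierCoef, ← integral_conj]
  congr 1 with x
  rw [map_mul, Complex.conj_ofReal, character_neg (-k)]

theorem hasSum_sq_fourierCoef (f : L2 d) :
    HasSum (fun k => ‖fourierCoef f k‖ ^ 2) (torusVol d * ‖f‖ ^ 2) := by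
  have h := (lp.hasSum_norm (p := 2) (by norm_num) ((charBasis d).repr (complexify f)))
  rw [LinearIsometryEquiv.norm_map, norm_complexify] at h
  simp only [repr_complexify, norm_mul] at h
  have h2 := h.mul_left (torusVol d)
  have hv := torusVol_pos d
  simp only [norm_inv, Complex.norm_real, Real.norm_of_nonneg (Real.sqrt_nonneg _),
    ENNReal.toReal_ofNat, Real.rpow_two, mul_pow, inv_pow, Real.sq_sqrt hv.le,
    mul_inv_cancel_left₀ hv.ne'] at h2
  exact h2

theorem tsum_enorm_sq_fourierCoef (f : L2 d) :
    ∑' k, ‖fourierCoef f k‖ₑ ^ 2 = ENNReal.ofReal (torusVol d * ‖f‖ ^ 2) := by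
  rw [← (hasSum_sq_fourierCoef f).tsum_eq,
    ENNReal.ofReal_tsum_of_nonneg (fun _ => by positivity) (hasSum_sq_fourierCoef f).summable]
  congr 1 with k
  rw [ENNReal.ofReal_pow (norm_nonneg _), ofReal_norm]

theorem ext_fourierCoef {f g : L2 d} (h : ∀ k, fourierCoef f k = fourierCoef g k) : f = g := by
  have h1 := hasSum_sq_fourierCoef (f - g)
  simp only [fourierCoef_sub, h, sub_self, norm_zero] at h1
  have h2 : torusVol d * ‖f - g‖ ^ 2 = 0 := h1.unique (by simp [hasSum_zero])
  have hv := torusVol_pos d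
  have : ‖f - g‖ = 0 := by
    rcases mul_eq_zero.mp h2 with h3 | h3
    · exact absurd h3 hv.ne'
    · exact pow_eq_zero_iff (two_ne_zero) |>.mp h3
  exact sub_eq_zero.mp (norm_eq_zero.mp this)

/-- Since Re F = (F + conj F)/2, taking the real part symmetrizes the coefficients. A Hermitian
family is therefore left unchanged, which is how complex `L²` theory yields real functions. -/
theorem fourierCoef_realPart (F : L2C d) (k : Fin d → ℤ) :
    fourierCoef (realPart F) k =
      ((∫ x, F x * character (-k) x) + conj (∫ x, F x * character k x)) / 2 := by
  have hint : ∀ k : Fin d → ℤ, Integrable (fun x => F x * character k x) volume := by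
    intro k
    refine ((Lp.memLp F).integrable (by norm_num)).mul_bdd (c := 1) ?_ ?_
    · exact (charC k).continuous.aestronglyMeasurable
    · exact ae_of_all _ fun x => (norm_character k x).le
  have h2 : Integrable (fun x => conj (F x * character k x)) volume := by
    simpa using! (Complex.conjLIE.integrable_comp_iff (φ := fun x => F x * character k x)).mpr (hint k)
  rw [← integral_conj, ← integral_add (hint (-k)) h2, fourierCoef, ← integral_div]
  apply integral_congr_ae
  filter_upwards [realPart_ae F] with x hx
  rw [hx, map_mul, ← character_neg, Complex.re_eq_add_conj]
  ring

/-- Every square summable Hermitian family is the family of Fourier coefficients of a real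
`L²` function. -/
theorem exists_fourierCoef_eq (c : (Fin d → ℤ) → ℂ) (hc : ∑' k, ‖c k‖ₑ ^ 2 < ⊤)
    (hsym : ∀ k, c (-k) = conj (c k)) : ∃ g : L2 d, ∀ k, fourierCoef g k = c k := by
  have hs : ((Real.sqrt (torusVol d) : ℝ) : ℂ) ≠ 0 := by
    exact_mod_cast (Real.sqrt_pos.mpr (torusVol_pos d)).ne'
  have hsum : Summable fun k => ‖c k‖ ^ 2 := by
    have h := ENNReal.summable_toReal hc.ne
    simpa using h
  have hmem : Memℓp (fun k => ((Real.sqrt (torusVol d))⁻¹ : ℂ) * c k) 2 := by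
    apply memℓp_gen
    have := hsum.mul_left (‖((Real.sqrt (torusVol d))⁻¹ : ℂ)‖ ^ 2)
    simpa [mul_pow] using this
  set F : L2C d := (charBasis d).repr.symm ⟨_, hmem⟩ with hF
  have hFc : ∀ k, ∫ x, F x * character (-k) x = c k := by
    intro k
    have h1 : (charBasis d).repr F k = ((Real.sqrt (torusVol d))⁻¹ : ℂ) * c k := by
      rw [hF, LinearIsometryEquiv.apply_symm_apply]
    rw [HilbertBasis.repr_apply_apply, charBasis_apply, inner_charL2] at h1
    exact mul_left_cancel₀ (inv_ne_zero hs) h1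
  refine ⟨realPart F, fun k => ?_⟩
  have h2 := hFc (-k)
  rw [neg_neg] at h2
  rw [fourierCoef_realPart, hFc, h2, hsym, Complex.conj_conj]
  ring

/-- The partial Fourier sums are measurable in s and converge for each s. This is needed because
`fourierMul` picks its value by choice, so the Duhamel integrand is accessible only through its
coefficients. -/
theorem aestronglyMeasurable_of_fourierCoef {α : Type*} [MeasurableSpace α] {μ : Measure α}
    {φ : α → L2 d} (h : ∀ k, AEStronglyMeasurable (fun s => fourierCoef (φ s) k) μ) :
    AEStronglyMeasurable φ μ := by
  have h1 : AEStronglyMeasurable (fun s => complexify (φ s)) μ := by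
    refine aestronglyMeasurable_of_tendsto_ae (u := atTop)
      (f := fun (S : Finset (Fin d → ℤ)) s =>
        ∑ k ∈ S, (charBasis d).repr (complexify (φ s)) k • charBasis d k) ?_ ?_
    · intro S
      refine Finset.aestronglyMeasurable_fun_sum _ fun k _ => ?_
      simp only [repr_complexify]
      exact ((h k).const_mul _).smul_const _
    · exact ae_of_all _ fun s => (charBasis d).hasSum_repr _
  have h2 := realPart.continuous.comp_aestronglyMeasurable h1
  simpa only [Function.comp_def, realPart_complexify] using h2

end Characters

/-! ### Products as convolutions, and synthesis of absolutely summable series -/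

section ContinuousFunctions

variable {d : ℕ}

theorem fourierCoef_toLp (f : C(Torus d, ℝ)) (k : Fin d → ℤ) :
    fourierCoef (ContinuousMap.toLp (E := ℝ) 2 volume ℝ f : L2 d) k = fourierCoef f k := by
  apply integral_congr_ae
  filter_upwards [ContinuousMap.coeFn_toLp (p := 2) (𝕜 := ℝ) volume f] with x hx
  rw [hx]

theorem fourierCoef_sub_continuous (f g : C(Torus d, ℝ)) (k : Fin d → ℤ) :
    fourierCoef (f - g : C(Torus d, ℝ)) k = fourierCoef f k - fourierCoef g k := by
  simp only [← fourierCoef_toLp, map_sub, fourierCoef_sub]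

theorem fourierCoef_add_continuous (f g : C(Torus d, ℝ)) (k : Fin d → ℤ) :
    fourierCoef (f + g : C(Torus d, ℝ)) k = fourierCoef f k + fourierCoef g k := by
  simp only [← fourierCoef_toLp, map_add, fourierCoef_add]

theorem fourierCoef_sum_continuous {ι : Type*} (s : Finset ι) (f : ι → C(Torus d, ℝ))
    (k : Fin d → ℤ) :
    fourierCoef (∑ i ∈ s, f i : C(Torus d, ℝ)) k = ∑ i ∈ s, fourierCoef (f i) k := by
  simp only [← fourierCoef_toLp, ← coefCLM_apply, map_sum]

theorem continuous_fourierCoef_continuousMap (k : Fin d → ℤ) :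
    Continuous fun f : C(Torus d, ℝ) => fourierCoef f k := by
  have h := (coefCLM k).continuous.comp
    (ContinuousMap.toLp (E := ℝ) 2 (volume : Measure (Torus d)) ℝ).continuous
  simpa only [Function.comp_def, coefCLM_apply, fourierCoef_toLp] using h

theorem inner_charL2_toLp (f : C(Torus d, ℂ)) (k : Fin d → ℤ) :
    inner ℂ (charL2 k) (ContinuousMap.toLp (E := ℂ) 2 volume ℂ f) =
      ((Real.sqrt (torusVol d))⁻¹ : ℂ) * ∫ x, f x * character (-k) x := by
  rw [inner_charL2]
  congr 1
  apply integral_congr_ae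
  filter_upwards [ContinuousMap.coeFn_toLp (p := 2) (𝕜 := ℂ) volume f] with x hx
  rw [hx]

/-- A real continuous function regarded as complex valued. -/
noncomputable def ofRealC (f : C(Torus d, ℝ)) : C(Torus d, ℂ) :=
  ⟨fun x => (f x : ℂ), by fun_prop⟩

/-- Parseval applied to the inner product of f with g e^{-ik·x}. The factor 1/vol comes from the two
normalizations 1/√vol of the basis. -/
theorem hasSum_fourierCoef_mul (f g : C(Torus d, ℝ)) (k : Fin d → ℤ) :
    HasSum (fun l => ((torusVol d)⁻¹ : ℂ) * (fourierCoef f l * fourierCoef g (k - l)))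
      (fourierCoef (f * g : C(Torus d, ℝ)) k) := by
  have h := (charBasis d).hasSum_inner_mul_inner
    (ContinuousMap.toLp (E := ℂ) 2 volume ℂ (ofRealC f))
    (ContinuousMap.toLp (E := ℂ) 2 volume ℂ (ofRealC g * charC (-k)))
  have hv := torusVol_pos d
  have hvv : ((Real.sqrt (torusVol d))⁻¹ : ℂ) * ((Real.sqrt (torusVol d))⁻¹ : ℂ) =
      ((torusVol d)⁻¹ : ℂ) := by
    rw [← mul_inv, ← Complex.ofReal_mul, Real.mul_self_sqrt hv.le]
  rw [ContinuousMap.inner_toLp] at h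
  have h0 : ∫ x, (ofRealC g * charC (-k)) x * conj (ofRealC f x) =
      fourierCoef (f * g : C(Torus d, ℝ)) k := by
    rw [fourierCoef]
    congr 1 with x
    simp only [ofRealC, ContinuousMap.mul_apply, ContinuousMap.coe_mk, Complex.conj_ofReal,
      charC_apply, Complex.ofReal_mul]
    ring
  rw [h0] at h
  have h1 : ∀ l, inner ℂ (ContinuousMap.toLp (E := ℂ) 2 volume ℂ (ofRealC f)) (charBasis d l) =
      ((Real.sqrt (torusVol d))⁻¹ : ℂ) * fourierCoef f (-l) := by
    intro l
    rw [← inner_conj_symm, charBasis_apply, inner_charL2_toLp, map_mul, fourierCoef_neg, map_inv₀,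
      Complex.conj_ofReal]
    rfl
  have h2 : ∀ l, inner ℂ (charBasis d l)
      (ContinuousMap.toLp (E := ℂ) 2 volume ℂ (ofRealC g * charC (-k))) =
      ((Real.sqrt (torusVol d))⁻¹ : ℂ) * fourierCoef g (k + l) := by
    intro l
    rw [charBasis_apply, inner_charL2_toLp, fourierCoef]
    congr 2 with x
    simp only [ContinuousMap.mul_apply, charC_apply, mul_assoc, ← character_add, ofRealC,
      ContinuousMap.coe_mk, neg_add]
  simp only [h1, h2] at h
  rw [← (Equiv.neg (Fin d → ℤ)).hasSum_iff] at h
  refine HasSum.congr_fun h fun l => ?_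
  simp only [Function.comp_apply, Equiv.neg_apply, neg_neg, ← sub_eq_add_neg, ← hvv]
  ring

theorem enorm_fourierCoef_mul_le (f g : C(Torus d, ℝ)) (k : Fin d → ℤ) :
    ‖fourierCoef (f * g : C(Torus d, ℝ)) k‖ₑ ≤ ENNReal.ofReal (torusVol d)⁻¹ *
      ∑' l, ‖fourierCoef f l‖ₑ * ‖fourierCoef g (k - l)‖ₑ := by
  rw [← (hasSum_fourierCoef_mul f g k).tsum_eq, ← ENNReal.tsum_mul_left]
  refine (enorm_tsum_le_tsum_enorm).trans (le_of_eq ?_)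
  congr 1 with l
  rw [enorm_mul, enorm_mul]
  congr 1
  rw [← Complex.ofReal_inv, ← ofReal_norm, Complex.norm_real,
    Real.norm_of_nonneg (inv_nonneg.mpr (torusVol_pos d).le)]

theorem summable_smul_charC {c : (Fin d → ℤ) → ℂ} (hc : Summable fun k => ‖c k‖) :
    Summable fun k => c k • charC k := by
  refine Summable.of_norm_bounded hc fun k => ?_
  rw [norm_smul]
  exact mul_le_of_le_one_right (norm_nonneg _) (norm_charC_le k)

/-- The real part of the trigonometric series with Fourier coefficients `c`. -/
noncomputable def synth (c : (Fin d → ℤ) → ℂ) : C(Torus d, ℝ) :=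
  ⟨fun x => (torusVol d)⁻¹ * ((∑' k, c k • charC k : C(Torus d, ℂ)) x).re, by fun_prop⟩

theorem norm_synth_sub_le {c c' : (Fin d → ℤ) → ℂ} (hc : Summable fun k => ‖c k‖)
    (hc' : Summable fun k => ‖c' k‖) :
    ‖synth c - synth c'‖ ≤ (torusVol d)⁻¹ * ∑' k, ‖c k - c' k‖ := by
  have hv := torusVol_pos d
  have hs : Summable fun k => ‖c k - c' k‖ :=
    Summable.of_nonneg_of_le (fun _ => norm_nonneg _) (fun k => norm_sub_le _ _) (hc.add hc')
  have h0 : 0 ≤ ∑' k, ‖c k - c' k‖ := tsum_nonneg fun _ => norm_nonneg _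
  refine (ContinuousMap.norm_le _ (by positivity)).mpr fun x => ?_
  simp only [ContinuousMap.sub_apply, synth, ContinuousMap.coe_mk]
  rw [← mul_sub, ← Complex.sub_re, ← ContinuousMap.sub_apply,
    ← (summable_smul_charC hc).tsum_sub (summable_smul_charC hc'), norm_mul, Real.norm_of_nonneg
    (inv_nonneg.mpr hv.le)]
  gcongr
  refine (Complex.abs_re_le_norm _).trans ((ContinuousMap.norm_coe_le_norm _ x).trans ?_)
  refine tsum_of_norm_bounded hs.hasSum fun k => ?_
  rw [← sub_smul, norm_smul]
  exact mul_le_of_le_one_right (norm_nonneg _) (norm_charC_le k)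

theorem synth_zero : synth (fun _ : Fin d → ℤ => 0) = 0 := by
  ext x
  simp [synth]

theorem norm_synth_le {c : (Fin d → ℤ) → ℂ} (hc : Summable fun k => ‖c k‖) :
    ‖synth c‖ ≤ (torusVol d)⁻¹ * ∑' k, ‖c k‖ := by
  simpa [synth_zero] using norm_synth_sub_le hc (c' := fun _ => 0) (by simp)

/-- The series converges uniformly, so coefficients may be taken term by term; Hermitian symmetry
makes the real part in `synth` harmless. -/
theorem fourierCoef_synth {c : (Fin d → ℤ) → ℂ} (hc : Summable fun k => ‖c k‖)
    (hsym : ∀ k, c (-k) = conj (c k)) (k : Fin d → ℤ) : fourierCoef (synth c) k = c k := by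
  have hv := torusVol_pos d
  have hv0 : (torusVol d : ℂ) ≠ 0 := by exact_mod_cast hv.ne'
  have hs : ((Real.sqrt (torusVol d) : ℝ) : ℂ) ≠ 0 := by
    exact_mod_cast (Real.sqrt_pos.mpr hv).ne'
  set S : C(Torus d, ℂ) := ∑' k, c k • charC k with hS
  have hcoef : ∀ k, ∫ x, S x * character (-k) x = torusVol d * c k := by
    intro k
    let Λ : C(Torus d, ℂ) →L[ℂ] ℂ := (innerSL ℂ (charL2 k)).comp
      (ContinuousMap.toLp (E := ℂ) 2 volume ℂ)
    have hΛ : ∀ f : C(Torus d, ℂ), Λ f =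
        ((Real.sqrt (torusVol d))⁻¹ : ℂ) * ∫ x, f x * character (-k) x := fun f =>
      inner_charL2_toLp f k
    have h1 := (summable_smul_charC hc).hasSum.mapL Λ
    rw [← hS] at h1
    have h2 : ∀ l, Λ (c l • charC l) =
        ((Real.sqrt (torusVol d))⁻¹ : ℂ) * if l = k then torusVol d * c k else 0 := by
      intro l
      rw [hΛ]
      congr 1
      simp only [ContinuousMap.smul_apply, smul_eq_mul, charC_apply, mul_assoc, ← character_add]
      rw [integral_const_mul, integral_character]
      by_cases h : l = k
      · subst h; simp [mul_comm]
      · have : l + -k ≠ 0 := by rw [← sub_eq_add_neg]; exact sub_ne_zero.mpr h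
        simp [this, h]
    simp only [h2, hΛ] at h1
    have h3 := (hasSum_mul_left_iff (inv_ne_zero hs)).mp h1
    exact h3.unique (hasSum_ite_eq k _)
  have hre : realPart (ContinuousMap.toLp (E := ℂ) 2 volume ℂ S) =
      torusVol d • ContinuousMap.toLp (E := ℝ) 2 volume ℝ (synth c) := by
    apply Lp.ext
    filter_upwards [realPart_ae (ContinuousMap.toLp (E := ℂ) 2 volume ℂ S),
      ContinuousMap.coeFn_toLp (p := 2) (𝕜 := ℂ) volume S,
      ContinuousMap.coeFn_toLp (p := 2) (𝕜 := ℝ) volume (synth c),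
      Lp.coeFn_smul (torusVol d) (ContinuousMap.toLp (E := ℝ) 2 volume ℝ (synth c) : L2 d)]
      with x h1 h2 h3 h4
    rw [h1, h2, h4, Pi.smul_apply, h3]
    simp only [synth, ContinuousMap.coe_mk, smul_eq_mul, ← hS]
    rw [mul_inv_cancel_left₀ hv.ne']
  have h5 := congrArg (fun f : L2 d => fourierCoef f k) hre
  simp only [fourierCoef_smul, fourierCoef_toLp] at h5
  rw [fourierCoef_realPart] at h5
  have h6 : ∀ k, ∫ x, (ContinuousMap.toLp (E := ℂ) 2 volume ℂ S : L2C d) x * character k x =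
      torusVol d * c (-k) := by
    intro k
    rw [← hcoef (-k), neg_neg]
    apply integral_congr_ae
    filter_upwards [ContinuousMap.coeFn_toLp (p := 2) (𝕜 := ℂ) volume S] with x hx
    rw [hx]
  rw [h6, h6, hsym k, neg_neg, map_mul, Complex.conj_conj, Complex.conj_ofReal] at h5
  apply mul_left_cancel₀ hv0
  rw [← h5]
  ring

end ContinuousFunctions

/-! ### Cauchy–Schwarz, Minkowski, Young and Beta integral bounds in `ℝ≥0∞` -/

section Inequalities

theorem ennreal_sqrt_sq (x : ℝ≥0∞) : (x ^ (1 / 2 : ℝ)) ^ 2 = x := by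
  rw [← ENNReal.rpow_two, ← ENNReal.rpow_mul]; norm_num

theorem ennreal_sq_sqrt (x : ℝ≥0∞) : (x ^ 2) ^ (1 / 2 : ℝ) = x := by
  rw [← ENNReal.rpow_two, ← ENNReal.rpow_mul]; norm_num

theorem ennreal_le_of_sq_le {x y : ℝ≥0∞} (h : x ^ 2 ≤ y ^ 2) : x ≤ y := by
  have := ENNReal.rpow_le_rpow h (by norm_num : (0 : ℝ) ≤ 1 / 2)
  rwa [ennreal_sq_sqrt, ennreal_sq_sqrt] at this

theorem ennreal_add_sq_le (x y : ℝ≥0∞) : (x + y) ^ 2 ≤ 2 * x ^ 2 + 2 * y ^ 2 := by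
  have := ENNReal.rpow_add_le_mul_rpow_add_rpow x y (p := 2) (by norm_num)
  simp only [ENNReal.rpow_two] at this
  norm_num at this
  rwa [mul_add] at this

theorem sq_sum_mul_le {ι : Type*} (s : Finset ι) (f g : ι → ℝ≥0∞) :
    (∑ i ∈ s, f i * g i) ^ 2 ≤ (∑ i ∈ s, f i ^ 2) * ∑ i ∈ s, g i ^ 2 := by
  have h := ENNReal.inner_le_Lp_mul_Lq s f g (p := 2) (q := 2) Real.HolderConjugate.two_two
  calc (∑ i ∈ s, f i * g i) ^ 2 ≤ ((∑ i ∈ s, f i ^ (2 : ℝ)) ^ (1 / 2 : ℝ) *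
        (∑ i ∈ s, g i ^ (2 : ℝ)) ^ (1 / 2 : ℝ)) ^ 2 := by gcongr
    _ = _ := by rw [mul_pow, ennreal_sqrt_sq, ennreal_sqrt_sq]; simp only [ENNReal.rpow_two]

theorem sq_tsum_mul_le {ι : Type*} (f g : ι → ℝ≥0∞) :
    (∑' i, f i * g i) ^ 2 ≤ (∑' i, f i ^ 2) * ∑' i, g i ^ 2 := by
  have h : ∑' i, f i * g i ≤ ((∑' i, f i ^ 2) * ∑' i, g i ^ 2) ^ (1 / 2 : ℝ) := by
    rw [ENNReal.tsum_eq_iSup_sum]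
    refine iSup_le fun s => ennreal_le_of_sq_le ?_
    rw [ennreal_sqrt_sq]
    exact (sq_sum_mul_le s f g).trans (by gcongr <;> exact ENNReal.sum_le_tsum s)
  calc _ ≤ (((∑' i, f i ^ 2) * ∑' i, g i ^ 2) ^ (1 / 2 : ℝ)) ^ 2 := by gcongr
    _ = _ := ennreal_sqrt_sq _

/-- Minkowski's integral inequality in `ℓ²`. -/
theorem tsum_sq_lintegral_le {α ι : Type*} [MeasurableSpace α] {μ : Measure α}
    {G : α → ι → ℝ≥0∞} {g : α → ℝ≥0∞} (hG : ∀ i, AEMeasurable (fun s => G s i) μ)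
    (h : ∀ᵐ s ∂μ, ∑' i, G s i ^ 2 ≤ g s ^ 2) :
    ∑' i, (∫⁻ s, G s i ∂μ) ^ 2 ≤ (∫⁻ s, g s ∂μ) ^ 2 := by
  by_cases hfin : ∫⁻ s, g s ∂μ = ⊤
  · simp [hfin]
  rw [ENNReal.tsum_eq_iSup_sum]
  refine iSup_le fun S => ?_
  set I : ι → ℝ≥0∞ := fun i => ∫⁻ s, G s i ∂μ with hI
  have hI_fin : ∀ i, I i ≠ ⊤ := fun i => ne_top_of_le_ne_top hfin (lintegral_mono_ae (by
    filter_upwards [h] with s hs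
    exact ennreal_le_of_sq_le ((ENNReal.le_tsum i).trans hs)))
  set X := ∑ i ∈ S, I i ^ 2 with hX
  have hXfin : X ≠ ⊤ := ENNReal.sum_ne_top.mpr fun i _ => ENNReal.pow_ne_top (hI_fin i)
  -- Duality: pair the vector (I i) with itself, move one copy under the integral and apply
  -- Cauchy–Schwarz for each s. Restricting to a finite set keeps X finite, so √X can be cancelled.
  have key : X ≤ X ^ (1 / 2 : ℝ) * ∫⁻ s, g s ∂μ := by
    calc X = ∑ i ∈ S, ∫⁻ s, I i * G s i ∂μ := by
          refine Finset.sum_congr rfl fun i _ => ?_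
          rw [lintegral_const_mul' _ _ (hI_fin i), sq]
      _ = ∫⁻ s, ∑ i ∈ S, I i * G s i ∂μ := by
          rw [lintegral_finsetSum' _ fun i _ => (hG i).const_mul _]
      _ ≤ ∫⁻ s, X ^ (1 / 2 : ℝ) * g s ∂μ := by
          refine lintegral_mono_ae ?_
          filter_upwards [h] with s hs
          refine ennreal_le_of_sq_le ((sq_sum_mul_le S _ _).trans ?_)
          rw [mul_pow, ennreal_sqrt_sq]
          gcongr
          exact (ENNReal.sum_le_tsum S).trans hs
      _ = _ := lintegral_const_mul' _ _ (ENNReal.rpow_ne_top_of_nonneg (by norm_num) hXfin)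
  by_cases hX0 : X = 0
  · rw [hX0]; exact zero_le
  have hs0 : X ^ (1 / 2 : ℝ) ≠ 0 := by
    intro h0
    have := ennreal_sqrt_sq X
    rw [h0] at this
    exact hX0 (by rw [← this]; simp)
  have hst : X ^ (1 / 2 : ℝ) ≠ ⊤ := ENNReal.rpow_ne_top_of_nonneg (by norm_num) hXfin
  have h2 : X ^ (1 / 2 : ℝ) ≤ ∫⁻ s, g s ∂μ := by
    have h3 : X ^ (1 / 2 : ℝ) * X ^ (1 / 2 : ℝ) ≤ X ^ (1 / 2 : ℝ) * ∫⁻ s, g s ∂μ := by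
      rw [← sq, ennreal_sqrt_sq]; exact key
    exact (ENNReal.mul_le_mul_iff_right hs0 hst).mp h3
  calc X = (X ^ (1 / 2 : ℝ)) ^ 2 := (ennreal_sqrt_sq X).symm
    _ ≤ _ := by gcongr

/-- Young's inequality `ℓ¹ * ℓ² ⊆ ℓ²`. -/
theorem tsum_sq_conv_le {Z : Type*} [AddCommGroup Z] (A B : Z → ℝ≥0∞) :
    ∑' k, (∑' l, A l * B (k - l)) ^ 2 ≤ (∑' l, A l) ^ 2 * ∑' k, B k ^ 2 := by
  let _ : MeasurableSpace Z := ⊤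
  have hm : ∀ f : Z → ℝ≥0∞, Measurable f := fun f _ _ => trivial
  -- Minkowski over the shift l with counting measure; every translate of B has the same ℓ² norm.
  have h := tsum_sq_lintegral_le (μ := (Measure.count : Measure Z))
    (G := fun l k => A l * B (k - l)) (g := fun l => A l * (∑' k, B k ^ 2) ^ (1 / 2 : ℝ))
    (fun k => (hm _).aemeasurable) (ae_of_all _ fun l => by
      simp only [mul_pow, ENNReal.tsum_mul_left, ennreal_sqrt_sq]
      exact le_of_eq (congrArg _ ((Equiv.subRight l).tsum_eq (fun k => B k ^ 2))))
  simp only [lintegral_count] at h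
  rw [ENNReal.tsum_mul_right, mul_pow, ennreal_sqrt_sq] at h
  exact h

theorem tsum_conv_comm {Z : Type*} [AddCommGroup Z] (A B : Z → ℝ≥0∞) (k : Z) :
    ∑' l, A l * B (k - l) = ∑' l, B l * A (k - l) := by
  rw [← (Equiv.subLeft k).tsum_eq]
  refine tsum_congr fun l => ?_
  simp [mul_comm]

/-- A bound for the Beta integral on `(0,t)`. -/
theorem exists_lintegral_beta_le {α β : ℝ} (hα0 : 0 ≤ α) (hα : α < 1) (hβ0 : 0 ≤ β)
    (hβ : β < 1) : ∃ C : ℝ, 0 < C ∧ ∀ t : ℝ, 0 < t →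
      ∫⁻ s in Ioo 0 t, ENNReal.ofReal ((t - s) ^ (-α) * s ^ (-β)) ≤
        ENNReal.ofReal (C * t ^ (1 - α - β)) := by
  have h1α : 0 < 1 - α := by linarith
  have h1β : 0 < 1 - β := by linarith
  refine ⟨2 ^ α / (1 - β) + 2 ^ β / (1 - α), by positivity, fun t ht => ?_⟩
  have hi : ∀ γ : ℝ, γ < 1 → IntervalIntegrable (fun s : ℝ => s ^ (-γ)) volume 0 t := fun γ hγ =>
    intervalIntegral.intervalIntegrable_rpow' (by linarith)
  have hi' : IntervalIntegrable (fun s : ℝ => (t - s) ^ (-α)) volume 0 t := by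
    have := (hi α hα).comp_sub_left t
    simp only [sub_zero, sub_self] at this
    exact this.symm
  have hv : ∀ γ : ℝ, γ < 1 → ∫ s in (0 : ℝ)..t, s ^ (-γ) = t ^ (1 - γ) / (1 - γ) := by
    intro γ hγ
    rw [integral_rpow (Or.inl (by linarith)), Real.zero_rpow (by linarith), sub_zero]
    ring_nf
  have hv' : ∫ s in (0 : ℝ)..t, (t - s) ^ (-α) = t ^ (1 - α) / (1 - α) := by
    have := intervalIntegral.integral_comp_sub_left (fun s : ℝ => s ^ (-α)) t (a := 0) (b := t)
    rw [this]
    simpa using hv α hα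
  have hI : IntervalIntegrable (fun s : ℝ => (t / 2) ^ (-α) * s ^ (-β) +
      (t / 2) ^ (-β) * (t - s) ^ (-α)) volume 0 t :=
    ((hi β hβ).const_mul _).add (hi'.const_mul _)
  calc ∫⁻ s in Ioo 0 t, ENNReal.ofReal ((t - s) ^ (-α) * s ^ (-β))
      ≤ ∫⁻ s in Ioo 0 t, ENNReal.ofReal ((t / 2) ^ (-α) * s ^ (-β) +
          (t / 2) ^ (-β) * (t - s) ^ (-α)) := by
        refine setLIntegral_mono' measurableSet_Ioo fun s hs => ENNReal.ofReal_le_ofReal ?_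
        have hs1 : 0 < s := hs.1
        have hs2 : 0 < t - s := by linarith [hs.2]
        have ht2 : 0 < t / 2 := by linarith
        -- On each half of (0,t) only one factor is singular, and the other is at most its value at
        -- t/2. Adding the two bounds avoids splitting the integral.
        rcases le_total s (t / 2) with h | h
        · have : (t - s) ^ (-α) ≤ (t / 2) ^ (-α) :=
            Real.rpow_le_rpow_of_nonpos ht2 (by linarith) (by linarith)
          have h2 : 0 ≤ (t / 2) ^ (-β) * (t - s) ^ (-α) := by positivity
          have h3 : 0 ≤ s ^ (-β) := by positivity
          nlinarith
        · have : s ^ (-β) ≤ (t / 2) ^ (-β) :=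
            Real.rpow_le_rpow_of_nonpos ht2 (by linarith) (by linarith)
          have h2 : 0 ≤ (t / 2) ^ (-α) * s ^ (-β) := by positivity
          have h3 : 0 ≤ (t - s) ^ (-α) := by positivity
          nlinarith
    _ = ENNReal.ofReal (∫ s in (0 : ℝ)..t, ((t / 2) ^ (-α) * s ^ (-β) +
          (t / 2) ^ (-β) * (t - s) ^ (-α))) := by
        rw [intervalIntegral.integral_of_le ht.le, integral_Ioc_eq_integral_Ioo,
          ofReal_integral_eq_lintegral_ofReal]
        · exact ((intervalIntegrable_iff_integrableOn_Ioo_of_le ht.le).mp hI)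
        · refine (ae_restrict_iff' measurableSet_Ioo).mpr (ae_of_all _ fun s hs => ?_)
          have hs1 : 0 < s := hs.1
          have hs2 : 0 < t - s := by linarith [hs.2]
          change 0 ≤ (t / 2) ^ (-α) * s ^ (-β) + (t / 2) ^ (-β) * (t - s) ^ (-α)
          positivity
    _ = _ := by
        congr 1
        rw [intervalIntegral.integral_add ((hi β hβ).const_mul _) (hi'.const_mul _),
          intervalIntegral.integral_const_mul, intervalIntegral.integral_const_mul, hv β hβ, hv',
          Real.div_rpow ht.le two_pos.le, Real.div_rpow ht.le two_pos.le,
          Real.rpow_neg two_pos.le, Real.rpow_neg two_pos.le]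
        have e1 : t ^ (1 - α - β) = t ^ (-α) * t ^ (1 - β) := by
          rw [← Real.rpow_add ht]; ring_nf
        have e2 : t ^ (-β) * t ^ (1 - α) = t ^ (-α) * t ^ (1 - β) := by
          rw [← Real.rpow_add ht, ← Real.rpow_add ht]; ring_nf
        have p1 : (2 : ℝ) ^ α ≠ 0 := by positivity
        have p2 : (2 : ℝ) ^ β ≠ 0 := by positivity
        rw [e1]
        field_simp
        linear_combination (2 ^ β * (1 - β)) * e2

end Inequalities

/-! ### Lattice sums and the weighted convolution algebra -/

section Lattice

variable {d : ℕ}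

theorem pow_succ_sub_pow_succ_le {x y : ℝ} (hy : 0 ≤ y) (hxy : y ≤ x) (n : ℕ) :
    x ^ (n + 1) - y ^ (n + 1) ≤ (n + 1) * (x - y) * x ^ n := by
  induction n with
  | zero => simp
  | succ n ih =>
    have h1 : y ^ (n + 1) ≤ x ^ (n + 1) := by gcongr
    have h2 := mul_le_mul_of_nonneg_left ih (hy.trans hxy)
    have h3 := mul_le_mul_of_nonneg_left h1 (sub_nonneg.mpr hxy)
    push_cast
    calc x ^ (n + 1 + 1) - y ^ (n + 1 + 1)
        = x * (x ^ (n + 1) - y ^ (n + 1)) + (x - y) * y ^ (n + 1) := by ring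
      _ ≤ x * ((n + 1) * (x - y) * x ^ n) + (x - y) * x ^ (n + 1) := add_le_add h2 h3
      _ = _ := by ring

/-- The number of lattice points of sup norm in `[n, n+1)`. -/
theorem encard_shell_le (hd : 1 ≤ d) (n : ℕ) :
    ({k : Fin d → ℤ | ⌊‖k‖⌋₊ = n}.encard : ℝ≥0∞) ≤
      ENNReal.ofReal (2 * d * 2 ^ (d - 1) * (1 + n) ^ (d - 1)) := by
  classical
  obtain ⟨e, rfl⟩ : ∃ e, d = e + 1 := ⟨d - 1, by omega⟩
  have hmem : ∀ (k : Fin (e + 1) → ℤ) (m : ℕ), ‖k‖ < m + 1 →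
      k ∈ Fintype.piFinset fun _ => Finset.Icc (-(m : ℤ)) m := by
    intro k m hk
    rw [Fintype.mem_piFinset]
    intro i
    have h1 : ‖k i‖ < m + 1 := (norm_le_pi_norm k i).trans_lt hk
    rw [Int.norm_eq_abs] at h1
    have h2 : |k i| < m + 1 := by exact_mod_cast h1
    rw [Finset.mem_Icc, ← abs_le]
    omega
  have hcard : ∀ m : ℕ, (Fintype.piFinset fun _ : Fin (e + 1) => Finset.Icc (-(m : ℤ)) m).card =
      (2 * m + 1) ^ (e + 1) := by
    intro m
    rw [Fintype.card_piFinset]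
    simp only [Int.card_Icc, Finset.prod_const, Finset.card_univ, Fintype.card_fin]
    congr 1
    omega
  rcases Nat.eq_zero_or_pos n with rfl | hn
  · have hsub : {k : Fin (e + 1) → ℤ | ⌊‖k‖⌋₊ = 0} ⊆
        (Fintype.piFinset fun _ : Fin (e + 1) => Finset.Icc (-((0 : ℕ) : ℤ)) (0 : ℕ) :
          Finset (Fin (e + 1) → ℤ)) := by
      intro k hk
      apply hmem
      have := Nat.floor_eq_zero.mp hk
      simpa using this
    have h2 := encard_le_encard hsub
    rw [encard_coe_eq_coe_finsetCard, hcard] at h2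
    have h3 : (({k : Fin (e + 1) → ℤ | ⌊‖k‖⌋₊ = 0}.encard : ℕ∞) : ℝ≥0∞) ≤ 1 := by
      simpa using (ENat.toENNReal_le.mpr h2)
    refine h3.trans ?_
    rw [ENNReal.one_le_ofReal]
    have : (1 : ℝ) ≤ 2 ^ e := one_le_pow₀ (by norm_num)
    push_cast
    simp only [add_zero, one_pow, mul_one]
    nlinarith [(Nat.cast_nonneg e : (0 : ℝ) ≤ e)]
  · obtain ⟨m, rfl⟩ : ∃ m, n = m + 1 := ⟨n - 1, by omega⟩
    set P : ℕ → Finset (Fin (e + 1) → ℤ) := fun m =>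
      Fintype.piFinset fun _ : Fin (e + 1) => Finset.Icc (-(m : ℤ)) m with hP
    -- The shell is contained in the difference of two consecutive cubes, so its size is a
    -- difference of consecutive odd numbers raised to the power d, of order n^{d-1}.
    have hsub : {k : Fin (e + 1) → ℤ | ⌊‖k‖⌋₊ = m + 1} ⊆ ((P (m + 1) \ P m : Finset _) : Set _) := by
      intro k hk
      have hk' : ⌊‖k‖⌋₊ = m + 1 := hk
      rw [Nat.floor_eq_iff (norm_nonneg k)] at hk'
      rw [Finset.mem_coe, Finset.mem_sdiff]
      refine ⟨hmem k (m + 1) hk'.2, fun hkm => ?_⟩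
      have : ‖k‖ ≤ m := by
        refine (pi_norm_le_iff_of_nonneg (Nat.cast_nonneg m)).mpr fun i => ?_
        have h1 := Finset.mem_Icc.mp ((Fintype.mem_piFinset.mp hkm) i)
        rw [Int.norm_eq_abs]
        exact_mod_cast abs_le.mpr h1
      have h3 := hk'.1
      push_cast at h3
      linarith
    have hPsub : P m ⊆ P (m + 1) := Fintype.piFinset_subset _ _ fun _ =>
      Finset.Icc_subset_Icc (by push_cast; omega) (by push_cast; omega)
    have h2 := encard_le_encard hsub
    rw [encard_coe_eq_coe_finsetCard, Finset.card_sdiff_of_subset hPsub, hcard, hcard] at h2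
    have h3 := ENat.toENNReal_le.mpr h2
    refine h3.trans ?_
    have hle : (2 * m + 1) ^ (e + 1) ≤ (2 * (m + 1) + 1) ^ (e + 1) := by gcongr; omega
    have h4 := pow_succ_sub_pow_succ_le (x := 2 * (m + 1) + 1) (y := 2 * m + 1) (by positivity)
      (by linarith) e
    have h5 : (2 * ((m : ℝ) + 1) + 1) ^ e ≤ 2 ^ e * (1 + (m + 1)) ^ e := by
      rw [← mul_pow]; gcongr; linarith
    have h6 : (((2 * (m + 1) + 1) ^ (e + 1) - (2 * m + 1) ^ (e + 1) : ℕ) : ℝ) ≤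
        2 * (e + 1) * 2 ^ e * (1 + (m + 1)) ^ e := by
      rw [Nat.cast_sub hle]
      push_cast
      refine h4.trans ?_
      have : ((e : ℝ) + 1) * (2 * (m + 1) + 1 - (2 * m + 1)) = 2 * (e + 1) := by ring
      rw [this, mul_assoc (2 * ((e : ℝ) + 1))]
      gcongr
    rw [ENat.toENNReal_coe, ← ENNReal.ofReal_natCast]
    apply ENNReal.ofReal_le_ofReal
    push_cast at h6 ⊢
    simpa using h6

theorem tsum_inv_sq_le {a : ℝ} (ha : 0 < a) (ha1 : a ≤ 1) :
    ∑' n : ℕ, ENNReal.ofReal (1 / (1 + a * n) ^ 2) ≤ ENNReal.ofReal (2 / a) := by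
  have hpos : ∀ n : ℕ, 0 < 1 + a * n := fun n => by positivity
  -- Comparison with a telescoping sum: 1/(1+a(i+1))² is at most 1/a times the decrease of 1/(1+ai).
  -- The first term 1 is absorbed through a ≤ 1.
  have hsum : ∀ m : ℕ, ∑ i ∈ Finset.range (m + 1), 1 / (1 + a * i) ^ 2 ≤
      1 + 1 / a - 1 / a * (1 / (1 + a * m)) := by
    intro m
    induction m with
    | zero => simp
    | succ m ih =>
      rw [Finset.sum_range_succ]
      refine (add_le_add_left ih _).trans ?_
      have h1 := hpos m
      have h2 := hpos (m + 1)
      push_cast at *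
      have e3 : 1 / a * (1 / (1 + a * (m : ℝ))) - 1 / a * (1 / (1 + a * (m + 1))) =
          1 / ((1 + a * m) * (1 + a * (m + 1))) := by
        field_simp; ring
      have e4 : 1 / (1 + a * ((m : ℝ) + 1)) ^ 2 ≤ 1 / ((1 + a * m) * (1 + a * (m + 1))) := by
        apply one_div_le_one_div_of_le (by positivity)
        rw [sq]; gcongr; linarith
      linarith
  rw [ENNReal.tsum_eq_iSup_nat]
  refine iSup_le fun n => ?_
  rw [← ENNReal.ofReal_sum_of_nonneg fun i _ => by positivity]
  apply ENNReal.ofReal_le_ofReal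
  have h0 : ∑ i ∈ Finset.range n, 1 / (1 + a * (i : ℝ)) ^ 2 ≤
      ∑ i ∈ Finset.range (n + 1), 1 / (1 + a * (i : ℝ)) ^ 2 :=
    Finset.sum_le_sum_of_subset_of_nonneg (Finset.range_mono n.le_succ) fun i _ _ => by positivity
  have h1 : 1 ≤ 1 / a := by rw [le_div_iff₀ ha]; linarith
  have h2 : 2 / a = 1 / a + 1 / a := by ring
  have h3 : 0 ≤ 1 / a * (1 / (1 + a * n)) := by have := hpos n; positivity
  linarith [hsum n]

variable (d) in
/-- A constant bounding the weighted lattice sum. -/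
noncomputable def latticeConst : ℝ := 2 * d * 2 ^ (d - 1) * 2

/-- Summing over shells, the O(n^{d-1}) points cancel the factor (1+‖k‖)^{d-1}. What remains is a
one-dimensional sum of size 1/a, in every dimension. -/
theorem tsum_lattice_le (hd : 1 ≤ d) {a : ℝ} (ha : 0 < a) (ha1 : a ≤ 1) :
    ∑' k : Fin d → ℤ, ENNReal.ofReal (1 / ((1 + ‖k‖) ^ (d - 1) * (1 + a * ‖k‖) ^ 2)) ≤
      ENNReal.ofReal (latticeConst d / a) := by
  rw [← (Equiv.sigmaFiberEquiv fun k : Fin d → ℤ => ⌊‖k‖⌋₊).tsum_eq, ENNReal.tsum_sigma']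
  calc _ ≤ ∑' n : ℕ, ENNReal.ofReal (2 * d * 2 ^ (d - 1)) *
        ENNReal.ofReal (1 / (1 + a * n) ^ 2) := by
        refine ENNReal.tsum_le_tsum fun n => ?_
        have h1 : ∀ k : {k : Fin d → ℤ // ⌊‖k‖⌋₊ = n}, ENNReal.ofReal
            (1 / ((1 + ‖k.1‖) ^ (d - 1) * (1 + a * ‖k.1‖) ^ 2)) ≤
            ENNReal.ofReal (1 / ((1 + n) ^ (d - 1) * (1 + a * n) ^ 2)) := by
          rintro ⟨k, hk⟩
          have hk' : (n : ℝ) ≤ ‖k‖ := by rw [← hk]; exact Nat.floor_le (norm_nonneg k)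
          apply ENNReal.ofReal_le_ofReal
          apply one_div_le_one_div_of_le (by positivity)
          gcongr
        refine (ENNReal.tsum_le_tsum fun k => h1 k).trans ?_
        rw [ENNReal.tsum_const]
        have h2 : (ENat.card {k : Fin d → ℤ // ⌊‖k‖⌋₊ = n} : ℝ≥0∞) ≤
            ENNReal.ofReal (2 * d * 2 ^ (d - 1) * (1 + n) ^ (d - 1)) := encard_shell_le hd n
        refine (mul_le_mul_left h2 _).trans ?_
        rw [← ENNReal.ofReal_mul (by positivity), ← ENNReal.ofReal_mul (by positivity)]
        apply ENNReal.ofReal_le_ofReal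
        have : (0 : ℝ) < 1 + n := by positivity
        apply le_of_eq
        field_simp
    _ = ENNReal.ofReal (2 * d * 2 ^ (d - 1)) * ∑' n : ℕ, ENNReal.ofReal (1 / (1 + a * n) ^ 2) :=
        ENNReal.tsum_mul_left
    _ ≤ ENNReal.ofReal (2 * d * 2 ^ (d - 1)) * ENNReal.ofReal (2 / a) := by
        gcongr; exact tsum_inv_sq_le ha ha1
    _ = _ := by
        rw [← ENNReal.ofReal_mul (by positivity), latticeConst]
        congr 1; ring

/-- The squared weight `(1+|k|)^{d-1} (1+a|k|)^{2N}`. -/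
noncomputable def wt (N : ℕ) (a : ℝ) (k : Fin d → ℤ) : ℝ :=
  (1 + ‖k‖) ^ (d - 1) * (1 + a * ‖k‖) ^ (2 * N)

theorem one_le_wt (N : ℕ) {a : ℝ} (ha : 0 ≤ a) (k : Fin d → ℤ) : 1 ≤ wt N a k := by
  have h1 : 0 ≤ ‖k‖ := norm_nonneg k
  have h2 : 0 ≤ a * ‖k‖ := by positivity
  exact one_le_mul_of_one_le_of_one_le (one_le_pow₀ (by linarith)) (one_le_pow₀ (by linarith))

theorem wt_pos (N : ℕ) {a : ℝ} (ha : 0 ≤ a) (k : Fin d → ℤ) : 0 < wt N a k :=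
  one_pos.trans_le (one_le_wt N ha k)

/-- Since k = l + (k-l), one of the two pieces has norm at least ‖k‖/2, and halving the frequency
costs at most 2^{d-1+2N}. -/
theorem wt_le (N : ℕ) {a : ℝ} (ha : 0 ≤ a) (k l : Fin d → ℤ) :
    wt N a k ≤ 2 ^ (d - 1 + 2 * N) * (wt N a l + wt N a (k - l)) := by
  have key : ∀ m : Fin d → ℤ, ‖k‖ ≤ 2 * ‖m‖ → wt N a k ≤ 2 ^ (d - 1 + 2 * N) * wt N a m := by
    intro m hm
    have h0 := norm_nonneg k
    have h1 := norm_nonneg m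
    rw [wt, wt, pow_add, mul_mul_mul_comm, ← mul_pow, ← mul_pow]
    have h3 : a * ‖k‖ ≤ a * (2 * ‖m‖) := by gcongr
    gcongr <;> linarith
  have h1 := wt_pos N ha l
  have h2 := wt_pos N ha (k - l)
  have h3 : ‖k‖ ≤ ‖l‖ + ‖k - l‖ := by
    have := norm_add_le l (k - l)
    rwa [add_sub_cancel] at this
  rw [mul_add]
  have p : (0 : ℝ) < 2 ^ (d - 1 + 2 * N) := by positivity
  rcases le_total ‖l‖ ‖k - l‖ with h | h
  · refine (key (k - l) (by linarith)).trans ?_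
    have := mul_pos p h1
    linarith
  · refine (key l (by linarith)).trans ?_
    have := mul_pos p h2
    linarith

/-- Cauchy–Schwarz against the inverse weight. It embeds the weighted ℓ² space into ℓ¹ with squared
norm O(1/a); the exponent N ≥ 1 supplies the two powers of 1+a‖k‖ that the lattice sum needs. -/
theorem sq_tsum_le_wt (hd : 1 ≤ d) {N : ℕ} (hN : 1 ≤ N) {a : ℝ} (ha : 0 < a) (ha1 : a ≤ 1)
    (B : (Fin d → ℤ) → ℝ≥0∞) :
    (∑' k, B k) ^ 2 ≤ ENNReal.ofReal (latticeConst d / a) *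
      ∑' k, ENNReal.ofReal (wt N a k) * B k ^ 2 := by
  have h := sq_tsum_mul_le (fun k => (ENNReal.ofReal (1 / wt N a k)) ^ (1 / 2 : ℝ))
    (fun k => (ENNReal.ofReal (wt N a k)) ^ (1 / 2 : ℝ) * B k)
  simp only [mul_pow, ennreal_sqrt_sq] at h
  have h1 : ∀ k, (ENNReal.ofReal (1 / wt N a k)) ^ (1 / 2 : ℝ) *
      ((ENNReal.ofReal (wt N a k)) ^ (1 / 2 : ℝ) * B k) = B k := by
    intro k
    have hp := wt_pos N ha.le k
    rw [← mul_assoc, ← ENNReal.mul_rpow_of_nonneg _ _ (by norm_num),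
      ← ENNReal.ofReal_mul (by positivity), one_div_mul_cancel hp.ne']
    simp
  simp only [h1] at h
  refine h.trans ?_
  gcongr
  refine (ENNReal.tsum_le_tsum fun k => ENNReal.ofReal_le_ofReal ?_).trans
    (tsum_lattice_le hd ha ha1)
  have h1 : 0 ≤ a * ‖k‖ := by positivity
  apply one_div_le_one_div_of_le (by positivity)
  rw [wt]
  gcongr
  · linarith
  · omega

/-- The weighted `ℓ²` spaces are convolution algebras. -/
theorem tsum_wt_conv_le (hd : 1 ≤ d) {N : ℕ} (hN : 1 ≤ N) {a : ℝ} (ha : 0 < a) (ha1 : a ≤ 1)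
    (A B : (Fin d → ℤ) → ℝ≥0∞) :
    ∑' k, ENNReal.ofReal (wt N a k) * (∑' l, A l * B (k - l)) ^ 2 ≤
      ENNReal.ofReal (2 ^ (d + 1 + 2 * N) * latticeConst d / a) *
        (∑' k, ENNReal.ofReal (wt N a k) * A k ^ 2) *
        ∑' k, ENNReal.ofReal (wt N a k) * B k ^ 2 := by
  set w : (Fin d → ℤ) → ℝ≥0∞ := fun k => (ENNReal.ofReal (wt N a k)) ^ (1 / 2 : ℝ) with hw
  have hw2 : ∀ k, ENNReal.ofReal (wt N a k) = w k ^ 2 := fun k => (ennreal_sqrt_sq _).symm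
  set K : ℝ≥0∞ := (ENNReal.ofReal (2 ^ (d - 1 + 2 * N))) ^ (1 / 2 : ℝ) with hK
  have hwle : ∀ k l, w k ≤ K * (w l + w (k - l)) := by
    intro k l
    have h1 : ENNReal.ofReal (wt N a k) ≤ ENNReal.ofReal (2 ^ (d - 1 + 2 * N)) *
        (ENNReal.ofReal (wt N a l) + ENNReal.ofReal (wt N a (k - l))) := by
      rw [← ENNReal.ofReal_add (wt_pos N ha.le _).le (wt_pos N ha.le _).le,
        ← ENNReal.ofReal_mul (by positivity)]
      exact ENNReal.ofReal_le_ofReal (wt_le N ha.le k l)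
    have h2 := ENNReal.rpow_le_rpow h1 (by norm_num : (0 : ℝ) ≤ 1 / 2)
    rw [ENNReal.mul_rpow_of_nonneg _ _ (by norm_num)] at h2
    refine h2.trans ?_
    gcongr
    exact ENNReal.rpow_add_le_add_rpow _ _ (by norm_num) (by norm_num)
  simp only [hw2, ← mul_pow]
  -- The weight at k is shared between l and k-l, as in a Leibniz rule. Each term is then the
  -- convolution of an ℓ¹ family with a weighted ℓ² family, to which Young's inequality applies.
  have hpt : ∀ k, (w k * ∑' l, A l * B (k - l)) ^ 2 ≤ K ^ 2 *
      (2 * (∑' l, B l * (w (k - l) * A (k - l))) ^ 2 +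
        2 * (∑' l, A l * (w (k - l) * B (k - l))) ^ 2) := by
    intro k
    have h1 : w k * ∑' l, A l * B (k - l) ≤ K *
        ((∑' l, B l * (w (k - l) * A (k - l))) + ∑' l, A l * (w (k - l) * B (k - l))) := by
      rw [← tsum_conv_comm (fun l => w l * A l) B, ← ENNReal.tsum_add, ← ENNReal.tsum_mul_left,
        ← ENNReal.tsum_mul_left]
      refine ENNReal.tsum_le_tsum fun l => ?_
      calc w k * (A l * B (k - l)) ≤ K * (w l + w (k - l)) * (A l * B (k - l)) := by
            gcongr; exact hwle k l
        _ = _ := by ring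
    calc _ ≤ (K * ((∑' l, B l * (w (k - l) * A (k - l))) +
          ∑' l, A l * (w (k - l) * B (k - l)))) ^ 2 := by gcongr
      _ ≤ _ := by rw [mul_pow]; gcongr; exact ennreal_add_sq_le _ _
  refine (ENNReal.tsum_le_tsum hpt).trans ?_
  rw [ENNReal.tsum_mul_left, ENNReal.tsum_add, ENNReal.tsum_mul_left, ENNReal.tsum_mul_left]
  have hA := sq_tsum_le_wt hd hN ha ha1 A
  have hB := sq_tsum_le_wt hd hN ha ha1 B
  simp only [hw2, ← mul_pow] at hA hB
  set SA := ∑' k, (w k * A k) ^ 2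
  set SB := ∑' k, (w k * B k) ^ 2
  have e1 := (tsum_sq_conv_le B (fun l => w l * A l)).trans (mul_le_mul_left hB SA)
  have e2 := (tsum_sq_conv_le A (fun l => w l * B l)).trans (mul_le_mul_left hA SB)
  have hL : 0 ≤ latticeConst d := by unfold latticeConst; positivity
  calc _ ≤ K ^ 2 * (2 * (ENNReal.ofReal (latticeConst d / a) * SB * SA) +
        2 * (ENNReal.ofReal (latticeConst d / a) * SA * SB)) := by gcongr
    _ = (K ^ 2 * 4 * ENNReal.ofReal (latticeConst d / a)) * SA * SB := by ring
    _ = _ := by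
        congr 2
        rw [hK, ennreal_sqrt_sq, show (4 : ℝ≥0∞) = ENNReal.ofReal 4 by norm_num,
          ← ENNReal.ofReal_mul (by positivity), ← ENNReal.ofReal_mul (by positivity)]
        congr 1
        obtain ⟨e, rfl⟩ : ∃ e, d = e + 1 := ⟨d - 1, by omega⟩
        simp only [add_tsub_cancel_right]
        ring

end Lattice

/-! ### Symbol bounds for the biharmonic semigroup -/

section Multipliers

variable {d : ℕ}

theorem freqNorm_nonneg (k : Fin d → ℤ) : 0 ≤ freqNorm k := Real.sqrt_nonneg _

theorem freqNorm_neg (k : Fin d → ℤ) : freqNorm (-k) = freqNorm k := by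
  simp [freqNorm]

theorem abs_le_freqNorm (k : Fin d → ℤ) (j : Fin d) : |(k j : ℝ)| ≤ freqNorm k := by
  apply Real.abs_le_sqrt
  exact Finset.single_le_sum (f := fun j => (k j : ℝ) ^ 2) (fun _ _ => sq_nonneg _)
    (Finset.mem_univ j)

theorem norm_le_freqNorm (k : Fin d → ℤ) : ‖k‖ ≤ freqNorm k :=
  (pi_norm_le_iff_of_nonneg (freqNorm_nonneg k)).mpr fun j => by
    rw [Int.norm_eq_abs]; exact abs_le_freqNorm k j

theorem freqNorm_le_norm (k : Fin d → ℤ) : freqNorm k ≤ Real.sqrt d * ‖k‖ := by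
  rw [freqNorm, ← Real.sqrt_sq (norm_nonneg k), ← Real.sqrt_mul (Nat.cast_nonneg d)]
  apply Real.sqrt_le_sqrt
  calc ∑ j, (k j : ℝ) ^ 2 ≤ ∑ _j : Fin d, ‖k‖ ^ 2 := by
        refine Finset.sum_le_sum fun j _ => ?_
        rw [← sq_abs]
        gcongr
        have := norm_le_pi_norm k j
        rwa [Int.norm_eq_abs] at this
    _ = _ := by simp

theorem freqNorm_zero : freqNorm (0 : Fin d → ℤ) = 0 := by simp [freqNorm]

theorem one_le_norm {k : Fin d → ℤ} (hk : k ≠ 0) : 1 ≤ ‖k‖ := by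
  obtain ⟨i, hi⟩ := Function.ne_iff.mp hk
  refine le_trans ?_ (norm_le_pi_norm k i)
  rw [Int.norm_eq_abs]
  exact_mod_cast Int.one_le_abs hi

theorem one_le_freqNorm {k : Fin d → ℤ} (hk : k ≠ 0) : 1 ≤ freqNorm k :=
  (one_le_norm hk).trans (norm_le_freqNorm k)

theorem exists_pow_mul_exp_le {ν : ℝ} (hν : 0 < ν) (n : ℕ) :
    ∃ C : ℝ, 0 < C ∧ ∀ x : ℝ, 0 ≤ x → (1 + x) ^ n * Real.exp (-(ν * x ^ 4)) ≤ C := by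
  refine ⟨n.factorial / ν ^ n * Real.exp (2 * ν), by positivity, fun x hx => ?_⟩
  have h1 := Real.pow_div_factorial_le_exp (ν * (1 + x)) (by positivity) n
  have h2 : Real.exp (-(ν * x ^ 4)) ≤ Real.exp (ν - ν * x) := by
    apply Real.exp_le_exp.mpr
    -- The quartic exponent is traded for a linear one, so that the exponential series bounds the
    -- polynomial.
    have : x - 1 ≤ x ^ 4 := by nlinarith [sq_nonneg (x ^ 2 - 1), sq_nonneg (x - 1)]
    nlinarith
  have h3 : (1 + x) ^ n ≤ n.factorial / ν ^ n * Real.exp (ν * (1 + x)) := by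
    rw [mul_pow, div_le_iff₀ (by positivity)] at h1
    rw [div_mul_eq_mul_div, le_div_iff₀ (by positivity)]
    linarith
  calc (1 + x) ^ n * Real.exp (-(ν * x ^ 4))
      ≤ (n.factorial / ν ^ n * Real.exp (ν * (1 + x))) * Real.exp (ν - ν * x) := by gcongr
    _ = _ := by
        rw [mul_assoc, ← Real.exp_add]; ring_nf

/-- In the variable x = τ^{1/4} r the time disappears except for the factor τ^{-p/4}: each
derivative costs τ^{-1/4}. The factors 1 + τ^{1/4} r come for free, and one constant serves all real
p in [0,n]. -/
theorem exists_heat_bound {ν : ℝ} (hν : 0 < ν) (n m : ℕ) :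
    ∃ C : ℝ, 0 < C ∧ ∀ p : ℝ, 0 ≤ p → p ≤ n → ∀ τ : ℝ, 0 < τ → ∀ r : ℝ, 0 ≤ r →
      r ^ p * (1 + τ ^ (1 / 4 : ℝ) * r) ^ m * Real.exp (-(τ * ν * r ^ 4)) ≤ C * τ ^ (-(p / 4)) := by
  obtain ⟨C, hC, h⟩ := exists_pow_mul_exp_le hν (n + m)
  refine ⟨C, hC, fun p hp hpn τ hτ r hr => ?_⟩
  set x := τ ^ (1 / 4 : ℝ) * r with hx
  have hx0 : 0 ≤ x := by positivity
  have hx4 : τ * ν * r ^ 4 = ν * x ^ 4 := by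
    rw [hx, mul_pow, ← Real.rpow_natCast (τ ^ (1 / 4 : ℝ)), ← Real.rpow_mul hτ.le]
    norm_num; ring
  have hr' : r ^ p = τ ^ (-(p / 4)) * x ^ p := by
    rw [hx, Real.mul_rpow (by positivity) hr, ← Real.rpow_mul hτ.le, ← mul_assoc,
      ← Real.rpow_add hτ]
    ring_nf; simp
  have hxp : x ^ p ≤ (1 + x) ^ n := by
    calc x ^ p ≤ (1 + x) ^ p := by gcongr; linarith
      _ ≤ (1 + x) ^ (n : ℝ) := Real.rpow_le_rpow_of_exponent_le (by linarith) hpn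
      _ = _ := Real.rpow_natCast _ _
  rw [hx4, hr']
  calc _ = τ ^ (-(p / 4)) * (x ^ p * (1 + x) ^ m * Real.exp (-(ν * x ^ 4))) := by ring
    _ ≤ τ ^ (-(p / 4)) * ((1 + x) ^ n * (1 + x) ^ m * Real.exp (-(ν * x ^ 4))) := by gcongr
    _ ≤ τ ^ (-(p / 4)) * C := by rw [← pow_add]; gcongr; exact h x hx0
    _ = _ := mul_comm _ _

/-- Boundedness keeps the new coefficients square summable and the symmetry keeps the function real,
so the definition by cases takes its meaningful branch. -/
theorem fourierCoef_fourierMul {m : (Fin d → ℤ) → ℂ} {M : ℝ} (hM : ∀ k, ‖m k‖ ≤ M)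
    (hsym : ∀ k, m (-k) = conj (m k)) (f : L2 d) (k : Fin d → ℤ) :
    fourierCoef (fourierMul m f) k = m k * fourierCoef f k := by
  have hM0 : 0 ≤ M := (norm_nonneg _).trans (hM 0)
  have hex : ∃ g : L2 d, ∀ k, fourierCoef g k = m k * fourierCoef f k := by
    apply exists_fourierCoef_eq
    · calc ∑' k, ‖m k * fourierCoef f k‖ₑ ^ 2
          ≤ ∑' k, ENNReal.ofReal M ^ 2 * ‖fourierCoef f k‖ₑ ^ 2 := by
            refine ENNReal.tsum_le_tsum fun k => ?_
            rw [enorm_mul, mul_pow]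
            gcongr
            rw [← ofReal_norm]
            exact ENNReal.ofReal_le_ofReal (hM k)
        _ < ⊤ := by
            rw [ENNReal.tsum_mul_left, tsum_enorm_sq_fourierCoef]
            exact ENNReal.mul_lt_top (by simp) ENNReal.ofReal_lt_top
    · intro k
      rw [hsym, fourierCoef_neg, map_mul]
  rw [fourierMul, dif_pos hex]
  exact hex.choose_spec k

theorem fourierCoef_biharmonic {ν τ : ℝ} (hν : 0 < ν) (hτ : 0 ≤ τ) (f : L2 d) (k : Fin d → ℤ) :
    fourierCoef (biharmonic ν τ f) k =
      (Real.exp (-(τ * ν * freqNorm k ^ 4)) : ℂ) * fourierCoef f k := by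
  apply fourierCoef_fourierMul (M := 1)
  · intro k
    rw [Complex.norm_real, Real.norm_of_nonneg (Real.exp_pos _).le, Real.exp_le_one_iff]
    have := freqNorm_nonneg k
    have : 0 ≤ τ * ν * freqNorm k ^ 4 := by positivity
    linarith
  · intro k
    rw [freqNorm_neg, Complex.conj_ofReal]

/-- The symbol of `∂_j e^{-τνΔ²}`. -/
noncomputable def derivSymbol (ν : ℝ) (j : Fin d) (τ : ℝ) (k : Fin d → ℤ) : ℂ :=
  Complex.I * (k j : ℂ) * (Real.exp (-(τ * ν * freqNorm k ^ 4)) : ℂ)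

theorem norm_derivSymbol_le (ν : ℝ) (j : Fin d) (τ : ℝ) (k : Fin d → ℤ) :
    ‖derivSymbol ν j τ k‖ ≤ freqNorm k * Real.exp (-(τ * ν * freqNorm k ^ 4)) := by
  rw [derivSymbol, norm_mul, norm_mul, Complex.norm_I, one_mul, Complex.norm_intCast,
    Complex.norm_real, Real.norm_of_nonneg (Real.exp_pos _).le]
  gcongr
  exact abs_le_freqNorm k j

theorem exists_norm_derivSymbol_le {ν : ℝ} (hν : 0 < ν) :
    ∃ C : ℝ, 0 < C ∧ ∀ (d : ℕ) (j : Fin d) (τ : ℝ), 0 < τ → ∀ k : Fin d → ℤ,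
      ‖derivSymbol ν j τ k‖ ≤ C * τ ^ (-(1 / 4) : ℝ) := by
  obtain ⟨C, hC, h⟩ := exists_heat_bound hν 1 0
  refine ⟨C, hC, fun d j τ hτ k => (norm_derivSymbol_le ν j τ k).trans ?_⟩
  simpa using h 1 zero_le_one (by simp) τ hτ _ (freqNorm_nonneg k)

theorem fourierCoef_derivBiharmonic {ν τ : ℝ} (hν : 0 < ν) (j : Fin d) (hτ : 0 < τ) (f : L2 d)
    (k : Fin d → ℤ) :
    fourierCoef (derivBiharmonic ν j τ f) k = derivSymbol ν j τ k * fourierCoef f k := by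
  obtain ⟨C, -, h⟩ := exists_norm_derivSymbol_le hν
  apply fourierCoef_fourierMul (m := derivSymbol ν j τ) (h d j τ hτ)
  intro k
  simp only [derivSymbol, freqNorm_neg, map_mul, Complex.conj_I, Complex.conj_ofReal,
    Pi.neg_apply, Int.cast_neg, map_intCast]
  ring

theorem exists_norm_derivBiharmonic_le {ν : ℝ} (hν : 0 < ν) :
    ∃ C : ℝ, 0 < C ∧ ∀ (d : ℕ) (j : Fin d) (τ : ℝ), 0 < τ → ∀ f : L2 d,
      ‖derivBiharmonic ν j τ f‖ ≤ C * τ ^ (-(1 / 4) : ℝ) * ‖f‖ := by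
  obtain ⟨C, hC, h⟩ := exists_norm_derivSymbol_le hν
  refine ⟨C, hC, fun d j τ hτ f => ?_⟩
  have hv := torusVol_pos d
  have h1 := hasSum_sq_fourierCoef (derivBiharmonic ν j τ f)
  have h2 := (hasSum_sq_fourierCoef f).mul_left ((C * τ ^ (-(1 / 4) : ℝ)) ^ 2)
  have h3 := hasSum_le (fun k => ?_) h1 h2
  · have h4 : ‖derivBiharmonic ν j τ f‖ ^ 2 ≤ (C * τ ^ (-(1 / 4) : ℝ) * ‖f‖) ^ 2 := by
      rw [mul_pow]
      have : torusVol d * ‖derivBiharmonic ν j τ f‖ ^ 2 ≤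
          torusVol d * ((C * τ ^ (-(1 / 4) : ℝ)) ^ 2 * ‖f‖ ^ 2) := by linarith
      exact le_of_mul_le_mul_left this hv
    exact le_of_sq_le_sq h4 (by positivity)
  · rw [fourierCoef_derivBiharmonic hν j hτ, norm_mul, mul_pow]
    gcongr
    exact h d j τ hτ k

end Multipliers

/-! ### Reduction of the mild formulation to Fourier coefficients -/

section Duhamel

variable {d : ℕ}

theorem integrableOn_beta {α β : ℝ} (hα0 : 0 ≤ α) (hα : α < 1) (hβ0 : 0 ≤ β) (hβ : β < 1)
    {t : ℝ} (ht : 0 < t) : IntegrableOn (fun s : ℝ => (t - s) ^ (-α) * s ^ (-β)) (Ioo 0 t) := by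
  obtain ⟨C, -, h⟩ := exists_lintegral_beta_le hα0 hα hβ0 hβ
  have hm : Measurable (fun s : ℝ => (t - s) ^ (-α) * s ^ (-β)) := by fun_prop
  refine ⟨hm.aestronglyMeasurable, ?_⟩
  rw [hasFiniteIntegral_iff_ofReal]
  · exact (h t ht).trans_lt ENNReal.ofReal_lt_top
  · refine (ae_restrict_iff' measurableSet_Ioo).mpr (ae_of_all _ fun s hs => ?_)
    have hs1 : 0 < s := hs.1
    have hs2 : 0 < t - s := by linarith [hs.2]
    change 0 ≤ (t - s) ^ (-α) * s ^ (-β)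
    positivity

theorem norm_toLp_le (f : C(Torus d, ℝ)) :
    ‖(ContinuousMap.toLp (E := ℝ) 2 volume ℝ f : L2 d)‖ ≤ Real.sqrt (torusVol d) * ‖f‖ := by
  have h := ContinuousLinearMap.le_of_opNorm_le _
    (ContinuousMap.toLp_norm_le (p := 2) (E := ℝ) (𝕜 := ℝ) (volume : Measure (Torus d))) f
  refine h.trans (le_of_eq ?_)
  congr 1
  have : measureUnivNNReal (volume : Measure (Torus d)) = Real.toNNReal (torusVol d) := by
    have h2 : (volume : Measure (Torus d)) univ = ENNReal.ofReal (torusVol d) := by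
      rw [← Set.pi_univ univ, volume_pi_pi]
      simp [AddCircle.measure_univ, torusVol, ENNReal.ofReal_pow Real.two_pi_pos.le]
    rw [← ENNReal.coe_inj, coe_measureUnivNNReal, h2]; rfl
  rw [this, Real.coe_toNNReal _ (torusVol_pos d).le, Real.sqrt_eq_rpow]
  norm_num

theorem continuous_derivSymbol_sub (ν : ℝ) (j : Fin d) (t : ℝ) (k : Fin d → ℤ) :
    Continuous fun s => derivSymbol ν j (t - s) k := by
  unfold derivSymbol; fun_prop

/-- The Duhamel integrand is integrable and its Fourier coefficients are computed under the
integral. -/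
theorem duhamel_integral {ν : ℝ} (hν : 0 < ν) (j : Fin d) {F : ℝ → C(Torus d, ℝ)} {K t : ℝ}
    (ht : 0 < t) (hF : ContinuousOn F (Ioo 0 t))
    (hK : ∀ s ∈ Ioo 0 t, ‖F s‖ ≤ K * s ^ (-(3 / 4) : ℝ)) :
    IntervalIntegrable (fun s => derivBiharmonic ν j (t - s)
      (ContinuousMap.toLp (E := ℝ) 2 volume ℝ (F s))) volume 0 t ∧
    ∀ k, fourierCoef (∫ s in (0 : ℝ)..t, derivBiharmonic ν j (t - s)
      (ContinuousMap.toLp (E := ℝ) 2 volume ℝ (F s)) : L2 d) k =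
      ∫ s in Ioo 0 t, derivSymbol ν j (t - s) k * fourierCoef (F s) k := by
  obtain ⟨C, hC, hD⟩ := exists_norm_derivBiharmonic_le hν
  have hcoef : ∀ s ∈ Ioo 0 t, ∀ k, fourierCoef (derivBiharmonic ν j (t - s)
      (ContinuousMap.toLp (E := ℝ) 2 volume ℝ (F s))) k =
      derivSymbol ν j (t - s) k * fourierCoef (F s) k := by
    intro s hs k
    rw [fourierCoef_derivBiharmonic hν j (by linarith [hs.2]), fourierCoef_toLp]
  have hint : IntegrableOn (fun s => derivBiharmonic ν j (t - s)
      (ContinuousMap.toLp (E := ℝ) 2 volume ℝ (F s))) (Ioo 0 t) := by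
    -- The exponent 1/4 is the cost of one derivative of the semigroup, and 3/4 is the assumed
    -- singularity of the flux.
    have hb := (integrableOn_beta (α := 1 / 4) (β := 3 / 4) (by norm_num) (by norm_num)
      (by norm_num) (by norm_num) ht).const_mul (C * (Real.sqrt (torusVol d) * K))
    refine Integrable.mono' hb ?_ ?_
    · apply aestronglyMeasurable_of_fourierCoef
      intro k
      have : ContinuousOn (fun s => derivSymbol ν j (t - s) k * fourierCoef (F s) k) (Ioo 0 t) :=
        (continuous_derivSymbol_sub ν j t k).continuousOn.mul
          ((continuous_fourierCoef_continuousMap k).comp_continuousOn hF)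
      refine (this.aestronglyMeasurable measurableSet_Ioo).congr ?_
      refine (ae_restrict_iff' measurableSet_Ioo).mpr (ae_of_all _ fun s hs => ?_)
      exact (hcoef s hs k).symm
    · refine (ae_restrict_iff' measurableSet_Ioo).mpr (ae_of_all _ fun s hs => ?_)
      have hs2 : 0 < t - s := by linarith [hs.2]
      refine (hD d j _ hs2 _).trans ?_
      calc _ ≤ C * (t - s) ^ (-(1 / 4) : ℝ) *
            (Real.sqrt (torusVol d) * (K * s ^ (-(3 / 4) : ℝ))) := by
            gcongr
            exact (norm_toLp_le _).trans (by gcongr; exact hK s hs)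
        _ = _ := by ring
  refine ⟨(intervalIntegrable_iff_integrableOn_Ioo_of_le ht.le).mpr hint, fun k => ?_⟩
  rw [intervalIntegral.integral_of_le ht.le, integral_Ioc_eq_integral_Ioo, ← coefCLM_apply,
    ← ContinuousLinearMap.integral_comp_comm _ hint]
  refine setIntegral_congr_fun measurableSet_Ioo fun s hs => ?_
  simp only [coefCLM_apply]
  exact hcoef s hs k

theorem norm_flux_le (p : Fin d → C(Torus d, ℝ)) (j : Fin d) :
    ‖flux p j‖ ≤ (∑ i, ‖p i‖ ^ 2 + 1) * ‖p j‖ := by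
  refine (norm_mul_le _ _).trans ?_
  gcongr
  refine (norm_sub_le _ _).trans ?_
  gcongr
  · refine (norm_sum_le _ _).trans (Finset.sum_le_sum fun i _ => norm_pow_le _ _)
  · exact (ContinuousMap.norm_le _ zero_le_one).mpr fun x => by simp

theorem continuous_flux (j : Fin d) : Continuous fun p : Fin d → C(Torus d, ℝ) => flux p j := by
  unfold flux; fun_prop

/-- The gradient data of a mild solution: `t^{1/4} p` is continuous on `[0,T]`. -/
def GradCont (T : ℝ) (p : ℝ → Fin d → C(Torus d, ℝ)) : Prop :=
  ∀ j, ContinuousOn (fun t => t ^ (1 / 4 : ℝ) • p t j) (Icc 0 T)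

theorem GradCont.continuousOn {T : ℝ} {p : ℝ → Fin d → C(Torus d, ℝ)} (hp : GradCont T p) :
    ContinuousOn p (Ioc 0 T) := by
  refine continuousOn_pi.mpr fun j => ?_
  have h1 : ContinuousOn (fun t : ℝ => t ^ (-(1 / 4) : ℝ) • (t ^ (1 / 4 : ℝ) • p t j))
      (Ioc 0 T) := by
    have h2 := (hp j).mono Ioc_subset_Icc_self
    refine ContinuousOn.smul (f := fun t : ℝ => t ^ (-(1 / 4) : ℝ)) ?_ h2
    exact fun s hs => (Real.continuousAt_rpow_const _ _ (Or.inl hs.1.ne')).continuousWithinAt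
  refine h1.congr fun s hs => ?_
  change p s j = s ^ (-(1 / 4) : ℝ) • s ^ (1 / 4 : ℝ) • p s j
  rw [smul_smul, ← Real.rpow_add hs.1]
  simp

theorem GradCont.exists_bound {T : ℝ} {p : ℝ → Fin d → C(Torus d, ℝ)} (hp : GradCont T p) :
    ∃ K : ℝ, 0 < K ∧ ∀ s ∈ Ioc 0 T, ∀ j, ‖p s j‖ ≤ K * s ^ (-(1 / 4) : ℝ) := by
  have h1 : ∀ j, ∃ K, ∀ s ∈ Icc 0 T, ‖s ^ (1 / 4 : ℝ) • p s j‖ ≤ K := fun j =>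
    isCompact_Icc.exists_bound_of_continuousOn (hp j)
  choose K hK using h1
  refine ⟨∑ j, |K j| + 1, by positivity, fun s hs j => ?_⟩
  have h2 := hK j s (Ioc_subset_Icc_self hs)
  have hs0 : 0 < s := hs.1
  rw [norm_smul, Real.norm_of_nonneg (by positivity)] at h2
  rw [Real.rpow_neg hs0.le, ← div_eq_mul_inv, le_div_iff₀ (by positivity), mul_comm]
  refine h2.trans ((le_abs_self _).trans ?_)
  have := Finset.single_le_sum (f := fun j => |K j|) (fun _ _ => abs_nonneg _) (Finset.mem_univ j)
  linarith

/-- The cubic part is of size (s^{-1/4})³. The linear part is only s^{-1/4} and is raised to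
s^{-3/4} at the cost of T^{1/2}. -/
theorem GradCont.exists_flux_bound {T : ℝ} {p : ℝ → Fin d → C(Torus d, ℝ)} (hp : GradCont T p) :
    ∃ K : ℝ, ∀ s ∈ Ioc 0 T, ∀ j, ‖flux (p s) j‖ ≤ K * s ^ (-(3 / 4) : ℝ) := by
  obtain ⟨K, hK0, hK⟩ := hp.exists_bound
  refine ⟨(d * K ^ 2 + T ^ (1 / 2 : ℝ)) * K, fun s hs j => (norm_flux_le _ j).trans ?_⟩
  have hs0 : 0 < s := hs.1
  have hT : 0 < T := hs0.trans_le hs.2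
  have e1 : (s ^ (-(1 / 4) : ℝ)) ^ 2 = s ^ (-(1 / 2) : ℝ) := by
    rw [← Real.rpow_natCast, ← Real.rpow_mul hs0.le]; norm_num
  have e2 : s ^ (-(3 / 4) : ℝ) = s ^ (-(1 / 2) : ℝ) * s ^ (-(1 / 4) : ℝ) := by
    rw [← Real.rpow_add hs0]; norm_num
  have e3 : 1 ≤ T ^ (1 / 2 : ℝ) * s ^ (-(1 / 2) : ℝ) := by
    have : s ^ (1 / 2 : ℝ) ≤ T ^ (1 / 2 : ℝ) := Real.rpow_le_rpow hs0.le hs.2 (by norm_num)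
    rw [Real.rpow_neg hs0.le, ← div_eq_mul_inv, le_div_iff₀ (by positivity)]
    linarith
  calc _ ≤ (∑ _i : Fin d, (K * s ^ (-(1 / 4) : ℝ)) ^ 2 +
        T ^ (1 / 2 : ℝ) * s ^ (-(1 / 2) : ℝ)) * (K * s ^ (-(1 / 4) : ℝ)) := by
        gcongr with i _
        · exact hK s hs i
        · exact hK s hs j
    _ = _ := by
        simp only [Finset.sum_const, Finset.card_univ, Fintype.card_fin, nsmul_eq_mul, mul_pow, e1]
        rw [e2]; ring

theorem GradCont.duhamel {ν T : ℝ} (hν : 0 < ν) {p : ℝ → Fin d → C(Torus d, ℝ)}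
    (hp : GradCont T p) {t : ℝ} (ht : t ∈ Ioc 0 T) (j : Fin d) :
    IntervalIntegrable (fun s => derivBiharmonic ν j (t - s)
      (ContinuousMap.toLp (E := ℝ) 2 volume ℝ (flux (p s) j))) volume 0 t ∧
    ∀ k, fourierCoef (∫ s in (0 : ℝ)..t, derivBiharmonic ν j (t - s)
      (ContinuousMap.toLp (E := ℝ) 2 volume ℝ (flux (p s) j)) : L2 d) k =
      ∫ s in Ioo 0 t, derivSymbol ν j (t - s) k * fourierCoef (flux (p s) j) k := by
  obtain ⟨K, hK⟩ := hp.exists_flux_bound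
  have hsub : Ioo 0 t ⊆ Ioc 0 T := fun s hs => ⟨hs.1, hs.2.le.trans ht.2⟩
  exact duhamel_integral hν j ht.1
    ((continuous_flux j).comp_continuousOn (hp.continuousOn.mono hsub))
    fun s hs => hK s (hsub hs) j

/-- The mild formulation on the level of Fourier coefficients. -/
def CoefMild (ν : ℝ) (h₀ : L2 d) (h : ℝ → L2 d) (p : ℝ → Fin d → C(Torus d, ℝ)) (t : ℝ) : Prop :=
  ∀ k, fourierCoef (h t) k = (Real.exp (-(t * ν * freqNorm k ^ 4)) : ℂ) * fourierCoef h₀ k +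
    ∑ j, ∫ s in Ioo 0 t, derivSymbol ν j (t - s) k * fourierCoef (flux (p s) j) k

theorem fourierCoef_sum (s : Finset (Fin d)) (f : Fin d → L2 d) (k : Fin d → ℤ) :
    fourierCoef (∑ i ∈ s, f i : L2 d) k = ∑ i ∈ s, fourierCoef (f i) k := by
  simp only [← coefCLM_apply, map_sum]

/-- Integrability of the Duhamel term follows from the continuity of t^{1/4}∇h, and an `L²` function
is determined by its coefficients. All later arguments use this scalar form. -/
theorem isMildSolution_iff {ν T : ℝ} (hν : 0 < ν) (h₀ : L2 d) (h : ℝ → L2 d) :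
    IsMildSolution ν h₀ T h ↔ ContInSobolev ((d : ℝ) / 2) T h ∧
      ContInSobolev ((d : ℝ) / 2 + 1) T (fun t => t ^ (1 / 4 : ℝ) • h t) ∧ h 0 = h₀ ∧
      ∃ p : ℝ → Fin d → C(Torus d, ℝ), (∀ t ∈ Ioc 0 T, ∀ j, IsWeakDeriv j (h t) (p t j)) ∧
        GradCont T p ∧ ∀ t ∈ Ioc 0 T, CoefMild ν h₀ h p t := by
  unfold IsMildSolution
  refine and_congr_right fun _ => and_congr_right fun _ => and_congr_right fun _ =>
    exists_congr fun p => and_congr_right fun _ => and_congr_right fun hp => ?_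
  refine forall₂_congr fun t ht => ?_
  have hD := fun j => GradCont.duhamel hν hp ht j
  constructor
  · rintro ⟨-, h1⟩ k
    rw [h1, fourierCoef_add, fourierCoef_biharmonic hν ht.1.le, fourierCoef_sum]
    simp only [(hD _).2]
  · intro h1
    refine ⟨fun j => (hD j).1, ext_fourierCoef fun k => ?_⟩
    rw [h1 k, fourierCoef_add, fourierCoef_biharmonic hν ht.1.le, fourierCoef_sum]
    simp only [(hD _).2]

end Duhamel

/-! ### Uniqueness through a singular Gronwall inequality -/

section Uniqueness

variable {d : ℕ}

/-- The `L²` norm of a continuous function. -/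
noncomputable def l2norm (f : C(Torus d, ℝ)) : ℝ :=
  ‖(ContinuousMap.toLp (E := ℝ) 2 volume ℝ f : L2 d)‖

theorem l2norm_nonneg (f : C(Torus d, ℝ)) : 0 ≤ l2norm f := norm_nonneg _

theorem l2norm_add_le (f g : C(Torus d, ℝ)) : l2norm (f + g) ≤ l2norm f + l2norm g := by
  unfold l2norm; rw [map_add]; exact norm_add_le _ _

theorem l2norm_sum_le {ι : Type*} (s : Finset ι) (f : ι → C(Torus d, ℝ)) :
    l2norm (∑ i ∈ s, f i) ≤ ∑ i ∈ s, l2norm (f i) := by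
  unfold l2norm; rw [map_sum]; exact norm_sum_le _ _

theorem l2norm_mul_le (f g : C(Torus d, ℝ)) : l2norm (f * g) ≤ ‖f‖ * l2norm g := by
  apply Lp.norm_le_mul_norm_of_ae_le_mul
  filter_upwards [ContinuousMap.coeFn_toLp (p := 2) (𝕜 := ℝ) volume (f * g),
    ContinuousMap.coeFn_toLp (p := 2) (𝕜 := ℝ) volume g] with x h1 h2
  rw [h1, h2, ContinuousMap.mul_apply, norm_mul]
  gcongr
  exact f.norm_coe_le_norm x

theorem tsum_enorm_sq_fourierCoef_continuous (f : C(Torus d, ℝ)) :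
    ∑' k, ‖fourierCoef f k‖ₑ ^ 2 = ENNReal.ofReal (Real.sqrt (torusVol d) * l2norm f) ^ 2 := by
  rw [← ENNReal.ofReal_pow (mul_nonneg (Real.sqrt_nonneg _) (l2norm_nonneg f)), mul_pow,
    Real.sq_sqrt (torusVol_pos d).le, l2norm, ← tsum_enorm_sq_fourierCoef]
  simp only [fourierCoef_toLp]

theorem flux_sub_flux (p q : Fin d → C(Torus d, ℝ)) (j : Fin d) :
    flux p j - flux q j = (∑ i, (p j * (p i + q i)) * (p i - q i)) +
      ((∑ i, q i ^ 2) - 1) * (p j - q j) := by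
  have h : ∑ i, (p j * (p i + q i)) * (p i - q i) = p j * (∑ i, p i ^ 2 - ∑ i, q i ^ 2) := by
    rw [← Finset.sum_sub_distrib, Finset.mul_sum]
    exact Finset.sum_congr rfl fun i _ => by ring
  rw [h, flux, flux]
  ring

theorem l2norm_flux_sub_le {p q : Fin d → C(Torus d, ℝ)} {P : ℝ} (hp : ∀ i, ‖p i‖ ^ 2 ≤ P)
    (hq : ∀ i, ‖q i‖ ^ 2 ≤ P) (j : Fin d) :
    l2norm (flux p j - flux q j) ≤ ((d + 2) * P + 1) * ∑ i, l2norm (p i - q i) := by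
  have hN : l2norm (p j - q j) ≤ ∑ i, l2norm (p i - q i) :=
    Finset.single_le_sum (f := fun i => l2norm (p i - q i)) (fun _ _ => l2norm_nonneg _)
      (Finset.mem_univ j)
  have hP0 : 0 ≤ P := (sq_nonneg _).trans (hp j)
  rw [flux_sub_flux]
  refine (l2norm_add_le _ _).trans ?_
  have h1 : l2norm (∑ i, (p j * (p i + q i)) * (p i - q i)) ≤
      2 * P * ∑ i, l2norm (p i - q i) := by
    refine (l2norm_sum_le _ _).trans ?_
    rw [Finset.mul_sum]
    refine Finset.sum_le_sum fun i _ => (l2norm_mul_le _ _).trans ?_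
    refine mul_le_mul_of_nonneg_right ?_ (l2norm_nonneg _)
    calc ‖p j * (p i + q i)‖ ≤ ‖p j‖ * (‖p i‖ + ‖q i‖) :=
          (norm_mul_le _ _).trans (by gcongr; exact norm_add_le _ _)
      _ ≤ 2 * P := by
          nlinarith [hp i, hq i, hp j, sq_nonneg (‖p j‖ - ‖p i‖), sq_nonneg (‖p j‖ - ‖q i‖)]
  have h2 : l2norm (((∑ i, q i ^ 2) - 1) * (p j - q j)) ≤
      (d * P + 1) * ∑ i, l2norm (p i - q i) := by
    refine (l2norm_mul_le _ _).trans ?_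
    refine mul_le_mul ?_ hN (l2norm_nonneg _) (by positivity)
    refine (norm_sub_le _ _).trans ?_
    gcongr
    · refine (norm_sum_le _ _).trans ?_
      calc ∑ i, ‖q i ^ 2‖ ≤ ∑ _i : Fin d, P :=
            Finset.sum_le_sum fun i _ => (norm_pow_le _ _).trans (hq i)
        _ = d * P := by simp
    · exact (ContinuousMap.norm_le _ zero_le_one).mpr fun x => by simp
  calc _ ≤ 2 * P * ∑ i, l2norm (p i - q i) + (d * P + 1) * ∑ i, l2norm (p i - q i) :=
        add_le_add h1 h2
    _ = _ := by ring

/-- The function t^{1/4} p vanishes at t = 0 and is continuous there, so near 0 the coefficient of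
s^{-1/2} is as small as desired; away from 0 the gradient is bounded. This replaces smallness of the
data, which is not available in the critical space. -/
theorem GradCont.exists_small {T : ℝ} {p : ℝ → Fin d → C(Torus d, ℝ)} (hp : GradCont T p)
    {ε : ℝ} (hε : 0 < ε) :
    ∃ K : ℝ, 0 < K ∧ ∀ s ∈ Ioc 0 T, ∀ j, ‖p s j‖ ^ 2 ≤ ε * s ^ (-(1 / 2) : ℝ) + K := by
  obtain ⟨K, hK0, hK⟩ := hp.exists_bound
  rcases le_or_gt T 0 with hT | hT
  · exact ⟨1, one_pos, fun s hs => absurd (hs.1.trans_le hs.2) (not_lt.mpr hT)⟩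
  have e1 : ∀ s : ℝ, 0 < s → (s ^ (-(1 / 4) : ℝ)) ^ 2 = s ^ (-(1 / 2) : ℝ) := fun s hs => by
    rw [← Real.rpow_natCast, ← Real.rpow_mul hs.le]; norm_num
  have hev : ∀ᶠ s in 𝓝[Icc 0 T] (0 : ℝ), ∀ j, ‖s ^ (1 / 4 : ℝ) • p s j‖ < Real.sqrt ε := by
    refine eventually_all.mpr fun j => ?_
    have h1 : Tendsto (fun s : ℝ => s ^ (1 / 4 : ℝ) • p s j) (𝓝[Icc 0 T] 0) (𝓝 0) := by
      have h2 := (hp j) 0 ⟨le_rfl, hT.le⟩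
      rw [ContinuousWithinAt, Real.zero_rpow (by norm_num), zero_smul] at h2
      exact h2
    have h3 := h1.norm
    rw [norm_zero] at h3
    exact h3.eventually_lt_const (Real.sqrt_pos.mpr hε)
  rw [eventually_nhdsWithin_iff, Metric.eventually_nhds_iff] at hev
  obtain ⟨δ, hδ, hev⟩ := hev
  refine ⟨K ^ 2 * δ ^ (-(1 / 2) : ℝ), by positivity, fun s hs j => ?_⟩
  have hs0 : 0 < s := hs.1
  rcases lt_or_ge s δ with h | h
  · have h2 := (hev (by rw [Real.dist_eq, sub_zero, abs_of_pos hs0]; exact h)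
      (Ioc_subset_Icc_self hs) j).le
    rw [norm_smul, Real.norm_of_nonneg (by positivity), mul_comm, ← le_div_iff₀ (by positivity),
      div_eq_mul_inv, ← Real.rpow_neg hs0.le] at h2
    calc ‖p s j‖ ^ 2 ≤ (Real.sqrt ε * s ^ (-(1 / 4) : ℝ)) ^ 2 := by gcongr
      _ = ε * s ^ (-(1 / 2) : ℝ) := by rw [mul_pow, Real.sq_sqrt hε.le, e1 s hs0]
      _ ≤ _ := by
        have : 0 ≤ K ^ 2 * δ ^ (-(1 / 2) : ℝ) := by positivity
        linarith
  · calc ‖p s j‖ ^ 2 ≤ (K * s ^ (-(1 / 4) : ℝ)) ^ 2 := by gcongr; exact hK s hs j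
      _ = K ^ 2 * s ^ (-(1 / 2) : ℝ) := by rw [mul_pow, e1 s hs0]
      _ ≤ K ^ 2 * δ ^ (-(1 / 2) : ℝ) := by
        exact mul_le_mul_of_nonneg_left (Real.rpow_le_rpow_of_nonpos hδ h (by norm_num))
          (sq_nonneg K)
      _ ≤ _ := by
        have : 0 ≤ ε * s ^ (-(1 / 2) : ℝ) := by positivity
        linarith

theorem sq_sum_le_card (x : Fin d → ℝ≥0∞) : (∑ i, x i) ^ 2 ≤ d * ∑ i, x i ^ 2 := by
  have h := sq_sum_mul_le Finset.univ (fun _ : Fin d => (1 : ℝ≥0∞)) x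
  simpa using h

theorem integrable_derivSymbol_mul {ν : ℝ} (hν : 0 < ν) {F : ℝ → C(Torus d, ℝ)} {K t : ℝ}
    (ht : 0 < t) (hF : ContinuousOn F (Ioo 0 t))
    (hK : ∀ s ∈ Ioo 0 t, ‖F s‖ ≤ K * s ^ (-(3 / 4) : ℝ)) (j : Fin d) (k : Fin d → ℤ) :
    IntegrableOn (fun s => derivSymbol ν j (t - s) k * fourierCoef (F s) k) (Ioo 0 t) := by
  have hd := (duhamel_integral hν j ht hF hK).1
  rw [intervalIntegrable_iff_integrableOn_Ioo_of_le ht.le] at hd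
  have h2 := (coefCLM k).integrable_comp hd
  refine IntegrableOn.congr_fun h2 (fun s hs => ?_) measurableSet_Ioo
  simp only [coefCLM_apply]
  rw [fourierCoef_derivBiharmonic hν j (by linarith [hs.2]), fourierCoef_toLp]

theorem GradCont.integrable {ν T : ℝ} (hν : 0 < ν) {p : ℝ → Fin d → C(Torus d, ℝ)}
    (hp : GradCont T p) {t : ℝ} (ht : t ∈ Ioc 0 T) (j : Fin d) (k : Fin d → ℤ) :
    IntegrableOn (fun s => derivSymbol ν j (t - s) k * fourierCoef (flux (p s) j) k)
      (Ioo 0 t) := by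
  obtain ⟨K, hK⟩ := hp.exists_flux_bound
  have hsub : Ioo 0 t ⊆ Ioc 0 T := fun s hs => ⟨hs.1, hs.2.le.trans ht.2⟩
  exact integrable_derivSymbol_mul hν ht.1
    ((continuous_flux j).comp_continuousOn (hp.continuousOn.mono hsub))
    (fun s hs => hK s (hsub hs) j) j k

/-- The integral inequality for the difference of two mild solutions. -/
theorem exists_difference_inequality {ν : ℝ} (hν : 0 < ν) (d : ℕ) :
    ∃ C : ℝ, 0 < C ∧ ∀ (T : ℝ) (h₀ : L2 d) (h₁ h₂ : ℝ → L2 d)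
      (p q : ℝ → Fin d → C(Torus d, ℝ)) (P : ℝ → ℝ),
      (∀ t ∈ Ioc 0 T, ∀ j, IsWeakDeriv j (h₁ t) (p t j)) →
      (∀ t ∈ Ioc 0 T, ∀ j, IsWeakDeriv j (h₂ t) (q t j)) →
      GradCont T p → GradCont T q →
      (∀ t ∈ Ioc 0 T, CoefMild ν h₀ h₁ p t) → (∀ t ∈ Ioc 0 T, CoefMild ν h₀ h₂ q t) →
      (∀ t ∈ Ioc 0 T, ∀ i, ‖p t i‖ ^ 2 ≤ P t ∧ ‖q t i‖ ^ 2 ≤ P t) →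
      ∀ t ∈ Ioc 0 T, ENNReal.ofReal (∑ i, l2norm (p t i - q t i)) ≤
        ∫⁻ s in Ioo 0 t, ENNReal.ofReal (C * ((t - s) ^ (-(1 / 2) : ℝ) *
          ((P s + 1) * ∑ i, l2norm (p s i - q s i)))) := by
  -- Two derivatives meet the semigroup, the divergence and the gradient of the solution, which
  -- gives (t-s)^{-1/2}.
  obtain ⟨C, hC, hheat⟩ := exists_heat_bound hν 2 0
  -- One factor d counts the flux components, the other the gradient components, and d+2 comes from
  -- the Lipschitz bound of the flux. The summand 1 keeps the constant positive when d = 0.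
  refine ⟨d * d * C * (d + 2) + 1, by positivity, ?_⟩
  intro T h₀ h₁ h₂ p q P hw₁ hw₂ hp hq hm₁ hm₂ hP t ht
  have hv := torusVol_pos d
  have hsv := Real.sqrt_pos.mpr hv
  have hsub : Ioo 0 t ⊆ Ioc 0 T := fun s hs => ⟨hs.1, hs.2.le.trans ht.2⟩
  set Nf : ℝ → ℝ := fun s => ∑ i, l2norm (p s i - q s i) with hNf
  have hN0 : ∀ s, 0 ≤ Nf s := fun s => Finset.sum_nonneg fun _ _ => l2norm_nonneg _
  set G : Fin d → ℝ → (Fin d → ℤ) → ℝ≥0∞ := fun l s k =>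
    ENNReal.ofReal (C * (t - s) ^ (-(1 / 2) : ℝ)) *
      ‖fourierCoef (flux (p s) l - flux (q s) l : C(Torus d, ℝ)) k‖ₑ with hG
  set g : ℝ → ℝ≥0∞ := fun s => ENNReal.ofReal (C * (t - s) ^ (-(1 / 2) : ℝ) *
    (Real.sqrt (torusVol d) * (((d + 2) * P s + 1) * Nf s))) with hg
  have hmink : ∀ l, ∑' k, (∫⁻ s in Ioo 0 t, G l s k) ^ 2 ≤ (∫⁻ s in Ioo 0 t, g s) ^ 2 := by
    intro l
    refine tsum_sq_lintegral_le (fun k => ?_) ?_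
    · have h1 : ContinuousOn (fun s => fourierCoef (flux (p s) l - flux (q s) l : C(Torus d, ℝ)) k)
          (Ioo 0 t) :=
        (continuous_fourierCoef_continuousMap k).comp_continuousOn
          (((continuous_flux l).comp_continuousOn (hp.continuousOn.mono hsub)).sub
            ((continuous_flux l).comp_continuousOn (hq.continuousOn.mono hsub)))
      refine AEMeasurable.mul ?_ (h1.aestronglyMeasurable measurableSet_Ioo).enorm
      exact Measurable.aemeasurable (by fun_prop)
    · refine (ae_restrict_iff' measurableSet_Ioo).mpr (ae_of_all _ fun s hs => ?_)
      have hs2 : 0 < t - s := by linarith [hs.2]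
      simp only [hG, mul_pow, ENNReal.tsum_mul_left]
      rw [tsum_enorm_sq_fourierCoef_continuous, ← mul_pow, ← ENNReal.ofReal_mul (by positivity)]
      simp only [hg]
      gcongr
      exact l2norm_flux_sub_le (fun i => (hP s (hsub hs) i).1) (fun i => (hP s (hsub hs) i).2) l
  have hcoef : ∀ j k, ‖fourierCoef (p t j - q t j : C(Torus d, ℝ)) k‖ₑ ≤
      ∑ l, ∫⁻ s in Ioo 0 t, G l s k := by
    intro j k
    have h1 : fourierCoef (h₁ t) k - fourierCoef (h₂ t) k = ∑ l, ∫ s in Ioo 0 t,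
        derivSymbol ν l (t - s) k *
          fourierCoef (flux (p s) l - flux (q s) l : C(Torus d, ℝ)) k := by
      rw [hm₁ t ht k, hm₂ t ht k, add_sub_add_left_eq_sub, ← Finset.sum_sub_distrib]
      refine Finset.sum_congr rfl fun l _ => ?_
      rw [← integral_sub (hp.integrable hν ht l k) (hq.integrable hν ht l k)]
      simp only [fourierCoef_sub_continuous, mul_sub]
    rw [fourierCoef_sub_continuous, hw₁ t ht j k, hw₂ t ht j k, ← mul_sub, h1, Finset.mul_sum]
    refine (enorm_sum_le _ _).trans (Finset.sum_le_sum fun l _ => ?_)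
    rw [← integral_const_mul]
    refine (enorm_integral_le_lintegral_enorm _).trans
      (setLIntegral_mono' measurableSet_Ioo fun s hs => ?_)
    have hs2 : 0 < t - s := by linarith [hs.2]
    rw [← mul_assoc, enorm_mul]
    simp only [hG]
    gcongr
    rw [← ofReal_norm]
    apply ENNReal.ofReal_le_ofReal
    rw [norm_mul, norm_mul, Complex.norm_I, one_mul, Complex.norm_intCast]
    have h2 := hheat 2 zero_le_two (by norm_num) (t - s) hs2 _ (freqNorm_nonneg k)
    norm_num at h2
    calc _ ≤ freqNorm k * (freqNorm k * Real.exp (-((t - s) * ν * freqNorm k ^ 4))) := by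
          gcongr
          · exact freqNorm_nonneg k
          · exact abs_le_freqNorm k j
          · exact norm_derivSymbol_le ν l _ k
      _ = freqNorm k ^ 2 * Real.exp (-((t - s) * ν * freqNorm k ^ 4)) := by ring
      _ ≤ _ := by simpa using h2
  have hj : ∀ j, ENNReal.ofReal (Real.sqrt (torusVol d) * l2norm (p t j - q t j)) ≤
      d * ∫⁻ s in Ioo 0 t, g s := by
    intro j
    apply ennreal_le_of_sq_le
    rw [← tsum_enorm_sq_fourierCoef_continuous]
    calc ∑' k, ‖fourierCoef (p t j - q t j : C(Torus d, ℝ)) k‖ₑ ^ 2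
        ≤ ∑' k, (d : ℝ≥0∞) * ∑ l, (∫⁻ s in Ioo 0 t, G l s k) ^ 2 := by
          refine ENNReal.tsum_le_tsum fun k => ?_
          refine le_trans ?_ (sq_sum_le_card _)
          gcongr
          exact hcoef j k
      _ = d * ∑ l, ∑' k, (∫⁻ s in Ioo 0 t, G l s k) ^ 2 := by
          rw [ENNReal.tsum_mul_left, Summable.tsum_finsetSum fun _ _ => ENNReal.summable]
      _ ≤ d * ∑ _l : Fin d, (∫⁻ s in Ioo 0 t, g s) ^ 2 := by
          gcongr with l _; exact hmink l
      _ = _ := by simp; ring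
  have hsum : ENNReal.ofReal (Real.sqrt (torusVol d)) * ENNReal.ofReal (Nf t) ≤
      d * d * ∫⁻ s in Ioo 0 t, g s := by
    rw [hNf]
    simp only
    rw [ENNReal.ofReal_sum_of_nonneg fun _ _ => l2norm_nonneg _, Finset.mul_sum]
    calc _ ≤ ∑ _j : Fin d, d * ∫⁻ s in Ioo 0 t, g s := by
          refine Finset.sum_le_sum fun j _ => ?_
          rw [← ENNReal.ofReal_mul hsv.le]
          exact hj j
      _ = _ := by simp; ring
  have hg2 : d * d * ∫⁻ s in Ioo 0 t, g s ≤ ENNReal.ofReal (Real.sqrt (torusVol d)) *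
      ∫⁻ s in Ioo 0 t, ENNReal.ofReal ((d * d * C * (d + 2) + 1) * ((t - s) ^ (-(1 / 2) : ℝ) *
          ((P s + 1) * Nf s))) := by
    rw [← lintegral_const_mul' _ _ ENNReal.ofReal_ne_top,
      ← lintegral_const_mul' _ _ (by finiteness)]
    refine setLIntegral_mono' measurableSet_Ioo fun s hs => ?_
    have hs2 : 0 < t - s := by linarith [hs.2]
    -- P is constrained only through some index i, so its sign is known only when d is positive.
    have hP0 : (d : ℝ) ≠ 0 → 0 ≤ P s := fun hd0 => by
      have : 0 < d := Nat.pos_of_ne_zero (by exact_mod_cast hd0)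
      exact (sq_nonneg _).trans (hP s (hsub hs) ⟨0, this⟩).1
    simp only [hg]
    rw [show (d : ℝ≥0∞) = ENNReal.ofReal d by simp, ← ENNReal.ofReal_mul (by positivity),
      ← ENNReal.ofReal_mul (by positivity), ← ENNReal.ofReal_mul hsv.le]
    apply ENNReal.ofReal_le_ofReal
    rcases eq_or_ne (d : ℝ) 0 with hd0 | hd0
    · have hdz : d = 0 := by exact_mod_cast hd0
      subst hdz
      simp [hNf]
    · have hP1 := hP0 hd0
      have hd1 : (0 : ℝ) ≤ d := Nat.cast_nonneg d
      have e1 : ((d : ℝ) + 2) * P s + 1 ≤ (d + 2) * (P s + 1) := by nlinarith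
      calc d * d * (C * (t - s) ^ (-(1 / 2) : ℝ) *
            (Real.sqrt (torusVol d) * (((d + 2) * P s + 1) * Nf s)))
          ≤ d * d * (C * (t - s) ^ (-(1 / 2) : ℝ) *
            (Real.sqrt (torusVol d) * (((d + 2) * (P s + 1)) * Nf s))) := by
            gcongr; exact hN0 s
        _ = Real.sqrt (torusVol d) * ((d * d * C * (d + 2)) * ((t - s) ^ (-(1 / 2) : ℝ) *
            ((P s + 1) * Nf s))) := by ring
        _ ≤ _ := by
            have h1 := hN0 s
            gcongr
            linarith
  have hfin := hsum.trans hg2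
  exact (ENNReal.mul_le_mul_iff_right (by simpa using hv) ENNReal.ofReal_ne_top).mp hfin

theorem exp_neg_le_rpow {y : ℝ} (hy : 0 < y) : Real.exp (-y) ≤ y ^ (-(1 / 4) : ℝ) := by
  have h1 : y ^ (1 / 4 : ℝ) ≤ Real.exp y := by
    calc y ^ (1 / 4 : ℝ) ≤ (1 + y) ^ (1 / 4 : ℝ) := by gcongr; linarith
      _ ≤ (1 + y) ^ (1 : ℝ) := Real.rpow_le_rpow_of_exponent_le (by linarith) (by norm_num)
      _ ≤ Real.exp y := by rw [Real.rpow_one, add_comm]; exact Real.add_one_le_exp y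
  rw [Real.exp_neg, Real.rpow_neg hy.le]
  exact inv_anti₀ (by positivity) h1

/-- A singular Gronwall lemma. -/
theorem eq_zero_of_singular_gronwall {T C : ℝ} (hC : 0 < C) {N A : ℝ → ℝ}
    (hN0 : ∀ s ∈ Ioc 0 T, 0 ≤ N s) (hA0 : ∀ s ∈ Ioc 0 T, 0 ≤ A s)
    (hA : ∀ ε > 0, ∃ K > 0, ∀ s ∈ Ioc 0 T, A s ≤ ε * s ^ (-(1 / 2) : ℝ) + K)
    {M : ℝ} (hM : 0 ≤ M) (hNM : ∀ s ∈ Ioc 0 T, N s ≤ M * s ^ (-(1 / 4) : ℝ))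
    (hint : ∀ t ∈ Ioc 0 T, ENNReal.ofReal (N t) ≤ ∫⁻ s in Ioo 0 t,
      ENNReal.ofReal (C * ((t - s) ^ (-(1 / 2) : ℝ) * (A s * N s)))) :
    ∀ t ∈ Ioc 0 T, N t = 0 := by
  rcases le_or_gt T 0 with hT | hT
  · exact fun s hs => absurd (hs.1.trans_le hs.2) (not_lt.mpr hT)
  obtain ⟨B₁, hB₁, hb₁⟩ := exists_lintegral_beta_le (α := 1 / 2) (β := 3 / 4) (by norm_num)
    (by norm_num) (by norm_num) (by norm_num)
  obtain ⟨B₂, hB₂, hb₂⟩ := exists_lintegral_beta_le (α := 3 / 4) (β := 1 / 4) (by norm_num)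
    (by norm_num) (by norm_num) (by norm_num)
  -- This ε makes the contribution of the s^{-1/2} part of A exactly a quarter of the bound. It
  -- cannot be gained from small time, because the kernel (t-s)^{-1/2} s^{-1/2} is scale invariant.
  obtain ⟨K, hK, hAK⟩ := hA (1 / (4 * (C * B₁))) (by positivity)
  set ε := 1 / (4 * (C * B₁)) with hε
  -- The part K of A is handled by the weight e^{λs}: the factor e^{-λ(t-s)} ≤ (λ(t-s))^{-1/4} gains
  -- λ^{-1/4} = 1/R. This R makes the second contribution a quarter as well.
  set R := 4 * (C * K * B₂ * T ^ (1 / 4 : ℝ)) with hR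
  have hR0 : 0 < R := by positivity
  set lam := R ^ 4 with hlam
  have hlam0 : 0 < lam := by positivity
  have hlamR : lam ^ (-(1 / 4) : ℝ) = R⁻¹ := by
    rw [hlam, ← Real.rpow_natCast, ← Real.rpow_mul hR0.le]
    norm_num
    exact Real.rpow_neg_one R
  -- Inserting a bound into the integral inequality halves its constant; iteration then forces N to
  -- vanish.
  have step : ∀ M : ℝ, 0 ≤ M →
      (∀ s ∈ Ioc 0 T, N s ≤ M * (Real.exp (lam * s) * s ^ (-(1 / 4) : ℝ))) →
      ∀ s ∈ Ioc 0 T, N s ≤ M / 2 * (Real.exp (lam * s) * s ^ (-(1 / 4) : ℝ)) := by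
    intro M hM h t ht
    have ht0 : 0 < t := ht.1
    have hsub : Ioo 0 t ⊆ Ioc 0 T := fun s hs => ⟨hs.1, hs.2.le.trans ht.2⟩
    set E := C * M * Real.exp (lam * t) with hE
    have hE0 : 0 ≤ E := by positivity
    have hpt : ∀ s ∈ Ioo 0 t, C * ((t - s) ^ (-(1 / 2) : ℝ) * (A s * N s)) ≤
        E * ε * ((t - s) ^ (-(1 / 2) : ℝ) * s ^ (-(3 / 4) : ℝ)) +
        E * K * R⁻¹ * ((t - s) ^ (-(3 / 4) : ℝ) * s ^ (-(1 / 4) : ℝ)) := by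
      intro s hs
      have hs0 : 0 < s := hs.1
      have hs2 : 0 < t - s := by linarith [hs.2]
      have hAs := hAK s (hsub hs)
      have hNs := h s (hsub hs)
      have hA1 := hA0 s (hsub hs)
      have hN1 := hN0 s (hsub hs)
      have e1 : s ^ (-(3 / 4) : ℝ) = s ^ (-(1 / 2) : ℝ) * s ^ (-(1 / 4) : ℝ) := by
        rw [← Real.rpow_add hs0]; norm_num
      have e2 : Real.exp (lam * s) ≤ Real.exp (lam * t) := by
        apply Real.exp_le_exp.mpr; gcongr; exact hs.2.le
      have e3 : Real.exp (lam * s) ≤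
          Real.exp (lam * t) * (R⁻¹ * (t - s) ^ (-(1 / 4) : ℝ)) := by
        have := exp_neg_le_rpow (mul_pos hlam0 hs2)
        rw [Real.mul_rpow hlam0.le hs2.le, hlamR] at this
        calc Real.exp (lam * s) = Real.exp (lam * t) * Real.exp (-(lam * (t - s))) := by
              rw [← Real.exp_add]; ring_nf
          _ ≤ _ := by gcongr
      have e4 : (t - s) ^ (-(3 / 4) : ℝ) = (t - s) ^ (-(1 / 2) : ℝ) * (t - s) ^ (-(1 / 4) : ℝ) := by
        rw [← Real.rpow_add hs2]; norm_num
      calc C * ((t - s) ^ (-(1 / 2) : ℝ) * (A s * N s))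
          ≤ C * ((t - s) ^ (-(1 / 2) : ℝ) * ((ε * s ^ (-(1 / 2) : ℝ) + K) *
            (M * (Real.exp (lam * s) * s ^ (-(1 / 4) : ℝ))))) := by gcongr
        _ = C * M * ((t - s) ^ (-(1 / 2) : ℝ) * ε * s ^ (-(3 / 4) : ℝ)) * Real.exp (lam * s) +
            C * M * ((t - s) ^ (-(1 / 2) : ℝ) * K * s ^ (-(1 / 4) : ℝ)) * Real.exp (lam * s) := by
            rw [e1]; ring
        _ ≤ C * M * ((t - s) ^ (-(1 / 2) : ℝ) * ε * s ^ (-(3 / 4) : ℝ)) * Real.exp (lam * t) +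
            C * M * ((t - s) ^ (-(1 / 2) : ℝ) * K * s ^ (-(1 / 4) : ℝ)) *
              (Real.exp (lam * t) * (R⁻¹ * (t - s) ^ (-(1 / 4) : ℝ))) := by gcongr
        _ = _ := by rw [hE, e4]; ring
    have hle : ENNReal.ofReal (N t) ≤
        ENNReal.ofReal (M / 2 * (Real.exp (lam * t) * t ^ (-(1 / 4) : ℝ))) := by
      refine (hint t ht).trans ?_
      calc _ ≤ ∫⁻ s in Ioo 0 t,
            (ENNReal.ofReal (E * ε) *
              ENNReal.ofReal ((t - s) ^ (-(1 / 2) : ℝ) * s ^ (-(3 / 4) : ℝ)) +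
            ENNReal.ofReal (E * K * R⁻¹) *
              ENNReal.ofReal ((t - s) ^ (-(3 / 4) : ℝ) * s ^ (-(1 / 4) : ℝ))) := by
            refine setLIntegral_mono' measurableSet_Ioo fun s hs => ?_
            have hs0 : 0 < s := hs.1
            have hs2 : 0 < t - s := by linarith [hs.2]
            rw [← ENNReal.ofReal_mul (by positivity), ← ENNReal.ofReal_mul (by positivity),
              ← ENNReal.ofReal_add (by positivity) (by positivity)]
            exact ENNReal.ofReal_le_ofReal (hpt s hs)
        _ ≤ ENNReal.ofReal (E * ε) * ENNReal.ofReal (B₁ * t ^ (1 - 1 / 2 - 3 / 4 : ℝ)) +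
            ENNReal.ofReal (E * K * R⁻¹) * ENNReal.ofReal (B₂ * t ^ (1 - 3 / 4 - 1 / 4 : ℝ)) := by
            rw [lintegral_add_left (by fun_prop), lintegral_const_mul' _ _ ENNReal.ofReal_ne_top,
              lintegral_const_mul' _ _ ENNReal.ofReal_ne_top]
            gcongr
            · exact hb₁ t ht0
            · exact hb₂ t ht0
        _ ≤ _ := by
            rw [← ENNReal.ofReal_mul (by positivity), ← ENNReal.ofReal_mul (by positivity),
              ← ENNReal.ofReal_add (by positivity) (by positivity)]
            apply ENNReal.ofReal_le_ofReal
            have e1 : E * ε * (B₁ * t ^ (1 - 1 / 2 - 3 / 4 : ℝ)) =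
                M / 4 * (Real.exp (lam * t) * t ^ (-(1 / 4) : ℝ)) := by
              rw [hE, hε]; norm_num; field_simp
            have e2 : E * K * R⁻¹ * (B₂ * t ^ (1 - 3 / 4 - 1 / 4 : ℝ)) =
                M / 4 * (Real.exp (lam * t) * T ^ (-(1 / 4) : ℝ)) := by
              rw [hE, hR, Real.rpow_neg hT.le]; norm_num; field_simp
            have e3 : T ^ (-(1 / 4) : ℝ) ≤ t ^ (-(1 / 4) : ℝ) :=
              Real.rpow_le_rpow_of_nonpos ht0 ht.2 (by norm_num)
            rw [e1, e2]
            calc _ ≤ M / 4 * (Real.exp (lam * t) * t ^ (-(1 / 4) : ℝ)) +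
                  M / 4 * (Real.exp (lam * t) * t ^ (-(1 / 4) : ℝ)) := by gcongr
              _ = _ := by ring
    exact (ENNReal.ofReal_le_ofReal_iff (by positivity)).mp hle
  have iter : ∀ n : ℕ, ∀ s ∈ Ioc 0 T,
      N s ≤ M * (1 / 2) ^ n * (Real.exp (lam * s) * s ^ (-(1 / 4) : ℝ)) := by
    intro n
    induction n with
    | zero =>
      intro s hs
      have hs0 : 0 < s := hs.1
      refine (hNM s hs).trans ?_
      rw [pow_zero, mul_one]
      have : 1 ≤ Real.exp (lam * s) := Real.one_le_exp (by positivity)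
      gcongr
      exact le_mul_of_one_le_left (by positivity) this
    | succ n ih =>
      have := step _ (by positivity) ih
      intro s hs
      refine (this s hs).trans (le_of_eq ?_)
      ring
  intro t ht
  refine le_antisymm ?_ (hN0 t ht)
  have hlim : Tendsto (fun n : ℕ => M * (1 / 2 : ℝ) ^ n *
      (Real.exp (lam * t) * t ^ (-(1 / 4) : ℝ))) atTop (𝓝 0) := by
    have := ((tendsto_pow_atTop_nhds_zero_of_lt_one (r := (1 / 2 : ℝ)) (by norm_num)
      (by norm_num)).const_mul M).mul_const (Real.exp (lam * t) * t ^ (-(1 / 4) : ℝ))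
    simpa using this
  exact ge_of_tendsto' hlim fun n => iter n t ht

/-- Gronwall shows that the gradients agree. The mild formula recovers h, zero frequency included,
from h₀ and the gradient, so the solutions agree too. -/
theorem IsMildSolution.unique {ν T : ℝ} (hν : 0 < ν) {h₀ : L2 d} {h₁ h₂ : ℝ → L2 d}
    (hm₁ : IsMildSolution ν h₀ T h₁) (hm₂ : IsMildSolution ν h₀ T h₂) :
    EqOn h₁ h₂ (Icc 0 T) := by
  rw [isMildSolution_iff hν] at hm₁ hm₂
  obtain ⟨-, -, h1z, p, hw₁, hp, hc₁⟩ := hm₁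
  obtain ⟨-, -, h2z, q, hw₂, hq, hc₂⟩ := hm₂
  obtain ⟨C, hC, hdiff⟩ := exists_difference_inequality hν d
  obtain ⟨Kp, hKp0, hKp⟩ := hp.exists_bound
  obtain ⟨Kq, hKq0, hKq⟩ := hq.exists_bound
  set P : ℝ → ℝ := fun s => ∑ i, ‖p s i‖ ^ 2 + ∑ i, ‖q s i‖ ^ 2 with hP
  have hP0 : ∀ s, 0 ≤ P s := fun s => by positivity
  have key := eq_zero_of_singular_gronwall (T := T) hC
    (N := fun s => ∑ i, l2norm (p s i - q s i)) (A := fun s => P s + 1)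
    (fun s _ => Finset.sum_nonneg fun _ _ => l2norm_nonneg _)
    (fun s _ => by have := hP0 s; positivity) ?_
    (M := d * (Real.sqrt (torusVol d) * (Kp + Kq))) (by positivity) ?_
    (hdiff T h₀ h₁ h₂ p q P hw₁ hw₂ hp hq hc₁ hc₂ ?_)
  · have hpq : ∀ s ∈ Ioc 0 T, p s = q s := by
      intro s hs
      funext i
      have h1 := (Finset.sum_eq_zero_iff_of_nonneg fun i _ => l2norm_nonneg _).mp (key s hs) i
        (Finset.mem_univ i)
      rw [l2norm, norm_eq_zero, map_sub, sub_eq_zero] at h1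
      exact ContinuousMap.toLp_injective (p := 2) (𝕜 := ℝ) (volume : Measure (Torus d)) h1
    intro t ht
    rcases eq_or_lt_of_le ht.1 with h | h
    · rw [← h, h1z, h2z]
    · have ht' : t ∈ Ioc 0 T := ⟨h, ht.2⟩
      apply ext_fourierCoef
      intro k
      rw [hc₁ t ht' k, hc₂ t ht' k]
      congr 1
      refine Finset.sum_congr rfl fun j _ => ?_
      refine setIntegral_congr_fun measurableSet_Ioo fun s hs => ?_
      rw [hpq s ⟨hs.1, hs.2.le.trans ht.2⟩]
  · intro ε hε
    obtain ⟨K₁, hK₁, hb₁⟩ := hp.exists_small (ε := ε / (2 * (d + 1))) (by positivity)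
    obtain ⟨K₂, hK₂, hb₂⟩ := hq.exists_small (ε := ε / (2 * (d + 1))) (by positivity)
    -- Each solution contributes d terms with coefficient ε/(2(d+1)), hence at most ε/2. The final 1
    -- is the linear term of the flux contained in A = P + 1.
    refine ⟨d * K₁ + d * K₂ + 1, by positivity, fun s hs => ?_⟩
    have hs0 : 0 < s := hs.1
    simp only [hP]
    have h1 : ∑ i, ‖p s i‖ ^ 2 ≤ d * (ε / (2 * (d + 1)) * s ^ (-(1 / 2) : ℝ) + K₁) := by
      calc _ ≤ ∑ _i : Fin d, (ε / (2 * (d + 1)) * s ^ (-(1 / 2) : ℝ) + K₁) :=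
            Finset.sum_le_sum fun i _ => hb₁ s hs i
        _ = _ := by simp; ring
    have h2 : ∑ i, ‖q s i‖ ^ 2 ≤ d * (ε / (2 * (d + 1)) * s ^ (-(1 / 2) : ℝ) + K₂) := by
      calc _ ≤ ∑ _i : Fin d, (ε / (2 * (d + 1)) * s ^ (-(1 / 2) : ℝ) + K₂) :=
            Finset.sum_le_sum fun i _ => hb₂ s hs i
        _ = _ := by simp; ring
    have h3 : (d : ℝ) * (ε / (2 * (d + 1))) ≤ ε / 2 := by
      rw [mul_div_assoc', div_le_div_iff₀ (by positivity) two_pos]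
      nlinarith
    have h4 := mul_le_mul_of_nonneg_right h3 (by positivity : 0 ≤ s ^ (-(1 / 2) : ℝ))
    linarith
  · intro s hs
    have hs0 : 0 < s := hs.1
    calc ∑ i, l2norm (p s i - q s i)
        ≤ ∑ _i : Fin d, Real.sqrt (torusVol d) * ((Kp + Kq) * s ^ (-(1 / 4) : ℝ)) := by
          refine Finset.sum_le_sum fun i _ => (norm_toLp_le _).trans ?_
          gcongr
          refine (norm_sub_le _ _).trans ?_
          rw [add_mul]
          exact add_le_add (hKp s hs i) (hKq s hs i)
      _ = _ := by simp; ring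
  · intro t ht i
    have h1 := Finset.single_le_sum (f := fun i => ‖p t i‖ ^ 2) (fun _ _ => sq_nonneg _)
      (Finset.mem_univ i)
    have h2 := Finset.single_le_sum (f := fun i => ‖q t i‖ ^ 2) (fun _ _ => sq_nonneg _)
      (Finset.mem_univ i)
    have h3 : 0 ≤ ∑ i, ‖p t i‖ ^ 2 := by positivity
    have h4 : 0 ≤ ∑ i, ‖q t i‖ ^ 2 := by positivity
    constructor <;> simp only [hP] <;> linarith

end Uniqueness

/-! ### The scale invariant energy and the flux estimate -/

section Energy

variable {d : ℕ}

/-- The convolution of nonnegative families. -/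
noncomputable def conv (A B : (Fin d → ℤ) → ℝ≥0∞) (k : Fin d → ℤ) : ℝ≥0∞ :=
  ∑' l, A l * B (k - l)

theorem conv_const_mul_left (c : ℝ≥0∞) (A B : (Fin d → ℤ) → ℝ≥0∞) (k : Fin d → ℤ) :
    conv (fun l => c * A l) B k = c * conv A B k := by
  simp only [conv, mul_assoc, ENNReal.tsum_mul_left]

/-- The weighted square sum `∑ (1+|k|)^{d-1} (1+a|k|)^{2N} f(k)²`. -/
noncomputable def wsum (N : ℕ) (a : ℝ) (f : (Fin d → ℤ) → ℝ≥0∞) : ℝ≥0∞ :=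
  ∑' k, ENNReal.ofReal (wt N a k) * f k ^ 2

theorem wsum_mono {N : ℕ} {a : ℝ} {f g : (Fin d → ℤ) → ℝ≥0∞} (h : ∀ k, f k ≤ g k) :
    wsum N a f ≤ wsum N a g := by
  unfold wsum
  refine ENNReal.tsum_le_tsum fun k => ?_
  gcongr
  exact h k

theorem wsum_add_le {N : ℕ} {a : ℝ} (f g : (Fin d → ℤ) → ℝ≥0∞) :
    wsum N a (fun k => f k + g k) ≤ 2 * wsum N a f + 2 * wsum N a g := by
  simp only [wsum, ← ENNReal.tsum_mul_left, ← ENNReal.tsum_add]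
  refine ENNReal.tsum_le_tsum fun k => ?_
  calc _ ≤ ENNReal.ofReal (wt N a k) * (2 * f k ^ 2 + 2 * g k ^ 2) := by
        gcongr; exact ennreal_add_sq_le _ _
    _ = _ := by ring

theorem wsum_const_mul {N : ℕ} {a : ℝ} (c : ℝ≥0∞) (f : (Fin d → ℤ) → ℝ≥0∞) :
    wsum N a (fun k => c * f k) = c ^ 2 * wsum N a f := by
  simp only [wsum, ← ENNReal.tsum_mul_left]
  refine tsum_congr fun k => ?_
  ring

/-- The modulus `|k| |x(k)|` of the gradient on the Fourier side. -/
noncomputable def gradAbs (x : (Fin d → ℤ) → ℂ) (k : Fin d → ℤ) : ℝ≥0∞ :=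
  ENNReal.ofReal (freqNorm k) * ‖x k‖ₑ

/-- The scale invariant weighted energy at time `t`. -/
noncomputable def energy (N : ℕ) (t : ℝ) (x : (Fin d → ℤ) → ℂ) : ℝ≥0∞ :=
  ENNReal.ofReal (t ^ (1 / 4 : ℝ)) * wsum N (t ^ (1 / 4 : ℝ)) (gradAbs x)

theorem energy_add_le (N : ℕ) (t : ℝ) (x y : (Fin d → ℤ) → ℂ) :
    energy N t (fun k => x k + y k) ≤ 2 * energy N t x + 2 * energy N t y := by
  unfold energy
  calc _ ≤ ENNReal.ofReal (t ^ (1 / 4 : ℝ)) * (2 * wsum N (t ^ (1 / 4 : ℝ)) (gradAbs x) +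
        2 * wsum N (t ^ (1 / 4 : ℝ)) (gradAbs y)) := by
        gcongr
        refine (wsum_mono fun k => ?_).trans (wsum_add_le _ _)
        simp only [gradAbs]
        rw [← mul_add]
        gcongr
        exact enorm_add_le _ _
    _ = _ := by ring

theorem energy_triangle (N : ℕ) (t : ℝ) (x y z : (Fin d → ℤ) → ℂ) :
    energy N t (fun k => x k - z k) ≤
      2 * energy N t (fun k => x k - y k) + 2 * energy N t (fun k => y k - z k) := by
  have := energy_add_le N t (fun k => x k - y k) (fun k => y k - z k)
  simpa using this

theorem energy_zero (N : ℕ) (t : ℝ) : energy N t (fun _ : Fin d → ℤ => 0) = 0 := by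
  simp [energy, wsum, gradAbs]

/-- Fatou's lemma on finite sets of frequencies; it passes energy bounds to coefficientwise limits
of the iterates. -/
theorem energy_le_of_tendsto {N : ℕ} {t : ℝ} {x : ℕ → (Fin d → ℤ) → ℂ} {y : (Fin d → ℤ) → ℂ}
    {B : ℝ≥0∞} (hx : ∀ k, Tendsto (fun n => x n k) atTop (𝓝 (y k)))
    (hB : ∀ᶠ n in atTop, energy N t (x n) ≤ B) : energy N t y ≤ B := by
  have hE : ∀ z : (Fin d → ℤ) → ℂ, energy N t z = ∑' k, (ENNReal.ofReal (t ^ (1 / 4 : ℝ)) *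
      (ENNReal.ofReal (wt N (t ^ (1 / 4 : ℝ)) k) * ENNReal.ofReal (freqNorm k) ^ 2)) *
        ‖z k‖ₑ ^ 2 := by
    intro z
    rw [energy, wsum, ← ENNReal.tsum_mul_left]
    refine tsum_congr fun k => ?_
    rw [gradAbs]; ring
  rw [hE, ENNReal.tsum_eq_iSup_sum]
  refine iSup_le fun S => ?_
  refine le_of_tendsto (f := fun n => ∑ k ∈ S, (ENNReal.ofReal (t ^ (1 / 4 : ℝ)) *
      (ENNReal.ofReal (wt N (t ^ (1 / 4 : ℝ)) k) * ENNReal.ofReal (freqNorm k) ^ 2)) *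
        ‖x n k‖ₑ ^ 2) (x := atTop) ?_ ?_
  · refine tendsto_finsetSum _ fun k _ => ?_
    refine ENNReal.Tendsto.const_mul ?_ (Or.inr (by finiteness))
    exact ((ENNReal.continuous_pow 2).tendsto _).comp ((hx k).enorm)
  · filter_upwards [hB] with n hn
    refine le_trans ?_ hn
    rw [hE]
    exact ENNReal.sum_le_tsum S

/-- Hermitian symmetry. -/
def Herm (x : (Fin d → ℤ) → ℂ) : Prop := ∀ k, x (-k) = conj (x k)

/-- The gradient of the trigonometric series with coefficients `x`. -/
noncomputable def grad (x : (Fin d → ℤ) → ℂ) (j : Fin d) : C(Torus d, ℝ) :=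
  synth fun k => Complex.I * (k j : ℂ) * x k

theorem enorm_gradCoef_le (x : (Fin d → ℤ) → ℂ) (j : Fin d) (k : Fin d → ℤ) :
    ‖Complex.I * (k j : ℂ) * x k‖ₑ ≤ gradAbs x k := by
  rw [enorm_mul, gradAbs]
  gcongr
  rw [← ofReal_norm, norm_mul, Complex.norm_I, one_mul, Complex.norm_intCast]
  exact ENNReal.ofReal_le_ofReal (abs_le_freqNorm k j)

theorem summable_gradCoef {x : (Fin d → ℤ) → ℂ} (hx : ∑' k, gradAbs x k < ⊤) (j : Fin d) :
    Summable fun k : Fin d → ℤ => ‖Complex.I * (k j : ℂ) * x k‖ := by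
  have h : ∑' k : Fin d → ℤ, ‖Complex.I * (k j : ℂ) * x k‖ₑ < ⊤ :=
    (ENNReal.tsum_le_tsum fun k => enorm_gradCoef_le x j k).trans_lt hx
  simpa using ENNReal.summable_toReal h.ne

theorem fourierCoef_grad {x : (Fin d → ℤ) → ℂ} (hx : Herm x) (hs : ∑' k, gradAbs x k < ⊤)
    (j : Fin d) (k : Fin d → ℤ) :
    fourierCoef (grad x j) k = Complex.I * (k j : ℂ) * x k := by
  apply fourierCoef_synth (summable_gradCoef hs j)
  intro k
  simp only [Pi.neg_apply, Int.cast_neg, hx k, map_mul, Complex.conj_I, map_intCast]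
  ring

theorem enorm_fourierCoef_grad_le {x : (Fin d → ℤ) → ℂ} (hx : Herm x)
    (hs : ∑' k, gradAbs x k < ⊤) (j : Fin d) (k : Fin d → ℤ) :
    ‖fourierCoef (grad x j) k‖ₑ ≤ gradAbs x k := by
  rw [fourierCoef_grad hx hs]; exact enorm_gradCoef_le x j k

theorem enorm_fourierCoef_mul_le_conv {f g : C(Torus d, ℝ)} {A B : (Fin d → ℤ) → ℝ≥0∞}
    (hf : ∀ k, ‖fourierCoef f k‖ₑ ≤ A k) (hg : ∀ k, ‖fourierCoef g k‖ₑ ≤ B k) (k : Fin d → ℤ) :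
    ‖fourierCoef (f * g : C(Torus d, ℝ)) k‖ₑ ≤ ENNReal.ofReal (torusVol d)⁻¹ * conv A B k := by
  refine (enorm_fourierCoef_mul_le f g k).trans ?_
  gcongr
  exact ENNReal.tsum_le_tsum fun l => mul_le_mul' (hf l) (hg (k - l))

/-- The cubic difference is a sum of 2d products of three factors, exactly one of which is a
difference of gradients. Products become convolutions of majorants, each product costing 1/vol. -/
theorem enorm_fourierCoef_flux_sub_le {x y : (Fin d → ℤ) → ℂ} (hx : Herm x) (hy : Herm y)
    (hsx : ∑' k, gradAbs x k < ⊤) (hsy : ∑' k, gradAbs y k < ⊤) (j : Fin d) (k : Fin d → ℤ) :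
    ‖fourierCoef (flux (grad x) j - flux (grad y) j : C(Torus d, ℝ)) k‖ₑ ≤
      (2 * d * ENNReal.ofReal (torusVol d)⁻¹ ^ 2) *
        conv (conv (fun l => gradAbs x l + gradAbs y l) fun l => gradAbs x l + gradAbs y l)
          (gradAbs fun l => x l - y l) k + gradAbs (fun l => x l - y l) k := by
  set v := ENNReal.ofReal (torusVol d)⁻¹ with hv
  set X : (Fin d → ℤ) → ℝ≥0∞ := fun l => gradAbs x l + gradAbs y l with hX
  set D := gradAbs fun l => x l - y l with hD
  have hp : ∀ i k, ‖fourierCoef (grad x i) k‖ₑ ≤ X k := fun i k =>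
    (enorm_fourierCoef_grad_le hx hsx i k).trans le_self_add
  have hq : ∀ i k, ‖fourierCoef (grad y i) k‖ₑ ≤ X k := fun i k =>
    (enorm_fourierCoef_grad_le hy hsy i k).trans le_add_self
  have hpq : ∀ i k, ‖fourierCoef (grad x i + grad y i : C(Torus d, ℝ)) k‖ₑ ≤ X k := by
    intro i k
    rw [fourierCoef_add_continuous]
    exact (enorm_add_le _ _).trans (add_le_add (enorm_fourierCoef_grad_le hx hsx i k)
      (enorm_fourierCoef_grad_le hy hsy i k))
  have hd : ∀ i k, ‖fourierCoef (grad x i - grad y i : C(Torus d, ℝ)) k‖ₑ ≤ D k := by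
    intro i k
    rw [fourierCoef_sub_continuous, fourierCoef_grad hx hsx, fourierCoef_grad hy hsy, ← mul_sub]
    exact enorm_gradCoef_le (fun l => x l - y l) i k
  have h1 : ∀ i, ‖fourierCoef ((grad x j * (grad x i + grad y i)) * (grad x i - grad y i) :
      C(Torus d, ℝ)) k‖ₑ ≤ v ^ 2 * conv (conv X X) D k := by
    intro i
    refine (enorm_fourierCoef_mul_le_conv
      (enorm_fourierCoef_mul_le_conv (hp j) (hpq i)) (hd i) k).trans (le_of_eq ?_)
    rw [conv_const_mul_left]; ring
  have h2 : ∀ i, ‖fourierCoef ((grad y i * grad y i) * (grad x j - grad y j) :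
      C(Torus d, ℝ)) k‖ₑ ≤ v ^ 2 * conv (conv X X) D k := by
    intro i
    refine (enorm_fourierCoef_mul_le_conv
      (enorm_fourierCoef_mul_le_conv (hq i) (hq i)) (hd j) k).trans (le_of_eq ?_)
    rw [conv_const_mul_left]; ring
  have hdec : flux (grad x) j - flux (grad y) j =
      (∑ i, (grad x j * (grad x i + grad y i)) * (grad x i - grad y i)) +
      (∑ i, (grad y i * grad y i) * (grad x j - grad y j)) - (grad x j - grad y j) := by
    rw [flux_sub_flux, ← Finset.sum_mul]
    simp only [sq]
    ring
  rw [hdec, fourierCoef_sub_continuous, fourierCoef_add_continuous, fourierCoef_sum_continuous,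
    fourierCoef_sum_continuous]
  refine (enorm_sub_le).trans (add_le_add ?_ (hd j k))
  refine (enorm_add_le _ _).trans ?_
  calc _ ≤ (∑ _i : Fin d, v ^ 2 * conv (conv X X) D k) +
        ∑ _i : Fin d, v ^ 2 * conv (conv X X) D k :=
        add_le_add ((enorm_sum_le _ _).trans (Finset.sum_le_sum fun i _ => h1 i))
          ((enorm_sum_le _ _).trans (Finset.sum_le_sum fun i _ => h2 i))
    _ = _ := by simp; ring

/-- One factor t^{-1/4} undoes the normalization of the energy and another is the lattice sum at a =
t^{1/4}. This is the bound of ∇h in the sup norm by t^{-1/4}. -/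
theorem sq_tsum_gradAbs_le (hd : 1 ≤ d) {N : ℕ} (hN : 1 ≤ N) {t : ℝ} (ht : 0 < t) (ht1 : t ≤ 1)
    (x : (Fin d → ℤ) → ℂ) :
    (∑' k, gradAbs x k) ^ 2 ≤
      ENNReal.ofReal (latticeConst d * t ^ (-(1 / 2) : ℝ)) * energy N t x := by
  have ha : 0 < t ^ (1 / 4 : ℝ) := by positivity
  have h := sq_tsum_le_wt hd hN ha (Real.rpow_le_one ht.le ht1 (by norm_num)) (gradAbs x)
  refine h.trans (le_of_eq ?_)
  rw [energy, ← mul_assoc, ← ENNReal.ofReal_mul (by unfold latticeConst; positivity), wsum]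
  congr 2
  rw [mul_assoc, ← Real.rpow_add ht, div_eq_mul_inv, ← Real.rpow_neg ht.le]
  norm_num

theorem tsum_gradAbs_lt_top (hd : 1 ≤ d) {N : ℕ} (hN : 1 ≤ N) {t : ℝ} (ht : 0 < t) (ht1 : t ≤ 1)
    {x : (Fin d → ℤ) → ℂ} (hx : energy N t x < ⊤) : ∑' k, gradAbs x k < ⊤ := by
  have h := (sq_tsum_gradAbs_le hd hN ht ht1 x).trans_lt
    (ENNReal.mul_lt_top ENNReal.ofReal_lt_top hx)
  by_contra hc
  rw [not_lt, top_le_iff] at hc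
  rw [hc] at h
  simp at h

/-- Each of the three factors of the cubic term carries s^{-1/4} from the normalization, and each of
the two convolutions another s^{-1/4}, in total s^{-5/4}. The linear term carries only s^{-1/4},
hence the summand s next to A². -/
theorem exists_wsum_flux_sub_le (hd : 1 ≤ d) {N : ℕ} (hN : 1 ≤ N) :
    ∃ C : ℝ, 0 < C ∧ ∀ (s : ℝ), 0 < s → s ≤ 1 → ∀ (x y : (Fin d → ℤ) → ℂ) (A B : ℝ≥0∞), A < ⊤ →
      Herm x → Herm y → energy N s x ≤ A → energy N s y ≤ A →
      energy N s (fun k => x k - y k) ≤ B → ∀ j : Fin d,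
      wsum N (s ^ (1 / 4 : ℝ)) (fun k =>
        ‖fourierCoef (flux (grad x) j - flux (grad y) j : C(Torus d, ℝ)) k‖ₑ) ≤
      ENNReal.ofReal (s ^ (-(5 / 4) : ℝ)) *
        (ENNReal.ofReal C * (A ^ 2 + ENNReal.ofReal s) * B) := by
  have hL : 0 ≤ latticeConst d := by unfold latticeConst; positivity
  have hv := torusVol_pos d
  set Kr : ℝ := 2 ^ (d + 1 + 2 * N) * latticeConst d with hKr
  have hKr0 : 0 ≤ Kr := by positivity
  set cr : ℝ := 2 * d * (torusVol d)⁻¹ ^ 2 with hcr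
  -- The number 32 is 2·4·4: one 2 from squaring a sum, and a 4 for each of the two factors |∇x| +
  -- |∇y|. The 2 belongs to the linear term.
  refine ⟨32 * cr ^ 2 * Kr ^ 2 + 2, by positivity, ?_⟩
  intro s hs hs1 x y A B hA hx hy hEx hEy hExy j
  set a := s ^ (1 / 4 : ℝ) with ha
  have ha0 : 0 < a := by positivity
  have ha1 : a ≤ 1 := Real.rpow_le_one hs.le hs1 (by norm_num)
  set ia := ENNReal.ofReal a⁻¹ with hia
  have hiaa : ia * ENNReal.ofReal a = 1 := by
    rw [hia, ← ENNReal.ofReal_mul (by positivity), inv_mul_cancel₀ ha0.ne', ENNReal.ofReal_one]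
  have hS : ∀ z : (Fin d → ℤ) → ℂ, wsum N a (gradAbs z) = ia * energy N s z := by
    intro z
    rw [energy, ← mul_assoc, hiaa, one_mul]
  have hsx := tsum_gradAbs_lt_top hd hN hs hs1 (hEx.trans_lt hA)
  have hsy := tsum_gradAbs_lt_top hd hN hs hs1 (hEy.trans_lt hA)
  set X : (Fin d → ℤ) → ℝ≥0∞ := fun l => gradAbs x l + gradAbs y l with hX
  set D := gradAbs fun l => x l - y l with hD
  have hSX : wsum N a X ≤ 4 * (ia * A) := by
    refine (wsum_add_le _ _).trans ?_
    rw [hS, hS]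
    calc _ ≤ 2 * (ia * A) + 2 * (ia * A) := by gcongr
      _ = _ := by ring
  have hSD : wsum N a D ≤ ia * B := by rw [hS]; gcongr
  have hK : ENNReal.ofReal (Kr / a) = ENNReal.ofReal Kr * ia := by
    rw [div_eq_mul_inv, ENNReal.ofReal_mul hKr0]
  have hXX : wsum N a (conv X X) ≤ ENNReal.ofReal Kr * ia * (4 * (ia * A)) * (4 * (ia * A)) := by
    refine (tsum_wt_conv_le hd hN ha0 ha1 X X).trans ?_
    rw [hK]
    exact mul_le_mul' (mul_le_mul' le_rfl hSX) hSX
  have hXXD : wsum N a (conv (conv X X) D) ≤ ENNReal.ofReal Kr * ia *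
      (ENNReal.ofReal Kr * ia * (4 * (ia * A)) * (4 * (ia * A))) * (ia * B) := by
    refine (tsum_wt_conv_le hd hN ha0 ha1 (conv X X) D).trans ?_
    rw [hK]
    exact mul_le_mul' (mul_le_mul' le_rfl hXX) hSD
  have hc : (2 * d * ENNReal.ofReal (torusVol d)⁻¹ ^ 2 : ℝ≥0∞) = ENNReal.ofReal cr := by
    rw [hcr, ENNReal.ofReal_mul (by positivity), ENNReal.ofReal_mul (by positivity),
      ENNReal.ofReal_pow (by positivity)]
    simp
  have hia5 : ENNReal.ofReal (s ^ (-(5 / 4) : ℝ)) = ia ^ 5 := by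
    rw [hia, ← ENNReal.ofReal_pow (by positivity), ha, ← Real.rpow_neg hs.le,
      ← Real.rpow_natCast, ← Real.rpow_mul hs.le]
    norm_num
  have hia1 : ia = ia ^ 5 * ENNReal.ofReal s := by
    have : ENNReal.ofReal s = ENNReal.ofReal a ^ 4 := by
      rw [← ENNReal.ofReal_pow ha0.le, ha, ← Real.rpow_natCast, ← Real.rpow_mul hs.le]
      norm_num
    rw [this]
    calc ia = ia * (ia * ENNReal.ofReal a) ^ 4 := by rw [hiaa]; simp
      _ = _ := by ring
  have hC : ENNReal.ofReal (32 * cr ^ 2 * Kr ^ 2 + 2) =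
      32 * ENNReal.ofReal cr ^ 2 * ENNReal.ofReal Kr ^ 2 + 2 := by
    have hcr0 : 0 ≤ cr := by positivity
    rw [ENNReal.ofReal_add (by positivity) (by positivity), ENNReal.ofReal_mul (by positivity),
      ENNReal.ofReal_mul (by positivity), ENNReal.ofReal_pow hcr0, ENNReal.ofReal_pow hKr0]
    simp
  calc _ ≤ wsum N a (fun k => ENNReal.ofReal cr * conv (conv X X) D k + D k) := by
        refine wsum_mono fun k => ?_
        rw [← hc]
        exact enorm_fourierCoef_flux_sub_le hx hy hsx hsy j k
    _ ≤ 2 * (ENNReal.ofReal cr ^ 2 * wsum N a (conv (conv X X) D)) + 2 * wsum N a D := by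
        rw [← wsum_const_mul]; exact wsum_add_le _ _
    _ ≤ 2 * (ENNReal.ofReal cr ^ 2 * (ENNReal.ofReal Kr * ia *
          (ENNReal.ofReal Kr * ia * (4 * (ia * A)) * (4 * (ia * A))) * (ia * B))) +
          2 * (ia * B) := by gcongr
    _ = ia ^ 5 * ((32 * ENNReal.ofReal cr ^ 2 * ENNReal.ofReal Kr ^ 2) * A ^ 2 * B) +
          2 * (ia ^ 5 * ENNReal.ofReal s * B) := by rw [← hia1]; ring
    _ ≤ ia ^ 5 * ((32 * ENNReal.ofReal cr ^ 2 * ENNReal.ofReal Kr ^ 2 + 2) *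
          (A ^ 2 + ENNReal.ofReal s) * B) := by
        have : ia ^ 5 * ((32 * ENNReal.ofReal cr ^ 2 * ENNReal.ofReal Kr ^ 2 + 2) *
          (A ^ 2 + ENNReal.ofReal s) * B) =
          (ia ^ 5 * ((32 * ENNReal.ofReal cr ^ 2 * ENNReal.ofReal Kr ^ 2) * A ^ 2 * B) +
          2 * (ia ^ 5 * ENNReal.ofReal s * B)) +
          (ia ^ 5 * ((32 * ENNReal.ofReal cr ^ 2 * ENNReal.ofReal Kr ^ 2) *
            ENNReal.ofReal s * B) + ia ^ 5 * (2 * A ^ 2 * B)) := by ring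
        rw [this]
        exact le_self_add
    _ = _ := by rw [hia5, hC]

/-- A weighted `ℓ²` bound for the Duhamel term. -/
theorem tsum_duhamel_le {ν : ℝ} {N : ℕ} {t : ℝ} {V : (Fin d → ℤ) → ℝ≥0∞}
    {κ : ℝ → ℝ} {γ : ℝ≥0∞} {G : Fin d → ℝ → (Fin d → ℤ) → ℂ}
    (hV : ∀ k, V k ≠ ⊤) (hγt : γ ≠ ⊤)
    (hκ : ∀ s ∈ Ioo 0 t, 0 ≤ κ s)
    (hmul : ∀ s ∈ Ioo 0 t, ∀ k, V k * ENNReal.ofReal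
      (freqNorm k * Real.exp (-((t - s) * ν * freqNorm k ^ 4))) ^ 2 ≤
        ENNReal.ofReal (κ s) ^ 2 * ENNReal.ofReal (wt N (s ^ (1 / 4 : ℝ)) k))
    (hG : ∀ l k, AEStronglyMeasurable (fun s => G l s k) (volume.restrict (Ioo 0 t)))
    (hγ : ∀ s ∈ Ioo 0 t, ∀ l, wsum N (s ^ (1 / 4 : ℝ)) (fun k => ‖G l s k‖ₑ) ≤
      ENNReal.ofReal (s ^ (-(5 / 4) : ℝ)) * γ) :
    ∑' k, V k * ‖∑ l, ∫ s in Ioo 0 t, derivSymbol ν l (t - s) k * G l s k‖ₑ ^ 2 ≤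
      d ^ 2 * (∫⁻ s in Ioo 0 t, ENNReal.ofReal (κ s * s ^ (-(5 / 8) : ℝ))) ^ 2 * γ := by
  set v : (Fin d → ℤ) → ℝ≥0∞ := fun k => (V k) ^ (1 / 2 : ℝ) with hv
  have hv2 : ∀ k, v k ^ 2 = V k := fun k => ennreal_sqrt_sq _
  have hvt : ∀ k, v k ≠ ⊤ := fun k => ENNReal.rpow_ne_top_of_nonneg (by norm_num) (hV k)
  set H : Fin d → ℝ → (Fin d → ℤ) → ℝ≥0∞ := fun l s k => v k * (ENNReal.ofReal
      (freqNorm k * Real.exp (-((t - s) * ν * freqNorm k ^ 4))) * ‖G l s k‖ₑ) with hH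
  set I := ∫⁻ s in Ioo 0 t, ENNReal.ofReal (κ s * s ^ (-(5 / 8) : ℝ)) with hI
  have hmeas : ∀ l k, AEMeasurable (fun s => ENNReal.ofReal
      (freqNorm k * Real.exp (-((t - s) * ν * freqNorm k ^ 4))) * ‖G l s k‖ₑ)
      (volume.restrict (Ioo 0 t)) := fun l k =>
    AEMeasurable.mul (Measurable.aemeasurable (by fun_prop)) (hG l k).enorm
  -- Minkowski's inequality brings the weighted ℓ² norm inside the time integral; s^{-5/8} is the
  -- square root of the factor in `hγ`.
  have hmink : ∀ l, ∑' k, (∫⁻ s in Ioo 0 t, H l s k) ^ 2 ≤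
      (∫⁻ s in Ioo 0 t, ENNReal.ofReal (κ s * s ^ (-(5 / 8) : ℝ)) * γ ^ (1 / 2 : ℝ)) ^ 2 := by
    intro l
    refine tsum_sq_lintegral_le (fun k => (hmeas l k).const_mul _) ?_
    refine (ae_restrict_iff' measurableSet_Ioo).mpr (ae_of_all _ fun s hs => ?_)
    have hs0 : 0 < s := hs.1
    rw [mul_pow, ennreal_sqrt_sq, ENNReal.ofReal_mul (hκ s hs), mul_pow]
    calc ∑' k, H l s k ^ 2 ≤ ∑' k, ENNReal.ofReal (κ s) ^ 2 *
          (ENNReal.ofReal (wt N (s ^ (1 / 4 : ℝ)) k) * ‖G l s k‖ₑ ^ 2) := by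
          refine ENNReal.tsum_le_tsum fun k => ?_
          simp only [hH]
          rw [mul_pow, mul_pow, hv2, ← mul_assoc, ← mul_assoc]
          exact mul_le_mul' (hmul s hs k) le_rfl
      _ = ENNReal.ofReal (κ s) ^ 2 * wsum N (s ^ (1 / 4 : ℝ)) (fun k => ‖G l s k‖ₑ) := by
          rw [ENNReal.tsum_mul_left, wsum]
      _ ≤ ENNReal.ofReal (κ s) ^ 2 * (ENNReal.ofReal (s ^ (-(5 / 4) : ℝ)) * γ) := by
          gcongr; exact hγ s hs l
      _ = _ := by
          rw [← ENNReal.ofReal_pow (by positivity : 0 ≤ s ^ (-(5 / 8) : ℝ)), ← Real.rpow_natCast,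
            ← Real.rpow_mul hs0.le]
          norm_num
          ring
  calc _ ≤ ∑' k, (d : ℝ≥0∞) * ∑ l, (∫⁻ s in Ioo 0 t, H l s k) ^ 2 := by
        refine ENNReal.tsum_le_tsum fun k => ?_
        refine le_trans ?_ (sq_sum_le_card _)
        rw [← hv2, ← mul_pow]
        gcongr
        calc v k * ‖∑ l, ∫ s in Ioo 0 t, derivSymbol ν l (t - s) k * G l s k‖ₑ
            ≤ v k * ∑ l, ∫⁻ s in Ioo 0 t, ENNReal.ofReal
              (freqNorm k * Real.exp (-((t - s) * ν * freqNorm k ^ 4))) * ‖G l s k‖ₑ := by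
              gcongr
              refine (enorm_sum_le _ _).trans (Finset.sum_le_sum fun l _ => ?_)
              refine (enorm_integral_le_lintegral_enorm _).trans (lintegral_mono fun s => ?_)
              simp only
              rw [enorm_mul]
              gcongr
              rw [← ofReal_norm]
              exact ENNReal.ofReal_le_ofReal (norm_derivSymbol_le ν l _ k)
          _ = _ := by
              rw [Finset.mul_sum]
              refine Finset.sum_congr rfl fun l _ => ?_
              rw [lintegral_const_mul' _ _ (hvt k)]
    _ = d * ∑ l, ∑' k, (∫⁻ s in Ioo 0 t, H l s k) ^ 2 := by
        rw [ENNReal.tsum_mul_left, Summable.tsum_finsetSum fun _ _ => ENNReal.summable]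
    _ ≤ d * ∑ _l : Fin d, (∫⁻ s in Ioo 0 t,
          ENNReal.ofReal (κ s * s ^ (-(5 / 8) : ℝ)) * γ ^ (1 / 2 : ℝ)) ^ 2 := by
        gcongr with l _; exact hmink l
    _ ≤ _ := by
        simp only [Finset.sum_const, Finset.card_univ, Fintype.card_fin, nsmul_eq_mul]
        rw [← mul_assoc, ← sq]
        rw [lintegral_mul_const' _ _ (ENNReal.rpow_ne_top_of_nonneg (by norm_num) hγt), mul_pow,
          ennreal_sqrt_sq, mul_assoc]

end Energy

/-! ### Duhamel bounds and the Picard map -/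

section Picard

variable {d : ℕ}

/-- By subadditivity of the fourth root, t^{1/4} ≤ s^{1/4} + (t-s)^{1/4}. The growth of the weight
from s to t is thus a power of 1+(t-s)^{1/4}|k|, which the semigroup over (s,t) absorbs. -/
theorem wt_le_wt_mul (N : ℕ) {s t : ℝ} (hs : 0 < s) (hst : s < t) (k : Fin d → ℤ) :
    wt N (t ^ (1 / 4 : ℝ)) k ≤
      wt N (s ^ (1 / 4 : ℝ)) k * ((1 + (t - s) ^ (1 / 4 : ℝ) * freqNorm k) ^ N) ^ 2 := by
  have h0 := norm_nonneg k
  have hts : 0 < t - s := by linarith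
  have h1 : t ^ (1 / 4 : ℝ) ≤ s ^ (1 / 4 : ℝ) + (t - s) ^ (1 / 4 : ℝ) := by
    have := Real.rpow_add_le_add_rpow hs.le hts.le (by norm_num : (0 : ℝ) ≤ 1 / 4) (by norm_num)
    rwa [add_sub_cancel] at this
  rw [wt, wt, ← pow_mul, mul_comm N 2, mul_assoc, ← mul_pow]
  have p1 : 0 ≤ s ^ (1 / 4 : ℝ) := by positivity
  have p2 : 0 ≤ (t - s) ^ (1 / 4 : ℝ) := by positivity
  have p3 : 0 ≤ t ^ (1 / 4 : ℝ) := Real.rpow_nonneg (by linarith) _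
  gcongr
  calc 1 + t ^ (1 / 4 : ℝ) * ‖k‖ ≤ 1 + (s ^ (1 / 4 : ℝ) + (t - s) ^ (1 / 4 : ℝ)) * ‖k‖ := by gcongr
    _ ≤ (1 + s ^ (1 / 4 : ℝ) * ‖k‖) * (1 + (t - s) ^ (1 / 4 : ℝ) * ‖k‖) := by
        have : 0 ≤ s ^ (1 / 4 : ℝ) * ‖k‖ * ((t - s) ^ (1 / 4 : ℝ) * ‖k‖) := by positivity
        nlinarith
    _ ≤ _ := by gcongr; exact norm_le_freqNorm k

theorem energy_eq_tsum (N : ℕ) {t : ℝ} (ht : 0 < t) (x : (Fin d → ℤ) → ℂ) :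
    energy N t x = ∑' k, ENNReal.ofReal (t ^ (1 / 4 : ℝ) * freqNorm k ^ 2 *
      wt N (t ^ (1 / 4 : ℝ)) k) * ‖x k‖ₑ ^ 2 := by
  rw [energy, wsum, ← ENNReal.tsum_mul_left]
  refine tsum_congr fun k => ?_
  have h1 := wt_pos N (by positivity : 0 ≤ t ^ (1 / 4 : ℝ)) k
  rw [gradAbs, ENNReal.ofReal_mul (by positivity), ENNReal.ofReal_mul (by positivity),
    ENNReal.ofReal_pow (freqNorm_nonneg k)]
  ring

/-- The second bound measures the Duhamel term in the critical norm and serves to prove continuity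
in H^{d/2} at t = 0. In both cases the Beta integral is independent of t, so the constant is uniform
in time. -/
theorem exists_duhamel_bounds (hd : 1 ≤ d) {ν : ℝ} (hν : 0 < ν) (N : ℕ) :
    ∃ C : ℝ, 0 < C ∧ ∀ (t : ℝ) (γ : ℝ≥0∞) (G : Fin d → ℝ → (Fin d → ℤ) → ℂ), 0 < t → γ ≠ ⊤ →
      (∀ l k, AEStronglyMeasurable (fun s => G l s k) (volume.restrict (Ioo 0 t))) →
      (∀ s ∈ Ioo 0 t, ∀ l, wsum N (s ^ (1 / 4 : ℝ)) (fun k => ‖G l s k‖ₑ) ≤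
        ENNReal.ofReal (s ^ (-(5 / 4) : ℝ)) * γ) →
      energy N t (fun k => ∑ l, ∫ s in Ioo 0 t, derivSymbol ν l (t - s) k * G l s k) ≤
        ENNReal.ofReal C * γ ∧
      ∑' k, ENNReal.ofReal (freqNorm k ^ d) *
        ‖∑ l, ∫ s in Ioo 0 t, derivSymbol ν l (t - s) k * G l s k‖ₑ ^ 2 ≤
        ENNReal.ofReal C * γ := by
  obtain ⟨C, hC, hheat⟩ := exists_heat_bound hν 2 N
  obtain ⟨B₁, hB₁, hb₁⟩ := exists_lintegral_beta_le (α := 1 / 2) (β := 5 / 8) (by norm_num)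
    (by norm_num) (by norm_num) (by norm_num)
  obtain ⟨B₂, hB₂, hb₂⟩ := exists_lintegral_beta_le (α := 3 / 8) (β := 5 / 8) (by norm_num)
    (by norm_num) (by norm_num) (by norm_num)
  have hd1 : (1 : ℝ) ≤ d := by exact_mod_cast hd
  have hsd : 1 ≤ Real.sqrt d := Real.one_le_sqrt.mpr hd1
  set c₂ : ℝ := Real.sqrt d ^ d with hc₂
  refine ⟨d ^ 2 * (C * B₁) ^ 2 + d ^ 2 * (c₂ * C * B₂) ^ 2, by positivity, ?_⟩
  intro t γ G ht hγ hG hw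
  have hto : ∀ b : ℝ, 0 ≤ b → (d : ℝ≥0∞) ^ 2 * ENNReal.ofReal b ^ 2 =
      ENNReal.ofReal (d ^ 2 * b ^ 2) := by
    intro b hb
    rw [ENNReal.ofReal_mul (by positivity), ENNReal.ofReal_pow (by positivity),
      ENNReal.ofReal_pow hb]
    simp
  constructor
  · rw [energy_eq_tsum N ht]
    -- Two derivatives cost (t-s)^{-1/2}, and t^{1/8} is the square root of the prefactor of the
    -- energy.
    refine (tsum_duhamel_le (N := N) (κ := fun s => C * t ^ (1 / 8 : ℝ) * (t - s) ^ (-(1 / 2) : ℝ))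
      (fun _ => ENNReal.ofReal_ne_top) hγ ?_ ?_ hG hw).trans ?_
    · intro s hs
      have : 0 < t - s := by linarith [hs.2]
      positivity
    · intro s hs k
      have hs0 : 0 < s := hs.1
      have hts : 0 < t - s := by linarith [hs.2]
      have hf := freqNorm_nonneg k
      have hw1 := wt_pos N (by positivity : 0 ≤ t ^ (1 / 4 : ℝ)) k
      have hw2 := wt_pos N (by positivity : 0 ≤ s ^ (1 / 4 : ℝ)) k
      rw [← ENNReal.ofReal_pow (by positivity), ← ENNReal.ofReal_pow (by positivity),
        ← ENNReal.ofReal_mul (by positivity), ← ENNReal.ofReal_mul (by positivity)]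
      apply ENNReal.ofReal_le_ofReal
      have h1 := hheat 2 zero_le_two (by norm_num) (t - s) hts _ hf
      rw [Real.rpow_two] at h1
      norm_num at h1
      have e8 : (t ^ (1 / 8 : ℝ)) ^ 2 = t ^ (1 / 4 : ℝ) := by
        rw [← Real.rpow_natCast, ← Real.rpow_mul ht.le]; norm_num
      set X := Real.exp (-((t - s) * ν * freqNorm k ^ 4))
      set Y := (1 + (t - s) ^ (1 / 4 : ℝ) * freqNorm k) ^ N
      calc _ ≤ t ^ (1 / 4 : ℝ) * freqNorm k ^ 2 * (wt N (s ^ (1 / 4 : ℝ)) k * Y ^ 2) *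
            (freqNorm k * X) ^ 2 := by
            gcongr; exact wt_le_wt_mul N hs0 hs.2 k
        _ = t ^ (1 / 4 : ℝ) * (freqNorm k ^ 2 * Y * X) ^ 2 * wt N (s ^ (1 / 4 : ℝ)) k := by ring
        _ ≤ t ^ (1 / 4 : ℝ) * (C * (t - s) ^ (-(1 / 2) : ℝ)) ^ 2 *
            wt N (s ^ (1 / 4 : ℝ)) k := by gcongr
        _ = _ := by rw [← e8]; ring
    · have : ∫⁻ s in Ioo 0 t, ENNReal.ofReal
          (C * t ^ (1 / 8 : ℝ) * (t - s) ^ (-(1 / 2) : ℝ) * s ^ (-(5 / 8) : ℝ)) ≤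
          ENNReal.ofReal (C * B₁) := by
        calc _ = ∫⁻ s in Ioo 0 t, ENNReal.ofReal (C * t ^ (1 / 8 : ℝ)) *
              ENNReal.ofReal ((t - s) ^ (-(1 / 2) : ℝ) * s ^ (-(5 / 8) : ℝ)) := by
              refine lintegral_congr fun s => ?_
              rw [← ENNReal.ofReal_mul (by positivity), mul_assoc]
          _ ≤ ENNReal.ofReal (C * t ^ (1 / 8 : ℝ)) *
              ENNReal.ofReal (B₁ * t ^ (1 - 1 / 2 - 5 / 8 : ℝ)) := by
              rw [lintegral_const_mul' _ _ ENNReal.ofReal_ne_top]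
              gcongr
              exact hb₁ t ht
          _ = _ := by
              rw [← ENNReal.ofReal_mul (by positivity)]
              congr 1
              rw [mul_mul_mul_comm, ← Real.rpow_add ht]
              norm_num
      calc _ ≤ d ^ 2 * ENNReal.ofReal (C * B₁) ^ 2 * γ := by gcongr
        _ ≤ _ := by
            rw [hto _ (by positivity)]
            gcongr
            exact le_add_of_nonneg_right (by positivity)
  -- Write |k|^d |k|² = |k|^{d-1} (|k|^{3/2})². The first factor is part of the weight, so only 3/2
  -- derivatives, that is (t-s)^{-3/8}, are charged to the semigroup.
  · refine (tsum_duhamel_le (N := N) (κ := fun s => c₂ * C * (t - s) ^ (-(3 / 8) : ℝ))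
      (fun _ => ENNReal.ofReal_ne_top) hγ ?_ ?_ hG hw).trans ?_
    · intro s hs
      have : 0 < t - s := by linarith [hs.2]
      positivity
    · intro s hs k
      have hs0 : 0 < s := hs.1
      have hts : 0 < t - s := by linarith [hs.2]
      have hf := freqNorm_nonneg k
      have hn := norm_nonneg k
      have hw2 := wt_pos N (by positivity : 0 ≤ s ^ (1 / 4 : ℝ)) k
      rw [← ENNReal.ofReal_pow (by positivity), ← ENNReal.ofReal_pow (by positivity),
        ← ENNReal.ofReal_mul (by positivity), ← ENNReal.ofReal_mul (by positivity)]
      apply ENNReal.ofReal_le_ofReal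
      have h1 := hheat (3 / 2) (by norm_num) (by norm_num) (t - s) hts _ hf
      norm_num at h1
      set X := Real.exp (-((t - s) * ν * freqNorm k ^ 4))
      have e3 : (freqNorm k ^ (3 / 2 : ℝ)) ^ 2 = freqNorm k ^ 3 := by
        rw [← Real.rpow_natCast, ← Real.rpow_mul hf, ← Real.rpow_natCast]; norm_num
      have h2 : freqNorm k ^ (3 / 2 : ℝ) * X ≤ C * (t - s) ^ (-(3 / 8) : ℝ) := by
        refine le_trans ?_ h1
        gcongr
        have : 1 ≤ (1 + (t - s) ^ (1 / 4 : ℝ) * freqNorm k) ^ N := one_le_pow₀ (by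
          have : 0 ≤ (t - s) ^ (1 / 4 : ℝ) * freqNorm k := by positivity
          linarith)
        exact le_mul_of_one_le_right (by positivity) this
      have h3 : freqNorm k ^ (d - 1) ≤ c₂ ^ 2 * wt N (s ^ (1 / 4 : ℝ)) k := by
        calc freqNorm k ^ (d - 1) ≤ (Real.sqrt d * (1 + ‖k‖)) ^ (d - 1) := by
              gcongr
              refine (freqNorm_le_norm k).trans ?_
              gcongr; linarith
          _ = Real.sqrt d ^ (d - 1) * (1 + ‖k‖) ^ (d - 1) := mul_pow _ _ _
          _ ≤ c₂ ^ 2 * wt N (s ^ (1 / 4 : ℝ)) k := by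
              gcongr
              · rw [hc₂, ← pow_mul]
                exact pow_le_pow_right₀ hsd (by omega)
              · rw [wt]
                refine le_mul_of_one_le_right (by positivity) (one_le_pow₀ ?_)
                have : 0 ≤ s ^ (1 / 4 : ℝ) * ‖k‖ := by positivity
                linarith
      have e4 : freqNorm k ^ d = freqNorm k ^ (d - 1) * freqNorm k := by
        rw [← pow_succ, Nat.sub_add_cancel hd]
      calc freqNorm k ^ d * (freqNorm k * X) ^ 2
          = freqNorm k ^ (d - 1) * (freqNorm k ^ (3 / 2 : ℝ) * X) ^ 2 := by
            rw [mul_pow (freqNorm k ^ (3 / 2 : ℝ)), e3, e4]; ring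
        _ ≤ c₂ ^ 2 * wt N (s ^ (1 / 4 : ℝ)) k * (C * (t - s) ^ (-(3 / 8) : ℝ)) ^ 2 := by gcongr
        _ = _ := by ring
    · have : ∫⁻ s in Ioo 0 t, ENNReal.ofReal
          (c₂ * C * (t - s) ^ (-(3 / 8) : ℝ) * s ^ (-(5 / 8) : ℝ)) ≤
          ENNReal.ofReal (c₂ * C * B₂) := by
        calc _ = ∫⁻ s in Ioo 0 t, ENNReal.ofReal (c₂ * C) *
              ENNReal.ofReal ((t - s) ^ (-(3 / 8) : ℝ) * s ^ (-(5 / 8) : ℝ)) := by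
              refine lintegral_congr fun s => ?_
              rw [← ENNReal.ofReal_mul (by positivity), mul_assoc]
          _ ≤ ENNReal.ofReal (c₂ * C) *
              ENNReal.ofReal (B₂ * t ^ (1 - 3 / 8 - 5 / 8 : ℝ)) := by
              rw [lintegral_const_mul' _ _ ENNReal.ofReal_ne_top]
              gcongr
              exact hb₂ t ht
          _ = _ := by
              rw [← ENNReal.ofReal_mul (by positivity)]
              norm_num
      calc _ ≤ d ^ 2 * ENNReal.ofReal (c₂ * C * B₂) ^ 2 * γ := by gcongr
        _ ≤ _ := by
            rw [hto _ (by positivity)]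
            gcongr
            exact le_add_of_nonneg_left (by positivity)

/-- Polynomial decay from the energy bound. -/
theorem freqNorm_mul_norm_le {N : ℕ} {δ s : ℝ} (hδ : 0 < δ) (hδs : δ ≤ s) (hs1 : s ≤ 1)
    {x : (Fin d → ℤ) → ℂ} (hx : energy N s x ≤ 1) (k : Fin d → ℤ) :
    freqNorm k * ‖x k‖ ≤ ((δ ^ (1 / 4 : ℝ)) ^ (N + 1))⁻¹ * (1 / (1 + ‖k‖) ^ N) := by
  have hs : 0 < s := hδ.trans_le hδs
  set b := δ ^ (1 / 4 : ℝ) with hb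
  have hb0 : 0 < b := by positivity
  have hbs : b ≤ s ^ (1 / 4 : ℝ) := Real.rpow_le_rpow hδ.le hδs (by norm_num)
  have hb1 : b ≤ 1 := hbs.trans (Real.rpow_le_one hs.le hs1 (by norm_num))
  have hn := norm_nonneg k
  have hf := freqNorm_nonneg k
  have h1 : s ^ (1 / 4 : ℝ) * freqNorm k ^ 2 * wt N (s ^ (1 / 4 : ℝ)) k * ‖x k‖ ^ 2 ≤ 1 := by
    have h2 := (ENNReal.le_tsum k).trans ((energy_eq_tsum N hs x).symm.le.trans hx)
    have hw := wt_pos N (by positivity : 0 ≤ s ^ (1 / 4 : ℝ)) k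
    rw [← ofReal_norm, ← ENNReal.ofReal_pow (norm_nonneg _), ← ENNReal.ofReal_mul (by positivity),
      ENNReal.ofReal_le_one] at h2
    exact h2
  have h3 : (b * (1 + ‖k‖)) ^ (2 * N) ≤ wt N (s ^ (1 / 4 : ℝ)) k := by
    rw [wt]
    have e1 : b * (1 + ‖k‖) ≤ 1 + s ^ (1 / 4 : ℝ) * ‖k‖ := by
      rw [mul_add, mul_one]; gcongr
    calc (b * (1 + ‖k‖)) ^ (2 * N) ≤ 1 * (1 + s ^ (1 / 4 : ℝ) * ‖k‖) ^ (2 * N) := by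
          rw [one_mul]; gcongr
      _ ≤ _ := by
          gcongr
          exact one_le_pow₀ (by linarith)
  have h4 : (b ^ (N + 1) * (1 + ‖k‖) ^ N * (freqNorm k * ‖x k‖)) ^ 2 ≤ 1 ^ 2 := by
    calc _ = b * b * freqNorm k ^ 2 * (b * (1 + ‖k‖)) ^ (2 * N) * ‖x k‖ ^ 2 := by
          generalize 1 + ‖k‖ = n; ring
      _ ≤ 1 * s ^ (1 / 4 : ℝ) * freqNorm k ^ 2 * wt N (s ^ (1 / 4 : ℝ)) k * ‖x k‖ ^ 2 := by
          gcongr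
      _ ≤ 1 ^ 2 := by simpa using h1
  have h5 := le_of_sq_le_sq h4 zero_le_one
  rw [one_div, ← mul_inv, ← one_div, le_div_iff₀ (by positivity)]
  linarith

theorem summable_one_div_pow (hd : 1 ≤ d) {n : ℕ} (hn : d + 1 ≤ n) :
    Summable fun k : Fin d → ℤ => 1 / (1 + ‖k‖) ^ n := by
  have h := tsum_lattice_le hd one_pos le_rfl
  have h2 : Summable fun k : Fin d → ℤ => 1 / ((1 + ‖k‖) ^ (d - 1) * (1 + 1 * ‖k‖) ^ 2) := by
    have h3 := ENNReal.summable_toReal (h.trans_lt ENNReal.ofReal_lt_top).ne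
    refine h3.congr fun k => ENNReal.toReal_ofReal ?_
    have := norm_nonneg k
    positivity
  refine Summable.of_nonneg_of_le (fun k => by have := norm_nonneg k; positivity) (fun k => ?_) h2
  have hk := norm_nonneg k
  rw [one_mul, ← pow_add]
  apply one_div_le_one_div_of_le (by positivity)
  exact pow_le_pow_right₀ (by linarith) (by omega)

/-- Time dependent coefficient families controlled by the bound `R`. -/
structure Adm (N : ℕ) (T : ℝ) (R : ℝ → ℝ≥0∞) (x : ℝ → (Fin d → ℤ) → ℂ) : Prop where
  herm : ∀ s ∈ Ioc 0 T, Herm (x s)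
  cont : ∀ k, ContinuousOn (fun s => x s k) (Ioc 0 T)
  bound : ∀ s ∈ Ioc 0 T, energy N s (x s) ≤ R s

theorem norm_grad_le {x : (Fin d → ℤ) → ℂ} (hx : ∑' k, gradAbs x k < ⊤) (j : Fin d) :
    ENNReal.ofReal ‖grad x j‖ ≤ ENNReal.ofReal (torusVol d)⁻¹ * ∑' k, gradAbs x k := by
  have h1 := norm_synth_le (summable_gradCoef hx j)
  have hv := torusVol_pos d
  refine (ENNReal.ofReal_le_ofReal h1).trans ?_
  rw [ENNReal.ofReal_mul (by positivity),
    ENNReal.ofReal_tsum_of_nonneg (fun _ => norm_nonneg _) (summable_gradCoef hx j)]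
  gcongr with k
  rw [ofReal_norm]
  exact enorm_gradCoef_le x j k

/-- At t = 0 the energy bounds t^{1/2}‖∇h‖² by a multiple of R, which tends to 0. At positive times
the weight gives the decay (1+‖k‖)^{-N} locally uniformly in time, summable because N ≥ d+1, and
continuity of the coefficients suffices by dominated convergence. -/
theorem Adm.gradCont (hd : 1 ≤ d) {N : ℕ} (hN : d + 1 ≤ N) {T : ℝ} (hT1 : T ≤ 1)
    {R : ℝ → ℝ≥0∞} (hR1 : ∀ s ∈ Ioc 0 T, R s ≤ 1) (hR0 : Tendsto R (𝓝[>] 0) (𝓝 0))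
    {x : ℝ → (Fin d → ℤ) → ℂ} (hx : Adm N T R x) : GradCont T fun s => grad (x s) := by
  have hv := torusVol_pos d
  have hsum : ∀ s ∈ Ioc 0 T, ∑' k, gradAbs (x s) k < ⊤ := fun s hs =>
    tsum_gradAbs_lt_top hd (by omega) hs.1 (hs.2.trans hT1)
      (((hx.bound s hs).trans (hR1 s hs)).trans_lt ENNReal.one_lt_top)
  intro j s₀ hs₀
  rcases eq_or_lt_of_le hs₀.1 with h0 | h0
  · subst h0
    rw [ContinuousWithinAt, Real.zero_rpow (by norm_num), zero_smul]
    have hb : ∀ s ∈ Ioc 0 T, ENNReal.ofReal (‖s ^ (1 / 4 : ℝ) • grad (x s) j‖ ^ 2) ≤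
        ENNReal.ofReal ((torusVol d)⁻¹ ^ 2 * latticeConst d) * R s := by
      intro s hs
      have hs0 : 0 < s := hs.1
      have hL : 0 ≤ latticeConst d := by unfold latticeConst; positivity
      have h1 := norm_grad_le (hsum s hs) j
      have h2 := sq_tsum_gradAbs_le hd (N := N) (by omega) hs0 (hs.2.trans hT1) (x s)
      rw [norm_smul, Real.norm_of_nonneg (by positivity), mul_pow,
        ENNReal.ofReal_mul (by positivity), ENNReal.ofReal_pow (norm_nonneg _)]
      have e : (s ^ (1 / 4 : ℝ)) ^ 2 = s ^ (1 / 2 : ℝ) := by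
        rw [← Real.rpow_natCast, ← Real.rpow_mul hs0.le]; norm_num
      calc _ ≤ ENNReal.ofReal ((s ^ (1 / 4 : ℝ)) ^ 2) *
            (ENNReal.ofReal (torusVol d)⁻¹ * ∑' k, gradAbs (x s) k) ^ 2 := by gcongr
        _ ≤ ENNReal.ofReal ((s ^ (1 / 4 : ℝ)) ^ 2) * (ENNReal.ofReal (torusVol d)⁻¹ ^ 2 *
            (ENNReal.ofReal (latticeConst d * s ^ (-(1 / 2) : ℝ)) * R s)) := by
            rw [mul_pow]
            gcongr
            exact h2.trans (by gcongr; exact hx.bound s hs)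
        _ = _ := by
            rw [← ENNReal.ofReal_pow (by positivity), ← mul_assoc, ← mul_assoc,
              ← ENNReal.ofReal_mul (by positivity), ← ENNReal.ofReal_mul (by positivity), e]
            congr 2
            calc s ^ (1 / 2 : ℝ) * (torusVol d)⁻¹ ^ 2 * (latticeConst d * s ^ (-(1 / 2) : ℝ))
                = (torusVol d)⁻¹ ^ 2 * latticeConst d *
                  (s ^ (1 / 2 : ℝ) * s ^ (-(1 / 2) : ℝ)) := by ring
              _ = _ := by rw [← Real.rpow_add hs0]; norm_num
    have hlim : Tendsto (fun s => ENNReal.ofReal ((torusVol d)⁻¹ ^ 2 * latticeConst d) * R s)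
        (𝓝[>] 0) (𝓝 0) := by
      have := ENNReal.Tendsto.const_mul hR0
        (a := ENNReal.ofReal ((torusVol d)⁻¹ ^ 2 * latticeConst d))
        (Or.inr ENNReal.ofReal_ne_top)
      simpa using this
    have hlim2 : Tendsto (fun s => ‖s ^ (1 / 4 : ℝ) • grad (x s) j‖) (𝓝[Ioc 0 T] 0) (𝓝 0) := by
      have h3 : Tendsto (fun s => ENNReal.ofReal (‖s ^ (1 / 4 : ℝ) • grad (x s) j‖ ^ 2))
          (𝓝[Ioc 0 T] 0) (𝓝 0) := by
        refine tendsto_of_tendsto_of_tendsto_of_le_of_le' tendsto_const_nhds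
          (hlim.mono_left (nhdsWithin_mono _ Ioc_subset_Ioi_self)) (Eventually.of_forall
            fun _ => zero_le) ?_
        filter_upwards [self_mem_nhdsWithin] with s hs using hb s hs
      have h4 := (ENNReal.tendsto_toReal ENNReal.zero_ne_top).comp h3
      have h5 := h4.sqrt
      simpa [Function.comp_def, ENNReal.toReal_ofReal, Real.sqrt_sq] using h5
    have hlim3 : Tendsto (fun s => s ^ (1 / 4 : ℝ) • grad (x s) j) (𝓝[Ioc 0 T] 0) (𝓝 0) :=
      tendsto_zero_iff_norm_tendsto_zero.mpr hlim2
    have hIcc : Icc (0 : ℝ) T = insert 0 (Ioc 0 T) := by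
      have hT0 : (0 : ℝ) ≤ T := hs₀.2
      rw [Ioc_insert_left hT0]
    rw [hIcc, nhdsWithin_insert]
    refine Tendsto.sup ?_ hlim3
    rw [tendsto_pure_left]
    intro s hs
    rw [Real.zero_rpow (by norm_num), zero_smul]
    exact mem_of_mem_nhds hs
  · have hs₀' : s₀ ∈ Ioc 0 T := ⟨h0, hs₀.2⟩
    have hc : ContinuousWithinAt (fun s => grad (x s) j) (Ioc 0 T) s₀ := by
      rw [ContinuousWithinAt, tendsto_iff_norm_sub_tendsto_zero]
      set δ := s₀ / 2 with hδ
      have hδ0 : 0 < δ := by positivity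
      have hev : ∀ᶠ s in 𝓝[Ioc 0 T] s₀, s ∈ Ioc 0 T ∧ δ ≤ s := by
        refine eventually_mem_nhdsWithin.and ?_
        exact nhdsWithin_le_nhds (Ici_mem_nhds (by linarith))
      have hdec : ∀ s, s ∈ Ioc 0 T ∧ δ ≤ s → ∀ k : Fin d → ℤ,
          ‖Complex.I * (k j : ℂ) * x s k‖ ≤
          ((δ ^ (1 / 4 : ℝ)) ^ (N + 1))⁻¹ * (1 / (1 + ‖k‖) ^ N) := by
        intro s hs k
        refine le_trans ?_ (freqNorm_mul_norm_le hδ0 hs.2 (hs.1.2.trans hT1)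
          ((hx.bound s hs.1).trans (hR1 s hs.1)) k)
        rw [norm_mul, norm_mul, Complex.norm_I, one_mul, Complex.norm_intCast]
        gcongr
        exact abs_le_freqNorm k j
      have hdom : Tendsto (fun s => ∑' k : Fin d → ℤ,
          ‖Complex.I * (k j : ℂ) * x s k - Complex.I * (k j : ℂ) * x s₀ k‖)
          (𝓝[Ioc 0 T] s₀) (𝓝 (∑' _k : Fin d → ℤ, 0)) := by
        refine tendsto_tsum_of_dominated_convergence (bound := fun k : Fin d → ℤ =>
          2 * (((δ ^ (1 / 4 : ℝ)) ^ (N + 1))⁻¹ * (1 / (1 + ‖k‖) ^ N))) ?_ ?_ ?_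
        · exact ((summable_one_div_pow hd hN).mul_left _).mul_left _
        · intro k
          have h1 := (((hx.cont k) s₀ hs₀').const_mul (Complex.I * (k j : ℂ))).sub_const
            (Complex.I * (k j : ℂ) * x s₀ k)
          have h2 := h1.norm
          simpa using h2
        · filter_upwards [hev] with s hs k
          rw [norm_norm]
          refine (norm_sub_le _ _).trans ?_
          have h1 := hdec s hs k
          have h2 := hdec s₀ ⟨hs₀', by linarith⟩ k
          linarith
      rw [tsum_zero] at hdom
      have hdom2 := hdom.const_mul (torusVol d)⁻¹
      rw [mul_zero] at hdom2
      refine tendsto_of_tendsto_of_tendsto_of_le_of_le' tendsto_const_nhds hdom2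
        (Eventually.of_forall fun _ => norm_nonneg _) ?_
      filter_upwards [hev] with s hs
      exact norm_synth_sub_le (summable_gradCoef (hsum s hs.1) j)
        (summable_gradCoef (hsum s₀ hs₀') j)
    have hc2 : ContinuousWithinAt (fun s : ℝ => s ^ (1 / 4 : ℝ) • grad (x s) j) (Ioc 0 T) s₀ :=
      (Real.continuousAt_rpow_const _ _ (Or.inl h0.ne')).continuousWithinAt.smul hc
    refine hc2.mono_of_mem_nhdsWithin ?_
    rw [← Ioi_inter_Iic, inter_comm]
    refine inter_mem ?_ (nhdsWithin_le_nhds (Ioi_mem_nhds h0))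
    filter_upwards [self_mem_nhdsWithin] with s hs using hs.2

/-- The Duhamel map on the level of Fourier coefficients. -/
noncomputable def picard (ν : ℝ) (c : (Fin d → ℤ) → ℂ) (x : ℝ → (Fin d → ℤ) → ℂ) (t : ℝ)
    (k : Fin d → ℤ) : ℂ :=
  (Real.exp (-(t * ν * freqNorm k ^ 4)) : ℂ) * c k +
    ∑ l, ∫ s in Ioo 0 t, derivSymbol ν l (t - s) k * fourierCoef (flux (grad (x s)) l) k

/-- The symbol of a derivative vanishes at k = 0. The energy does not see this mode, so every
argument based on the energy treats it separately. -/
theorem picard_zero_freq (ν : ℝ) (c : (Fin d → ℤ) → ℂ) (x : ℝ → (Fin d → ℤ) → ℂ) (t : ℝ) :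
    picard ν c x t 0 = c 0 := by
  simp [picard, derivSymbol, freqNorm_zero]

theorem flux_grad_zero (l : Fin d) : flux (grad fun _ : Fin d → ℤ => (0 : ℂ)) l = 0 := by
  simp [flux, grad, synth_zero]

theorem picard_zero (ν : ℝ) (c : (Fin d → ℤ) → ℂ) (t : ℝ) (k : Fin d → ℤ) :
    picard ν c (fun _ _ => 0) t k = (Real.exp (-(t * ν * freqNorm k ^ 4)) : ℂ) * c k := by
  simp only [picard, flux_grad_zero]
  simp [fourierCoef]

theorem derivSymbol_neg (ν : ℝ) (j : Fin d) (τ : ℝ) (k : Fin d → ℤ) :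
    derivSymbol ν j τ (-k) = conj (derivSymbol ν j τ k) := by
  simp only [derivSymbol, freqNorm_neg, map_mul, Complex.conj_I, Complex.conj_ofReal,
    Pi.neg_apply, Int.cast_neg, map_intCast]
  ring

theorem herm_picard (ν : ℝ) {c : (Fin d → ℤ) → ℂ} (hc : Herm c) (x : ℝ → (Fin d → ℤ) → ℂ)
    (t : ℝ) : Herm (picard ν c x t) := by
  intro k
  simp only [picard, map_add, map_mul, map_sum, Complex.conj_ofReal, freqNorm_neg, hc k]
  congr 1
  refine Finset.sum_congr rfl fun l _ => ?_
  rw [← integral_conj]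
  congr 1 with s
  rw [derivSymbol_neg, fourierCoef_neg, map_mul]

/-- For a fixed frequency the exponential can be run backwards: its value at t-s is e^{(T-t)ν|k|⁴}
times its value at T-s. The integrand no longer depends on t, and a primitive of an integrable
function is continuous. -/
theorem continuousOn_picard {ν : ℝ} (hν : 0 < ν) (c : (Fin d → ℤ) → ℂ)
    {x : ℝ → (Fin d → ℤ) → ℂ} {T : ℝ} (hT : 0 < T) (hx : GradCont T fun s => grad (x s))
    (k : Fin d → ℤ) : ContinuousOn (fun t => picard ν c x t k) (Ioc 0 T) := by
  unfold picard
  refine ContinuousOn.add (by fun_prop) (continuousOn_finsetSum _ fun l _ => ?_)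
  have hint := hx.integrable hν ⟨hT, le_rfl⟩ l k
  have h1 : ContinuousOn (fun t => ∫ s in Ioc 0 t, derivSymbol ν l (T - s) k *
      fourierCoef (flux (grad (x s)) l) k) (Icc 0 T) := by
    apply intervalIntegral.continuousOn_primitive
    rw [integrableOn_Icc_iff_integrableOn_Ioo]
    exact hint
  have h2 : ContinuousOn (fun t : ℝ => (Real.exp ((T - t) * ν * freqNorm k ^ 4) : ℂ) *
      ∫ s in Ioc 0 t, derivSymbol ν l (T - s) k * fourierCoef (flux (grad (x s)) l) k)
      (Ioc 0 T) := ContinuousOn.mul (by fun_prop) (h1.mono Ioc_subset_Icc_self)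
  refine h2.congr fun t _ => ?_
  simp only
  rw [integral_Ioc_eq_integral_Ioo, ← integral_const_mul]
  congr 1 with s
  rw [← mul_assoc]
  congr 1
  simp only [derivSymbol]
  have : Real.exp (-((t - s) * ν * freqNorm k ^ 4)) = Real.exp ((T - t) * ν * freqNorm k ^ 4) *
      Real.exp (-((T - s) * ν * freqNorm k ^ 4)) := by
    rw [← Real.exp_add]; ring_nf
  rw [this]
  push_cast
  ring

end Picard

/-! ### The contraction argument -/

section FixedPoint

variable {d : ℕ}

theorem exists_picard_sub_le (hd : 1 ≤ d) {ν : ℝ} (hν : 0 < ν) {N : ℕ} (hN : 1 ≤ N) :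
    ∃ K : ℝ, 0 < K ∧ ∀ (T : ℝ), T ≤ 1 → ∀ (c : (Fin d → ℤ) → ℂ) (x y : ℝ → (Fin d → ℤ) → ℂ),
      GradCont T (fun s => grad (x s)) → GradCont T (fun s => grad (y s)) →
      (∀ s ∈ Ioc 0 T, Herm (x s)) → (∀ s ∈ Ioc 0 T, Herm (y s)) →
      ∀ t ∈ Ioc 0 T, ∀ A B : ℝ≥0∞, A < ⊤ → B < ⊤ → (∀ s ∈ Ioo 0 t, energy N s (x s) ≤ A) →
      (∀ s ∈ Ioo 0 t, energy N s (y s) ≤ A) →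
      (∀ s ∈ Ioo 0 t, energy N s (fun k => x s k - y s k) ≤ B) →
      energy N t (fun k => picard ν c x t k - picard ν c y t k) ≤
        ENNReal.ofReal K * (A ^ 2 + ENNReal.ofReal t) * B ∧
      ∑' k, ENNReal.ofReal (freqNorm k ^ d) * ‖picard ν c x t k - picard ν c y t k‖ₑ ^ 2 ≤
        ENNReal.ofReal K * (A ^ 2 + ENNReal.ofReal t) * B := by
  obtain ⟨C₁, hC₁, h₁⟩ := exists_duhamel_bounds hd hν N
  obtain ⟨C₂, hC₂, h₂⟩ := exists_wsum_flux_sub_le hd hN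
  refine ⟨C₁ * C₂, by positivity, ?_⟩
  intro T hT1 c x y hx hy hxH hyH t ht A B hA hB hxA hyA hxy
  set G : Fin d → ℝ → (Fin d → ℤ) → ℂ := fun l s k =>
    fourierCoef (flux (grad (x s)) l - flux (grad (y s)) l : C(Torus d, ℝ)) k with hG
  have hsub : Ioo 0 t ⊆ Ioc 0 T := fun s hs => ⟨hs.1, hs.2.le.trans ht.2⟩
  have hdiff : ∀ k, picard ν c x t k - picard ν c y t k =
      ∑ l, ∫ s in Ioo 0 t, derivSymbol ν l (t - s) k * G l s k := by
    intro k
    simp only [picard]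
    rw [add_sub_add_left_eq_sub, ← Finset.sum_sub_distrib]
    refine Finset.sum_congr rfl fun l _ => ?_
    rw [← integral_sub (hx.integrable hν ht l k) (hy.integrable hν ht l k)]
    congr 1 with s
    simp only [hG, fourierCoef_sub_continuous]
    ring
  simp only [hdiff]
  have key := h₁ t (ENNReal.ofReal C₂ * (A ^ 2 + ENNReal.ofReal t) * B) G ht.1
    (by finiteness) ?_ ?_
  · rw [← mul_assoc, ← mul_assoc, ← ENNReal.ofReal_mul hC₁.le] at key
    exact key
  · intro l k
    have h1 : ContinuousOn (fun s => flux (grad (x s)) l - flux (grad (y s)) l) (Ioo 0 t) :=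
      (((continuous_flux l).comp_continuousOn hx.continuousOn).sub
        ((continuous_flux l).comp_continuousOn hy.continuousOn)).mono hsub
    exact ((continuous_fourierCoef_continuousMap k).comp_continuousOn h1).aestronglyMeasurable
      measurableSet_Ioo
  · intro s hs l
    have hs' := hsub hs
    refine (h₂ s hs.1 (hs'.2.trans hT1) (x s) (y s) A B hA (hxH s hs') (hyH s hs') (hxA s hs)
      (hyA s hs) (hxy s hs) l).trans ?_
    gcongr
    exact hs.2.le

/-- For k ≠ 0 both |k| and the weight are at least 1, so the energy controls each coefficient up to
t^{1/8}, the square root of its prefactor. -/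
theorem norm_mul_le_of_energy_le {N : ℕ} {t : ℝ} (ht : 0 < t) {z : (Fin d → ℤ) → ℂ} {b : ℝ}
    (hb : 0 ≤ b) (hz : energy N t z ≤ ENNReal.ofReal (b ^ 2)) {k : Fin d → ℤ} (hk : k ≠ 0) :
    t ^ (1 / 8 : ℝ) * ‖z k‖ ≤ b := by
  have h2 := (ENNReal.le_tsum k).trans ((energy_eq_tsum N ht z).symm.le.trans hz)
  have hw := one_le_wt N (by positivity : 0 ≤ t ^ (1 / 4 : ℝ)) k
  rw [← ofReal_norm, ← ENNReal.ofReal_pow (norm_nonneg _), ← ENNReal.ofReal_mul (by positivity),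
    ENNReal.ofReal_le_ofReal_iff (by positivity)] at h2
  have hf := one_le_freqNorm hk
  have e8 : (t ^ (1 / 8 : ℝ)) ^ 2 = t ^ (1 / 4 : ℝ) := by
    rw [← Real.rpow_natCast, ← Real.rpow_mul ht.le]; norm_num
  have h3 : (t ^ (1 / 8 : ℝ) * ‖z k‖) ^ 2 ≤ b ^ 2 := by
    rw [mul_pow, e8]
    refine le_trans ?_ h2
    gcongr
    rw [mul_assoc]
    exact le_mul_of_one_le_right (by positivity) (one_le_mul_of_one_le_of_one_le
      (one_le_pow₀ hf) hw)
  exact le_of_sq_le_sq h3 hb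

/-- L bounds the energy of the linear flow. Since energies are squared norms, a sum of two terms of
size L has energy at most 2L + 2L, whence the ball of radius 4L. The factor 1/16 is a contraction by
1/4 in norm. -/
theorem exists_picard_fixedPoint (hd : 1 ≤ d) {ν : ℝ} (hν : 0 < ν) {N : ℕ} (hN : d + 1 ≤ N) :
    ∃ K : ℝ, 0 < K ∧ ∀ (T : ℝ), 0 < T → T ≤ 1 → ∀ (c : (Fin d → ℤ) → ℂ) (L : ℝ → ℝ≥0∞),
      Herm c → MonotoneOn L (Ioc 0 T) → Tendsto L (𝓝[>] 0) (𝓝 0) →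
      (∀ t ∈ Ioc 0 T, energy N t
        (fun k => (Real.exp (-(t * ν * freqNorm k ^ 4)) : ℂ) * c k) ≤ L t) →
      L T ≤ 1 / 4 → ENNReal.ofReal K * ((4 * L T) ^ 2 + ENNReal.ofReal T) ≤ 1 / 16 →
      ∃ a : ℝ → (Fin d → ℤ) → ℂ, Adm N T (fun t => 4 * L t) a ∧
        ∀ t ∈ Ioc 0 T, a t = picard ν c a t ∧
          ∑' k, ENNReal.ofReal (freqNorm k ^ d) *
            ‖a t k - (Real.exp (-(t * ν * freqNorm k ^ 4)) : ℂ) * c k‖ₑ ^ 2 ≤ L t := by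
  obtain ⟨K, hK, hdiff⟩ := exists_picard_sub_le hd hν (by omega : 1 ≤ N)
  refine ⟨K, hK, ?_⟩
  intro T hT hT1 c L hc hL hL0 hlin hL1 hK1
  set R : ℝ → ℝ≥0∞ := fun t => 4 * L t with hR
  have hTm : T ∈ Ioc 0 T := ⟨hT, le_rfl⟩
  have hLT : ∀ t ∈ Ioc 0 T, L t ≤ L T := fun t ht => hL ht hTm ht.2
  have hRT : ∀ t ∈ Ioc 0 T, R t ≤ R T := fun t ht => by simp only [hR]; gcongr; exact hLT t ht
  have hR1 : ∀ t ∈ Ioc 0 T, R t ≤ 1 := fun t ht => by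
    refine (hRT t ht).trans ?_
    calc 4 * L T ≤ 4 * (1 / 4) := by gcongr
      _ = 1 := by rw [one_div, ENNReal.mul_inv_cancel (by simp) (by simp)]
  have hR0 : Tendsto R (𝓝[>] 0) (𝓝 0) := by
    simpa using ENNReal.Tendsto.const_mul hL0 (a := 4) (Or.inr (by simp))
  have hRlt : ∀ t ∈ Ioc 0 T, R t < ⊤ := fun t ht => (hR1 t ht).trans_lt ENNReal.one_lt_top
  have hG : ∀ x, Adm N T R x → GradCont T fun s => grad (x s) := fun x hx =>
    hx.gradCont hd hN hT1 hR1 hR0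
  have hcon : ∀ x y, Adm N T R x → Adm N T R y → ∀ t ∈ Ioc 0 T, ∀ B : ℝ≥0∞, B < ⊤ →
      (∀ s ∈ Ioo 0 t, energy N s (fun k => x s k - y s k) ≤ B) →
      energy N t (fun k => picard ν c x t k - picard ν c y t k) ≤ 1 / 16 * B ∧
      ∑' k, ENNReal.ofReal (freqNorm k ^ d) * ‖picard ν c x t k - picard ν c y t k‖ₑ ^ 2 ≤
        1 / 16 * B := by
    intro x y hx hy t ht B hB hxy
    have hsub : Ioo 0 t ⊆ Ioc 0 T := fun s hs => ⟨hs.1, hs.2.le.trans ht.2⟩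
    have h := hdiff T hT1 c x y (hG x hx) (hG y hy) hx.herm hy.herm t ht (R T) B (hRlt T hTm) hB
      (fun s hs => (hx.bound s (hsub hs)).trans (hRT s (hsub hs)))
      (fun s hs => (hy.bound s (hsub hs)).trans (hRT s (hsub hs))) hxy
    have h2 : ENNReal.ofReal K * (R T ^ 2 + ENNReal.ofReal t) * B ≤ 1 / 16 * B := by
      gcongr
      refine le_trans ?_ hK1
      gcongr
      exact ht.2
    exact ⟨h.1.trans h2, h.2.trans h2⟩
  have hzero : Adm N T R (fun _ (_ : Fin d → ℤ) => 0) :=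
    ⟨fun s _ k => by simp, fun k => continuousOn_const, fun s _ => by simp [energy_zero]⟩
  have h416 : (1 / 16 : ℝ≥0∞) * 4 ≤ 1 := by
    rw [one_div, mul_comm, ← div_eq_mul_inv]
    exact ENNReal.div_le_of_le_mul (by norm_num)
  -- The distance to 0 is measured by R t rather than R T, using monotonicity of L, so the nonlinear
  -- correction inherits the decay of L at t = 0.
  have hcorr : ∀ x, Adm N T R x → ∀ t ∈ Ioc 0 T,
      energy N t (fun k => picard ν c x t k - picard ν c (fun _ _ => 0) t k) ≤ L t ∧
      ∑' k, ENNReal.ofReal (freqNorm k ^ d) *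
        ‖picard ν c x t k - picard ν c (fun _ _ => 0) t k‖ₑ ^ 2 ≤ L t := by
    intro x hx t ht
    have h := hcon x _ hx hzero t ht (R t) (hRlt t ht) (fun s hs => by
      have hs' : s ∈ Ioc 0 T := ⟨hs.1, hs.2.le.trans ht.2⟩
      simp only [sub_zero]
      refine (hx.bound s hs').trans ?_
      simp only [hR]
      gcongr
      exact hL hs' ht hs.2.le)
    have h2 : 1 / 16 * R t ≤ L t := by
      simp only [hR]
      rw [← mul_assoc]
      exact mul_le_of_le_one_left zero_le h416
    exact ⟨h.1.trans h2, h.2.trans h2⟩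
  have hstep : ∀ x, Adm N T R x → Adm N T R (picard ν c x) := by
    intro x hx
    refine ⟨fun s _ => herm_picard ν hc x s, continuousOn_picard hν c hT (hG x hx), ?_⟩
    intro t ht
    have h1 := energy_add_le N t (fun k => picard ν c x t k - picard ν c (fun _ _ => 0) t k)
      (picard ν c (fun _ _ => 0) t)
    simp only [sub_add_cancel] at h1
    have h2 : energy N t (picard ν c (fun _ _ => 0) t) ≤ L t := by
      rw [show picard ν c (fun _ _ => 0) t = _ from funext (picard_zero ν c t)]
      exact hlin t ht
    calc energy N t (picard ν c x t) ≤ _ := h1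
      _ ≤ 2 * L t + 2 * L t := by gcongr; exact (hcorr x hx t ht).1
      _ = R t := by simp only [hR]; ring
  set u : ℕ → ℝ → (Fin d → ℤ) → ℂ := fun n => (picard ν c)^[n] fun _ _ => 0 with hu
  have husucc : ∀ n, u (n + 1) = picard ν c (u n) := fun n => Function.iterate_succ_apply' _ _ _
  have hAdm : ∀ n, Adm N T R (u n) := by
    intro n
    induction n with
    | zero => exact hzero
    | succ n ih => rw [husucc]; exact hstep _ ih
  have hconv : ∀ n, ∀ t ∈ Ioc 0 T, energy N t (fun k => u (n + 1) t k - u n t k) ≤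
      (1 / 16) ^ n := by
    intro n
    induction n with
    | zero =>
      intro t ht
      simpa [hu] using ((hAdm 1).bound t ht).trans (hR1 t ht)
    | succ n ih =>
      intro t ht
      rw [husucc, husucc n, pow_succ']
      refine (hcon _ _ (hstep _ (hAdm n)) (hAdm n) t ht _
        (ENNReal.pow_lt_top (by simp)) ?_).1
      intro s hs
      rw [← husucc]
      exact ih s ⟨hs.1, hs.2.le.trans ht.2⟩
  have hq : ∀ n : ℕ, ((1 / 16 : ℝ≥0∞)) ^ n = ENNReal.ofReal (((1 / 4 : ℝ) ^ n) ^ 2) := by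
    intro n
    have h : (1 / 16 : ℝ≥0∞) = ENNReal.ofReal (1 / 16) := by
      rw [ENNReal.ofReal_div_of_pos (by norm_num)]; norm_num
    rw [h, ← ENNReal.ofReal_pow (by norm_num), ← pow_mul, mul_comm n, pow_mul]
    norm_num
  -- The sequence is read from index 1 on: at k = 0 the iterate `u 0` is 0, and all later ones equal
  -- `c 0`.
  have hpt : ∀ n, ∀ t ∈ Ioc 0 T, ∀ k,
      t ^ (1 / 8 : ℝ) * ‖u (n + 2) t k - u (n + 1) t k‖ ≤ (1 / 4) ^ n := by
    intro n t ht k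
    by_cases hk : k = 0
    · subst hk
      rw [husucc, husucc, picard_zero_freq, picard_zero_freq, sub_self, norm_zero, mul_zero]
      positivity
    · refine (norm_mul_le_of_energy_le ht.1 (by positivity)
        ((hconv (n + 1) t ht).trans (hq _).le) hk).trans ?_
      exact pow_le_pow_of_le_one (by norm_num) (by norm_num) (by omega)
  have hdist : ∀ t ∈ Ioc 0 T, ∀ k n, dist (u (n + 1) t k) (u (n + 1 + 1) t k) ≤
      (t ^ (1 / 8 : ℝ))⁻¹ * (1 / 4) ^ n := by
    intro t ht k n
    have : 0 < t ^ (1 / 8 : ℝ) := Real.rpow_pos_of_pos ht.1 _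
    rw [dist_comm, dist_eq_norm, inv_mul_eq_div, le_div_iff₀ this, mul_comm]
    exact hpt n t ht k
  have hlim : ∀ t k, ∃ z, t ∈ Ioc 0 T → Tendsto (fun n => u (n + 1) t k) atTop (𝓝 z) := by
    intro t k
    by_cases ht : t ∈ Ioc 0 T
    · obtain ⟨z, hz⟩ := cauchySeq_tendsto_of_complete
        (cauchySeq_of_le_geometric _ _ (by norm_num) (hdist t ht k))
      exact ⟨z, fun _ => hz⟩
    · exact ⟨0, fun h => absurd h ht⟩
  choose a ha using hlim
  have haun : ∀ t ∈ Ioc 0 T, ∀ k n, t ^ (1 / 8 : ℝ) * ‖u (n + 1) t k - a t k‖ ≤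
      (1 / 4) ^ n * (4 / 3) := by
    intro t ht k n
    have h := dist_le_of_le_geometric_of_tendsto _ _ (by norm_num) (hdist t ht k) (ha t k ht) n
    have : 0 < t ^ (1 / 8 : ℝ) := Real.rpow_pos_of_pos ht.1 _
    rw [dist_eq_norm] at h
    calc _ ≤ t ^ (1 / 8 : ℝ) * ((t ^ (1 / 8 : ℝ))⁻¹ * (1 / 4) ^ n / (1 - 1 / 4)) := by gcongr
      _ = _ := by field_simp; norm_num
  have hgeo : Tendsto (fun n : ℕ => (1 / 4 : ℝ) ^ n * (4 / 3)) atTop (𝓝 0) := by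
    simpa using (tendsto_pow_atTop_nhds_zero_of_lt_one (r := (1 / 4 : ℝ)) (by norm_num)
      (by norm_num)).mul_const (4 / 3)
  have haA : Adm N T R a := by
    refine ⟨fun s hs k => ?_, fun k => ?_, fun s hs => ?_⟩
    · refine tendsto_nhds_unique (ha s (-k) hs) ?_
      refine ((Complex.continuous_conj.tendsto _).comp (ha s k hs)).congr fun n => ?_
      exact ((hAdm (n + 1)).herm s hs k).symm
    -- The convergence is uniform in time only after multiplication by s^{1/8}; the weight is
    -- divided out again on (0,T].
    · have hunif : TendstoUniformlyOn (fun n (s : ℝ) => (s ^ (1 / 8 : ℝ) : ℝ) • u (n + 1) s k)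
          (fun s : ℝ => (s ^ (1 / 8 : ℝ) : ℝ) • a s k) atTop (Ioc 0 T) := by
        rw [Metric.tendstoUniformlyOn_iff]
        intro ε hε
        filter_upwards [hgeo.eventually (gt_mem_nhds hε)] with n hn s hs
        have : 0 < s ^ (1 / 8 : ℝ) := Real.rpow_pos_of_pos hs.1 _
        rw [dist_comm, dist_eq_norm, ← smul_sub, norm_smul, Real.norm_of_nonneg this.le]
        exact (haun s hs k n).trans_lt hn
      have hc1 := hunif.continuousOn (Frequently.of_forall fun n => by
        refine ContinuousOn.smul (f := fun s : ℝ => s ^ (1 / 8 : ℝ)) ?_ ((hAdm (n + 1)).cont k)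
        exact (Real.continuous_rpow_const (by norm_num)).continuousOn)
      have hc2 : ContinuousOn (fun s : ℝ => s ^ (-(1 / 8) : ℝ) • ((s ^ (1 / 8 : ℝ) : ℝ) • a s k))
          (Ioc 0 T) := by
        refine ContinuousOn.smul (f := fun s : ℝ => s ^ (-(1 / 8) : ℝ)) ?_ hc1
        exact fun s hs => (Real.continuousAt_rpow_const _ _ (Or.inl hs.1.ne')).continuousWithinAt
      refine hc2.congr fun s hs => ?_
      simp only
      rw [smul_smul, ← Real.rpow_add hs.1]
      simp
    · exact energy_le_of_tendsto (fun k => ha s k hs)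
        (Eventually.of_forall fun n => (hAdm (n + 1)).bound s hs)
  have hmn : ∀ j n, ∀ t ∈ Ioc 0 T, energy N t (fun k => u (n + j) t k - u n t k) ≤
      4 * (1 / 16) ^ n := by
    intro j
    induction j with
    | zero => intro n t ht; simp [energy_zero]
    | succ j ih =>
      intro n t ht
      have h1 := ih (n + 1) t ht
      rw [add_right_comm, add_assoc] at h1
      calc _ ≤ 2 * energy N t (fun k => u (n + (j + 1)) t k - u (n + 1) t k) +
            2 * energy N t (fun k => u (n + 1) t k - u n t k) := energy_triangle _ _ _ _ _
        _ ≤ 2 * (4 * (1 / 16) ^ (n + 1)) + 2 * (1 / 16) ^ n := by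
            gcongr; exact hconv n t ht
        _ = (2 * (1 / 16 * 4) + 2) * (1 / 16) ^ n := by ring
        _ ≤ (2 * 1 + 2) * (1 / 16) ^ n := by gcongr
        _ = _ := by norm_num
  have han : ∀ n, ∀ t ∈ Ioc 0 T, energy N t (fun k => a t k - u n t k) ≤ 4 * (1 / 16) ^ n := by
    intro n t ht
    refine energy_le_of_tendsto (x := fun m k => u (m + 1) t k - u n t k)
      (fun k => (ha t k ht).sub_const _) ?_
    filter_upwards [eventually_ge_atTop n] with m hm
    obtain ⟨j, hj⟩ := Nat.exists_eq_add_of_le (hm.trans (Nat.le_succ m))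
    simp only [Nat.succ_eq_add_one] at hj
    rw [hj]
    exact hmn j n t ht
  -- The contraction estimate applied to a and `u n` shows that the image of `u n`, which is the
  -- next iterate, also converges to the image of a.
  have hfix : ∀ t ∈ Ioc 0 T, a t = picard ν c a t := by
    intro t ht
    funext k
    refine tendsto_nhds_unique (ha t k ht) ?_
    by_cases hk : k = 0
    · subst hk
      simp only [husucc, picard_zero_freq]
      exact tendsto_const_nhds
    · rw [tendsto_iff_norm_sub_tendsto_zero]
      have hp : 0 < t ^ (1 / 8 : ℝ) := Real.rpow_pos_of_pos ht.1 _
      have hb : ∀ n, ‖u (n + 1) t k - picard ν c a t k‖ ≤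
          (t ^ (1 / 8 : ℝ))⁻¹ * (2 * (1 / 4) ^ n) := by
        intro n
        rw [inv_mul_eq_div, le_div_iff₀ hp, mul_comm, norm_sub_rev, husucc]
        refine norm_mul_le_of_energy_le (N := N) (z := fun k => picard ν c a t k -
          picard ν c (u n) t k) ht.1 (by positivity) ?_ hk
        refine (hcon a (u n) haA (hAdm n) t ht (4 * (1 / 16) ^ n) (by
          rw [hq]; finiteness) fun s hs => han n s ⟨hs.1, hs.2.le.trans ht.2⟩).1.trans ?_
        rw [← mul_assoc, mul_pow, ENNReal.ofReal_mul (by norm_num), ← hq]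
        gcongr
        refine h416.trans ?_
        norm_num
      refine squeeze_zero (fun _ => norm_nonneg _) hb ?_
      have := (tendsto_pow_atTop_nhds_zero_of_lt_one (r := (1 / 4 : ℝ)) (by norm_num)
        (by norm_num)).const_mul 2 |>.const_mul (t ^ (1 / 8 : ℝ))⁻¹
      simpa using this
  refine ⟨a, haA, fun t ht => ⟨hfix t ht, ?_⟩⟩
  have h := (hcorr a haA t ht).2
  rw [← hfix t ht] at h
  simpa only [picard_zero] using h

end FixedPoint

/-! ### Sobolev sums, dominated convergence and the linear flow -/

section Sobolev

variable {d : ℕ}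

theorem tendsto_tsum_of_dominated {α ι : Type*} [Countable ι] {l : Filter α}
    [l.IsCountablyGenerated] {f : α → ι → ℝ≥0∞} {g b : ι → ℝ≥0∞} (hb : ∑' i, b i ≠ ⊤)
    (hf : ∀ᶠ x in l, ∀ i, f x i ≤ b i) (hg : ∀ i, Tendsto (fun x => f x i) l (𝓝 (g i))) :
    Tendsto (fun x => ∑' i, f x i) l (𝓝 (∑' i, g i)) := by
  let _ : MeasurableSpace ι := ⊤
  have : MeasurableSingletonClass ι := ⟨fun _ => trivial⟩
  simp only [← lintegral_count]
  refine tendsto_lintegral_filter_of_dominated_convergence b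
    (Eventually.of_forall fun _ => measurable_from_top) ?_ (by rwa [lintegral_count])
    (ae_of_all _ hg)
  filter_upwards [hf] with x hx using ae_of_all _ hx

/-- The weighted square sum `∑ (1 + |k|^p) |c(k)|²`. -/
noncomputable def sobSq (p : ℕ) (c : (Fin d → ℤ) → ℂ) : ℝ≥0∞ :=
  ∑' k, ENNReal.ofReal (1 + freqNorm k ^ p) * ‖c k‖ₑ ^ 2

theorem sobolevNormSq_eq {s : ℝ} {p : ℕ} (hs : 2 * s = p) (f : L2 d) :
    sobolevNormSq s f = sobSq p (fourierCoef f) := by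
  refine tsum_congr fun k => ?_
  have := freqNorm_nonneg k
  rw [hs, Real.rpow_natCast, ENNReal.ofReal_mul (by positivity),
    ENNReal.ofReal_pow (norm_nonneg _), ofReal_norm]

theorem sobSq_zero (p : ℕ) : sobSq p (fun _ : Fin d → ℤ => 0) = 0 := by simp [sobSq]

theorem sobSq_add_le (p : ℕ) (b c : (Fin d → ℤ) → ℂ) :
    sobSq p (fun k => b k + c k) ≤ 2 * sobSq p b + 2 * sobSq p c := by
  simp only [sobSq, ← ENNReal.tsum_mul_left, ← ENNReal.tsum_add]
  refine ENNReal.tsum_le_tsum fun k => ?_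
  calc _ ≤ ENNReal.ofReal (1 + freqNorm k ^ p) * (2 * ‖b k‖ₑ ^ 2 + 2 * ‖c k‖ₑ ^ 2) := by
        gcongr
        refine le_trans ?_ (ennreal_add_sq_le _ _)
        gcongr
        exact enorm_add_le _ _
    _ = _ := by ring

theorem sobSq_smul (p : ℕ) (a : ℝ) (c : (Fin d → ℤ) → ℂ) :
    sobSq p (fun k => a * c k) = ENNReal.ofReal (a ^ 2) * sobSq p c := by
  rw [sobSq, sobSq, ← ENNReal.tsum_mul_left]
  refine tsum_congr fun k => ?_
  rw [enorm_mul, mul_pow, ← ofReal_norm (a : ℂ), Complex.norm_real, Real.norm_eq_abs,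
    ← ENNReal.ofReal_pow (abs_nonneg a), sq_abs]
  ring

theorem one_add_freqNorm_pow_le (p : ℕ) (k : Fin d → ℤ) :
    1 + freqNorm k ^ p ≤ (1 + Real.sqrt d ^ p) * (1 + ‖k‖) ^ p := by
  have h0 := norm_nonneg k
  have hf := freqNorm_nonneg k
  have h1 : 1 ≤ (1 + ‖k‖) ^ p := one_le_pow₀ (by linarith)
  have h2 : freqNorm k ^ p ≤ (Real.sqrt d * (1 + ‖k‖)) ^ p := by
    gcongr
    refine (freqNorm_le_norm k).trans ?_
    gcongr
    linarith
  rw [mul_pow] at h2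
  linarith

/-- Polynomially decaying families have finite weighted sums. -/
theorem tsum_sobSq_decay_lt_top (hd : 1 ≤ d) {N p : ℕ} (hN : p + d + 1 ≤ 2 * N) (E : ℝ) :
    ∑' k : Fin d → ℤ, ENNReal.ofReal (1 + freqNorm k ^ p) *
      ENNReal.ofReal ((E * (1 / (1 + ‖k‖) ^ N)) ^ 2) < ⊤ := by
  have hs := (summable_one_div_pow hd (n := d + 1) le_rfl).mul_left
    ((1 + Real.sqrt d ^ p) * E ^ 2)
  refine lt_of_le_of_lt (ENNReal.tsum_le_tsum fun k => ?_) (hs.tsum_ofReal_lt_top)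
  have h0 := norm_nonneg k
  have hf := freqNorm_nonneg k
  rw [← ENNReal.ofReal_mul (by positivity)]
  apply ENNReal.ofReal_le_ofReal
  calc _ ≤ (1 + Real.sqrt d ^ p) * (1 + ‖k‖) ^ p * (E * (1 / (1 + ‖k‖) ^ N)) ^ 2 := by
        gcongr; exact one_add_freqNorm_pow_le p k
    _ = (1 + Real.sqrt d ^ p) * E ^ 2 * ((1 + ‖k‖) ^ p * (1 / (1 + ‖k‖) ^ (2 * N))) := by
        rw [mul_pow, div_pow, one_pow, ← pow_mul, mul_comm N 2]; ring
    _ ≤ _ := by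
        gcongr
        rw [mul_one_div, div_le_div_iff₀ (by positivity) (by positivity), one_mul, ← pow_add]
        exact pow_le_pow_right₀ (by linarith) (by omega)

theorem sobSq_lt_top_of_decay (hd : 1 ≤ d) {N p : ℕ} (hN : p + d + 1 ≤ 2 * N) {E : ℝ}
    {c : (Fin d → ℤ) → ℂ} (hc : ∀ k, ‖c k‖ ≤ E * (1 / (1 + ‖k‖) ^ N)) : sobSq p c < ⊤ := by
  refine lt_of_le_of_lt (ENNReal.tsum_le_tsum fun k => ?_) (tsum_sobSq_decay_lt_top hd hN E)
  gcongr
  rw [← ofReal_norm, ← ENNReal.ofReal_pow (norm_nonneg _)]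
  have := hc k
  gcongr

theorem tendsto_sobSq_sub (hd : 1 ≤ d) {N p : ℕ} (hN : p + d + 1 ≤ 2 * N) {l : Filter ℝ}
    [l.IsCountablyGenerated] {y : ℝ → (Fin d → ℤ) → ℂ} {z : (Fin d → ℤ) → ℂ} {E : ℝ}
    (hy : ∀ k, Tendsto (fun r => y r k) l (𝓝 (z k)))
    (hb : ∀ᶠ r in l, ∀ k, ‖y r k‖ ≤ E * (1 / (1 + ‖k‖) ^ N))
    (hz : ∀ k, ‖z k‖ ≤ E * (1 / (1 + ‖k‖) ^ N)) :
    Tendsto (fun r => sobSq p fun k => y r k - z k) l (𝓝 0) := by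
  have h := tendsto_tsum_of_dominated (l := l)
    (f := fun r k => ENNReal.ofReal (1 + freqNorm k ^ p) * ‖y r k - z k‖ₑ ^ 2) (g := fun _ => 0)
    (tsum_sobSq_decay_lt_top hd hN (2 * E)).ne ?_ ?_
  · rw [tsum_zero] at h; exact h
  · filter_upwards [hb] with r hr k
    gcongr
    rw [← ofReal_norm, ← ENNReal.ofReal_pow (norm_nonneg _)]
    gcongr
    refine (norm_sub_le _ _).trans ?_
    have := hr k
    have := hz k
    linarith
  · intro k
    have h1 : Tendsto (fun r => y r k - z k) l (𝓝 0) := by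
      simpa using (hy k).sub_const (z k)
    have h2 := ((ENNReal.continuous_pow 2).tendsto _).comp h1.enorm
    simpa using ENNReal.Tendsto.const_mul h2 (a := ENNReal.ofReal (1 + freqNorm k ^ p))
      (Or.inr ENNReal.ofReal_ne_top)

/-- The quantity controlling the linear evolution up to time `t`. -/
noncomputable def lowNorm (c : (Fin d → ℤ) → ℂ) (t : ℝ) : ℝ≥0∞ :=
  ∑' k, ENNReal.ofReal (freqNorm k ^ d * min 1 (t ^ (1 / 4 : ℝ) * freqNorm k)) * ‖c k‖ₑ ^ 2

theorem lowNorm_mono (c : (Fin d → ℤ) → ℂ) {s t : ℝ} (hs : 0 ≤ s) (hst : s ≤ t) :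
    lowNorm c s ≤ lowNorm c t := by
  refine ENNReal.tsum_le_tsum fun k => ?_
  have := freqNorm_nonneg k
  gcongr

/-- One extra derivative on the data gives a rate at t = 0. This makes the existence time depend
only on the H^{d/2+1} norm, which the regularity argument needs. -/
theorem lowNorm_le (c : (Fin d → ℤ) → ℂ) {t : ℝ} (ht : 0 ≤ t) :
    lowNorm c t ≤ ENNReal.ofReal (t ^ (1 / 4 : ℝ)) * sobSq (d + 2) c := by
  rw [sobSq, ← ENNReal.tsum_mul_left]
  refine ENNReal.tsum_le_tsum fun k => ?_
  rw [← mul_assoc, ← ENNReal.ofReal_mul (by positivity)]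
  have hf := freqNorm_nonneg k
  refine mul_le_mul' (ENNReal.ofReal_le_ofReal ?_) le_rfl
  calc _ ≤ freqNorm k ^ d * (t ^ (1 / 4 : ℝ) * freqNorm k) := by gcongr; exact min_le_right _ _
    _ = t ^ (1 / 4 : ℝ) * freqNorm k ^ (d + 1) := by ring
    _ ≤ _ := by
        gcongr
        by_cases hk : k = 0
        · simp [hk, freqNorm_zero]
        · have := pow_le_pow_right₀ (one_le_freqNorm hk) (by omega : d + 1 ≤ d + 2)
          linarith

/-- Dominated convergence with the H^{d/2} sum as majorant. There is no rate, so in the critical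
space the existence time depends on the data and not merely on its norm. -/
theorem tendsto_lowNorm {c : (Fin d → ℤ) → ℂ} (hc : sobSq d c < ⊤) :
    Tendsto (lowNorm c) (𝓝[>] 0) (𝓝 0) := by
  have h := tendsto_tsum_of_dominated (l := 𝓝[>] (0 : ℝ)) (f := fun t k => ENNReal.ofReal
    (freqNorm k ^ d * min 1 (t ^ (1 / 4 : ℝ) * freqNorm k)) * ‖c k‖ₑ ^ 2) (g := fun _ => 0)
    hc.ne ?_ ?_
  · rw [tsum_zero] at h; exact h
  · refine Eventually.of_forall fun t k => mul_le_mul' (ENNReal.ofReal_le_ofReal ?_) le_rfl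
    have hf := freqNorm_nonneg k
    calc _ ≤ freqNorm k ^ d * 1 := by gcongr; exact min_le_left _ _
      _ ≤ _ := by linarith
  · intro k
    have h1 : Continuous fun t : ℝ => freqNorm k ^ d * min 1 (t ^ (1 / 4 : ℝ) * freqNorm k) := by
      have := Real.continuous_rpow_const (q := 1 / 4) (by norm_num)
      fun_prop
    have h2 := (h1.tendsto 0).mono_left (nhdsWithin_le_nhds (s := Ioi 0))
    rw [Real.zero_rpow (by norm_num), zero_mul, min_eq_right zero_le_one, mul_zero] at h2
    have h3 := ENNReal.Tendsto.mul_const (ENNReal.tendsto_ofReal h2) (b := ‖c k‖ₑ ^ 2)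
      (Or.inr (by finiteness))
    simpa using h3

theorem exists_energy_heat_le {ν : ℝ} (hν : 0 < ν) (hd : 1 ≤ d) (N : ℕ) :
    ∃ C : ℝ, 0 < C ∧ ∀ (c : (Fin d → ℤ) → ℂ) (t : ℝ), 0 < t →
      energy N t (fun k => (Real.exp (-(t * ν * freqNorm k ^ 4)) : ℂ) * c k) ≤
        ENNReal.ofReal C * lowNorm c t := by
  -- The extra power of 1+x pays for replacing x by min 1 x, through x ≤ min 1 x · (1+x).
  obtain ⟨C, hC, h⟩ := exists_pow_mul_exp_le hν (2 * N + 1)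
  refine ⟨2 ^ (d - 1) * C, by positivity, fun c t ht => ?_⟩
  rw [energy_eq_tsum N ht, lowNorm, ← ENNReal.tsum_mul_left]
  refine ENNReal.tsum_le_tsum fun k => ?_
  have hf := freqNorm_nonneg k
  have hn := norm_nonneg k
  have hw := wt_pos N (by positivity : 0 ≤ t ^ (1 / 4 : ℝ)) k
  rw [enorm_mul, mul_pow, ← mul_assoc, ← mul_assoc, ← ofReal_norm, Complex.norm_real,
    Real.norm_of_nonneg (Real.exp_pos _).le, ← ENNReal.ofReal_pow (by positivity),
    ← ENNReal.ofReal_mul (by positivity), ← ENNReal.ofReal_mul (by positivity)]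
  refine mul_le_mul' (ENNReal.ofReal_le_ofReal ?_) le_rfl
  by_cases hk : k = 0
  · simp [hk, freqNorm_zero]
  have h1 := one_le_freqNorm hk
  have hnf := norm_le_freqNorm k
  set a := t ^ (1 / 4 : ℝ) with ha
  have ha0 : 0 < a := by positivity
  set x := a * freqNorm k with hx
  have hx0 : 0 ≤ x := by positivity
  have hx4 : t * ν * freqNorm k ^ 4 = ν * x ^ 4 := by
    rw [hx, ha, mul_pow, ← Real.rpow_natCast (t ^ (1 / 4 : ℝ)), ← Real.rpow_mul ht.le]
    norm_num; ring
  have hex : Real.exp (-(ν * x ^ 4)) ≤ 1 := Real.exp_le_one_iff.mpr (by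
    have : 0 ≤ ν * x ^ 4 := by positivity
    linarith)
  have hmin : x ≤ min 1 x * (1 + x) := by
    rcases le_total 1 x with h | h
    · rw [min_eq_left h]; linarith
    · rw [min_eq_right h]; nlinarith
  have hwt : wt N a k ≤ 2 ^ (d - 1) * freqNorm k ^ (d - 1) * (1 + x) ^ (2 * N) := by
    rw [wt, ← mul_pow]
    gcongr
    · linarith
    · rw [hx]; gcongr
  have e4 : freqNorm k ^ d = freqNorm k ^ (d - 1) * freqNorm k := by
    rw [← pow_succ, Nat.sub_add_cancel hd]
  rw [hx4]
  calc _ ≤ a * freqNorm k ^ 2 * (2 ^ (d - 1) * freqNorm k ^ (d - 1) * (1 + x) ^ (2 * N)) *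
        (1 * Real.exp (-(ν * x ^ 4))) := by
        rw [sq (Real.exp _)]
        gcongr
    _ = 2 ^ (d - 1) * freqNorm k ^ d * ((1 + x) ^ (2 * N) * Real.exp (-(ν * x ^ 4))) * x := by
        rw [e4, hx]; ring
    _ ≤ 2 ^ (d - 1) * freqNorm k ^ d * ((1 + x) ^ (2 * N) * Real.exp (-(ν * x ^ 4))) *
        (min 1 x * (1 + x)) := by gcongr
    _ = 2 ^ (d - 1) * freqNorm k ^ d * min 1 x *
        ((1 + x) ^ (2 * N + 1) * Real.exp (-(ν * x ^ 4))) := by ring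
    _ ≤ 2 ^ (d - 1) * freqNorm k ^ d * min 1 x * C := by
        have : 0 ≤ min 1 x := le_min zero_le_one hx0
        gcongr
        exact h x hx0
    _ = _ := by ring

theorem nhdsWithin_Icc_eq_Ioc {T t : ℝ} (ht : t ∈ Ioc 0 T) : 𝓝[Icc 0 T] t = 𝓝[Ioc 0 T] t := by
  refine le_antisymm ?_ (nhdsWithin_mono _ Ioc_subset_Icc_self)
  refine le_inf nhdsWithin_le_nhds (le_principal_iff.mpr ?_)
  filter_upwards [self_mem_nhdsWithin, nhdsWithin_le_nhds (Ioi_mem_nhds ht.1)] with s h1 h2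
  exact ⟨h2, h1.2⟩

theorem contInSobolev_of_Ioc {s T : ℝ} {u : ℝ → L2 d} (h0 : MemSobolev s (u 0))
    (h1 : ∀ t ∈ Ioc 0 T, MemSobolev s (u t))
    (hc0 : Tendsto (fun r => sobolevNormSq s (u r - u 0)) (𝓝[Ioc 0 T] 0) (𝓝 0))
    (hc1 : ∀ t ∈ Ioc 0 T, Tendsto (fun r => sobolevNormSq s (u r - u t)) (𝓝[Ioc 0 T] t) (𝓝 0)) :
    ContInSobolev s T u := by
  refine ⟨fun t ht => ?_, fun t ht => ?_⟩
  · rcases eq_or_lt_of_le ht.1 with rfl | h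
    · exact h0
    · exact h1 t ⟨h, ht.2⟩
  · rcases eq_or_lt_of_le ht.1 with rfl | h
    · have hT : (0 : ℝ) ≤ T := ht.2
      rw [← Ioc_insert_left hT, nhdsWithin_insert]
      refine Tendsto.sup ?_ hc0
      rw [tendsto_pure_left]
      intro v hv
      have : sobolevNormSq s (u 0 - u 0) = 0 := by
        rw [sub_self, sobolevNormSq, ENNReal.tsum_eq_zero]
        intro k
        have : fourierCoef ((0 : L2 d) : Torus d → ℝ) k = 0 := by
          rw [← coefCLM_apply, map_zero]
        rw [this]; simp
      rw [this]
      exact mem_of_mem_nhds hv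
    · rw [nhdsWithin_Icc_eq_Ioc ⟨h, ht.2⟩]
      exact hc1 t ⟨h, ht.2⟩

end Sobolev

/-! ### Local existence in the solution class -/

section LocalExistence

variable {d : ℕ}

theorem Adm.exists_decay {N : ℕ} {T : ℝ} (hT1 : T ≤ 1) {R : ℝ → ℝ≥0∞}
    (hR1 : ∀ s ∈ Ioc 0 T, R s ≤ 1) {x : ℝ → (Fin d → ℤ) → ℂ} (hx : Adm N T R x) {c₀ : ℂ}
    (h0 : ∀ s ∈ Ioc 0 T, x s 0 = c₀) {δ : ℝ} (hδ : 0 < δ) :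
    ∃ E : ℝ, ∀ s ∈ Ioc 0 T, δ ≤ s → ∀ k, ‖x s k‖ ≤ E * (1 / (1 + ‖k‖) ^ N) := by
  refine ⟨‖c₀‖ + ((δ ^ (1 / 4 : ℝ)) ^ (N + 1))⁻¹, fun s hs hδs k => ?_⟩
  have hk := norm_nonneg k
  rw [add_mul]
  by_cases hk0 : k = 0
  · subst hk0
    rw [h0 s hs]
    simp only [norm_zero, add_zero, one_pow, div_one, mul_one]
    have : 0 ≤ ((δ ^ (1 / 4 : ℝ)) ^ (N + 1))⁻¹ := by positivity
    linarith
  · have h1 := freqNorm_mul_norm_le hδ hδs (hs.2.trans hT1)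
      ((hx.bound s hs).trans (hR1 s hs)) k
    have h2 : ‖x s k‖ ≤ freqNorm k * ‖x s k‖ :=
      le_mul_of_one_le_left (norm_nonneg _) (one_le_freqNorm hk0)
    have h3 : 0 ≤ ‖c₀‖ * (1 / (1 + ‖k‖) ^ N) := by positivity
    linarith

/-- Away from the zero frequency the critical weight is controlled by the energy. -/
theorem sobSq_smul_le_energy (hd : 1 ≤ d) {N : ℕ} (hN : 1 ≤ N) {t : ℝ} (ht : 0 < t)
    (x : (Fin d → ℤ) → ℂ) :
    ENNReal.ofReal ((t ^ (1 / 4 : ℝ)) ^ 2) * sobSq (d + 2) x ≤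
      ENNReal.ofReal ((t ^ (1 / 4 : ℝ)) ^ 2) * ‖x 0‖ₑ ^ 2 +
        ENNReal.ofReal (2 * Real.sqrt d ^ d) * energy N t x := by
  classical
  rw [energy_eq_tsum N ht, sobSq, ← ENNReal.tsum_mul_left, ← ENNReal.tsum_mul_left,
    ← tsum_ite_eq (0 : Fin d → ℤ)
      (fun k => ENNReal.ofReal ((t ^ (1 / 4 : ℝ)) ^ 2) * ‖x k‖ₑ ^ 2), ← ENNReal.tsum_add]
  refine ENNReal.tsum_le_tsum fun k => ?_
  set a := t ^ (1 / 4 : ℝ) with ha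
  have ha0 : 0 < a := by positivity
  by_cases hk : k = 0
  · subst hk
    simp only [↓reduceIte, freqNorm_zero]
    rw [zero_pow (by omega), add_zero, ENNReal.ofReal_one, one_mul]
    exact le_self_add
  rw [if_neg hk, zero_add, ← mul_assoc, ← mul_assoc, ← ENNReal.ofReal_mul (by positivity),
    ← ENNReal.ofReal_mul (by positivity)]
  refine mul_le_mul' (ENNReal.ofReal_le_ofReal ?_) le_rfl
  have h1 := one_le_freqNorm hk
  have hn := norm_nonneg k
  have hp : 1 ≤ freqNorm k ^ (d + 2) := one_le_pow₀ h1
  -- The spare power of 1+a‖k‖, available since N ≥ 1, raises the weight (1+‖k‖)^{d-1} to order d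
  -- and uses one of the two factors a = t^{1/4}.
  have hb : a * ‖k‖ ≤ (1 + a * ‖k‖) ^ (2 * N) := by
    have : 0 ≤ a * ‖k‖ := by positivity
    calc a * ‖k‖ ≤ (1 + a * ‖k‖) ^ 1 := by rw [pow_one]; linarith
      _ ≤ _ := pow_le_pow_right₀ (by linarith) (by omega)
  have hd' : freqNorm k ^ d ≤ Real.sqrt d ^ d * ((1 + ‖k‖) ^ (d - 1) * ‖k‖) := by
    calc freqNorm k ^ d ≤ (Real.sqrt d * ‖k‖) ^ d := by gcongr; exact freqNorm_le_norm k
      _ = Real.sqrt d ^ d * (‖k‖ ^ (d - 1) * ‖k‖) := by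
          rw [mul_pow, ← pow_succ, Nat.sub_add_cancel hd]
      _ ≤ _ := by gcongr; linarith
  calc _ ≤ a ^ 2 * (2 * freqNorm k ^ (d + 2)) := by gcongr; linarith
    _ = 2 * a ^ 2 * freqNorm k ^ 2 * freqNorm k ^ d := by ring
    _ ≤ 2 * a ^ 2 * freqNorm k ^ 2 * (Real.sqrt d ^ d * ((1 + ‖k‖) ^ (d - 1) * ‖k‖)) := by gcongr
    _ = 2 * Real.sqrt d ^ d * (a * freqNorm k ^ 2 * ((1 + ‖k‖) ^ (d - 1) * (a * ‖k‖))) := by ring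
    _ ≤ _ := by rw [wt]; gcongr

theorem tendsto_sobSq_heat {ν : ℝ} (hν : 0 < ν) {p : ℕ} {c : (Fin d → ℤ) → ℂ}
    (hc : sobSq p c < ⊤) :
    Tendsto (fun t : ℝ => sobSq p fun k => (Real.exp (-(t * ν * freqNorm k ^ 4)) : ℂ) * c k - c k)
      (𝓝[>] 0) (𝓝 0) := by
  have h := tendsto_tsum_of_dominated (l := 𝓝[>] (0 : ℝ)) (f := fun t k =>
    ENNReal.ofReal (1 + freqNorm k ^ p) *
      ‖(Real.exp (-(t * ν * freqNorm k ^ 4)) : ℂ) * c k - c k‖ₑ ^ 2) (g := fun _ => 0)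
    hc.ne ?_ ?_
  · rw [tsum_zero] at h; exact h
  · filter_upwards [self_mem_nhdsWithin] with t ht k
    have hf := freqNorm_nonneg k
    have ht0 : 0 < t := ht
    gcongr
    have e : (Real.exp (-(t * ν * freqNorm k ^ 4)) : ℂ) * c k - c k =
        ((Real.exp (-(t * ν * freqNorm k ^ 4)) - 1 : ℝ) : ℂ) * c k := by push_cast; ring
    rw [e, enorm_mul]
    refine mul_le_of_le_one_left zero_le ?_
    rw [← ofReal_norm, Complex.norm_real, ENNReal.ofReal_le_one, Real.norm_eq_abs, abs_le]
    have h1 := Real.exp_pos (-(t * ν * freqNorm k ^ 4))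
    have h2 : Real.exp (-(t * ν * freqNorm k ^ 4)) ≤ 1 := Real.exp_le_one_iff.mpr (by
      have : 0 ≤ t * ν * freqNorm k ^ 4 := by positivity
      linarith)
    constructor <;> linarith
  · intro k
    have h1 : Continuous fun t : ℝ => (Real.exp (-(t * ν * freqNorm k ^ 4)) : ℂ) * c k - c k := by
      fun_prop
    have h2 := (h1.tendsto 0).mono_left (nhdsWithin_le_nhds (s := Ioi 0))
    simp only [zero_mul, neg_zero, Real.exp_zero, Complex.ofReal_one, one_mul, sub_self] at h2
    have h3 := ((ENNReal.continuous_pow 2).tendsto _).comp h2.enorm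
    simpa using ENNReal.Tendsto.const_mul h3 (a := ENNReal.ofReal (1 + freqNorm k ^ p))
      (Or.inr ENNReal.ofReal_ne_top)

theorem sobSq_le_of_zero_freq {p : ℕ} {c : (Fin d → ℤ) → ℂ} (hc : c 0 = 0) :
    sobSq p c ≤ 2 * ∑' k, ENNReal.ofReal (freqNorm k ^ p) * ‖c k‖ₑ ^ 2 := by
  rw [sobSq, ← ENNReal.tsum_mul_left]
  refine ENNReal.tsum_le_tsum fun k => ?_
  by_cases hk : k = 0
  · simp [hk, hc]
  rw [← mul_assoc]
  gcongr
  have h1 : 1 ≤ freqNorm k ^ p := one_le_pow₀ (one_le_freqNorm hk)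
  rw [show (2 : ℝ≥0∞) = ENNReal.ofReal 2 by simp, ← ENNReal.ofReal_mul (by norm_num)]
  apply ENNReal.ofReal_le_ofReal
  linarith

/-- At positive times all continuity claims follow from locally uniform decay of the coefficients.
At t = 0 they follow from L → 0, from strong continuity of the semigroup on H^{d/2}, and from
constancy of the mode k = 0. -/
theorem isMildSolution_of_fixedPoint (hd : 1 ≤ d) {ν : ℝ} (hν : 0 < ν) {N : ℕ} (hN : d + 2 ≤ N)
    {T : ℝ} (hT1 : T ≤ 1) {h₀ : L2 d} (hh₀ : sobSq d (fourierCoef h₀) < ⊤)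
    {L : ℝ → ℝ≥0∞} (hL0 : Tendsto L (𝓝[>] 0) (𝓝 0)) (hL1 : ∀ t ∈ Ioc 0 T, 4 * L t ≤ 1)
    {a : ℝ → (Fin d → ℤ) → ℂ} (ha : Adm N T (fun t => 4 * L t) a)
    (hfix : ∀ t ∈ Ioc 0 T, a t = picard ν (fourierCoef h₀) a t)
    (hlow : ∀ t ∈ Ioc 0 T, ∑' k, ENNReal.ofReal (freqNorm k ^ d) *
      ‖a t k - (Real.exp (-(t * ν * freqNorm k ^ 4)) : ℂ) * fourierCoef h₀ k‖ₑ ^ 2 ≤ L t) :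
    ∃ h, IsMildSolution ν h₀ T h ∧
      ∀ m : ℕ, 2 * m + d + 1 ≤ 2 * N → ∀ t ∈ Ioc 0 T, MemSobolev (m : ℝ) (h t) := by
  set c := fourierCoef h₀ with hcdef
  have ha0 : ∀ t ∈ Ioc 0 T, a t 0 = c 0 := fun t ht => by
    rw [hfix t ht, picard_zero_freq]
  have hdecay : ∀ δ, 0 < δ → ∃ E : ℝ, ∀ s ∈ Ioc 0 T, δ ≤ s → ∀ k,
      ‖a s k‖ ≤ E * (1 / (1 + ‖k‖) ^ N) := fun δ hδ => ha.exists_decay hT1 hL1 ha0 hδ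
  have hfin : ∀ p, p + d + 1 ≤ 2 * N → ∀ t ∈ Ioc 0 T, sobSq p (a t) < ⊤ := by
    intro p hp t ht
    obtain ⟨E, hE⟩ := hdecay t ht.1
    exact sobSq_lt_top_of_decay hd hp (hE t ht le_rfl)
  have hex : ∀ t, ∃ f : L2 d, (t = 0 → f = h₀) ∧ (t ∈ Ioc 0 T → ∀ k, fourierCoef f k = a t k) := by
    intro t
    by_cases ht : t ∈ Ioc 0 T
    · have hl2 : ∑' k, ‖a t k‖ₑ ^ 2 < ⊤ := by
        refine lt_of_le_of_lt (ENNReal.tsum_le_tsum fun k => ?_) (hfin d (by omega) t ht)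
        refine le_mul_of_one_le_left zero_le ?_
        rw [ENNReal.one_le_ofReal]
        have := freqNorm_nonneg k
        have : 0 ≤ freqNorm k ^ d := by positivity
        linarith
      obtain ⟨f, hf⟩ := exists_fourierCoef_eq (a t) hl2 (ha.herm t ht)
      exact ⟨f, fun h => absurd h ht.1.ne', fun _ => hf⟩
    · exact ⟨h₀, fun _ => rfl, fun h => absurd h ht⟩
  choose h hh0 hha using hex
  have hz : h 0 = h₀ := hh0 0 rfl
  have hmem : ∀ (s : ℝ) (p : ℕ), 2 * s = p → p + d + 1 ≤ 2 * N → ∀ t ∈ Ioc 0 T,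
      MemSobolev s (h t) := by
    intro s p hs hp t ht
    rw [MemSobolev, sobolevNormSq_eq hs, funext (hha t ht)]
    exact hfin p hp t ht
  have hnear : ∀ t ∈ Ioc 0 T, ∀ᶠ r in 𝓝[Ioc 0 T] t, r ∈ Ioc 0 T ∧ t / 2 ≤ r := by
    intro t ht
    refine eventually_mem_nhdsWithin.and (nhdsWithin_le_nhds (Ici_mem_nhds ?_))
    have := ht.1
    linarith
  have hle : 𝓝[Ioc 0 T] (0 : ℝ) ≤ 𝓝[>] 0 := nhdsWithin_mono _ Ioc_subset_Ioi_self
  have e1 : 2 * ((d : ℝ) / 2) = (d : ℕ) := by ring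
  have e2 : 2 * ((d : ℝ) / 2 + 1) = (d + 2 : ℕ) := by push_cast; ring
  refine ⟨h, ?_, fun m hm t ht => hmem m (2 * m) (by push_cast; ring) hm t ht⟩
  rw [isMildSolution_iff hν]
  refine ⟨?_, ?_, hz, fun t => grad (a t), ?_, ?_, ?_⟩
  · refine contInSobolev_of_Ioc ?_ (hmem _ d e1 (by omega)) ?_ ?_
    · rw [MemSobolev, sobolevNormSq_eq e1, hz]; exact hh₀
    · have hb : ∀ r ∈ Ioc 0 T, sobolevNormSq ((d : ℝ) / 2) (h r - h 0) ≤ 2 * (2 * L r) +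
          2 * sobSq d fun k => (Real.exp (-(r * ν * freqNorm k ^ 4)) : ℂ) * c k - c k := by
        intro r hr
        rw [sobolevNormSq_eq e1]
        have : (fourierCoef (h r - h 0 : L2 d)) = fun k =>
            (a r k - (Real.exp (-(r * ν * freqNorm k ^ 4)) : ℂ) * c k) +
            ((Real.exp (-(r * ν * freqNorm k ^ 4)) : ℂ) * c k - c k) := by
          funext k
          rw [fourierCoef_sub, hz, hha r hr]; ring
        rw [this]
        refine (sobSq_add_le _ _ _).trans ?_
        gcongr
        refine (sobSq_le_of_zero_freq ?_).trans ?_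
        · simp [ha0 r hr, freqNorm_zero]
        · gcongr; exact hlow r hr
      have hlim : Tendsto (fun r => 2 * (2 * L r) +
          2 * sobSq d fun k => (Real.exp (-(r * ν * freqNorm k ^ 4)) : ℂ) * c k - c k)
          (𝓝[>] 0) (𝓝 (2 * (2 * 0) + 2 * 0)) := by
        refine Tendsto.add ?_ ?_
        · exact ENNReal.Tendsto.const_mul (ENNReal.Tendsto.const_mul hL0 (Or.inr (by simp)))
            (Or.inr (by simp))
        · exact ENNReal.Tendsto.const_mul (tendsto_sobSq_heat hν hh₀) (Or.inr (by simp))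
      simp only [mul_zero, add_zero] at hlim
      refine tendsto_of_tendsto_of_tendsto_of_le_of_le' tendsto_const_nhds
        (hlim.mono_left hle) (Eventually.of_forall fun _ => zero_le) ?_
      filter_upwards [self_mem_nhdsWithin] with r hr using hb r hr
    · intro t ht
      obtain ⟨E, hE⟩ := hdecay (t / 2) (half_pos ht.1)
      have hlim := tendsto_sobSq_sub hd (p := d) (by omega) (fun k => ha.cont k t ht)
        ((hnear t ht).mono fun r hr => hE r hr.1 hr.2) (hE t ht (by linarith [ht.1]))
      refine hlim.congr' ?_
      filter_upwards [self_mem_nhdsWithin] with r hr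
      rw [sobolevNormSq_eq e1]
      congr 1
      funext k
      rw [fourierCoef_sub, hha r hr, hha t ht]
  · have hcoef : ∀ r ∈ Ioc 0 T, fourierCoef (r ^ (1 / 4 : ℝ) • h r : L2 d) =
        fun k => ((r ^ (1 / 4 : ℝ) : ℝ) : ℂ) * a r k := by
      intro r hr
      funext k
      rw [fourierCoef_smul, hha r hr]
    have hw0 : (0 : ℝ) ^ (1 / 4 : ℝ) • h 0 = 0 := by
      rw [Real.zero_rpow (by norm_num), zero_smul]
    refine contInSobolev_of_Ioc ?_ ?_ ?_ ?_
    · rw [hw0, MemSobolev, sobolevNormSq_eq e2]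
      have : fourierCoef ((0 : L2 d) : Torus d → ℝ) = fun _ => 0 := by
        funext k; rw [← coefCLM_apply, map_zero]
      rw [this, sobSq_zero]
      exact ENNReal.zero_lt_top
    · intro t ht
      rw [MemSobolev, sobolevNormSq_eq e2, hcoef t ht, sobSq_smul]
      exact ENNReal.mul_lt_top ENNReal.ofReal_lt_top (hfin _ (by omega) t ht)
    · rw [hw0]
      have hb : ∀ r ∈ Ioc 0 T, sobolevNormSq ((d : ℝ) / 2 + 1) (r ^ (1 / 4 : ℝ) • h r - 0) ≤
          ENNReal.ofReal ((r ^ (1 / 4 : ℝ)) ^ 2) * ‖c 0‖ₑ ^ 2 +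
          ENNReal.ofReal (2 * Real.sqrt d ^ d) * (4 * L r) := by
        intro r hr
        rw [sub_zero, sobolevNormSq_eq e2, hcoef r hr, sobSq_smul]
        refine (sobSq_smul_le_energy hd (by omega : 1 ≤ N) hr.1 (a r)).trans ?_
        rw [ha0 r hr]
        gcongr
        exact ha.bound r hr
      have hlim : Tendsto (fun r : ℝ => ENNReal.ofReal ((r ^ (1 / 4 : ℝ)) ^ 2) * ‖c 0‖ₑ ^ 2 +
          ENNReal.ofReal (2 * Real.sqrt d ^ d) * (4 * L r)) (𝓝[>] 0)
          (𝓝 (0 * ‖c 0‖ₑ ^ 2 + ENNReal.ofReal (2 * Real.sqrt d ^ d) * (4 * 0))) := by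
        refine Tendsto.add ?_ ?_
        · refine ENNReal.Tendsto.mul_const ?_ (Or.inr (by finiteness))
          have h1 : Continuous fun r : ℝ => (r ^ (1 / 4 : ℝ)) ^ 2 :=
            (Real.continuous_rpow_const (by norm_num)).pow 2
          have h2 := ENNReal.tendsto_ofReal ((h1.tendsto 0).mono_left
            (nhdsWithin_le_nhds (s := Ioi 0)))
          simpa using h2
        · exact ENNReal.Tendsto.const_mul (ENNReal.Tendsto.const_mul hL0 (Or.inr (by simp)))
            (Or.inr ENNReal.ofReal_ne_top)
      simp only [mul_zero, add_zero, zero_mul] at hlim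
      refine tendsto_of_tendsto_of_tendsto_of_le_of_le' tendsto_const_nhds
        (hlim.mono_left hle) (Eventually.of_forall fun _ => zero_le) ?_
      filter_upwards [self_mem_nhdsWithin] with r hr using hb r hr
    · intro t ht
      obtain ⟨E, hE⟩ := hdecay (t / 2) (half_pos ht.1)
      have hw : ∀ r ∈ Ioc 0 T, t / 2 ≤ r → ∀ k,
          ‖((r ^ (1 / 4 : ℝ) : ℝ) : ℂ) * a r k‖ ≤ E * (1 / (1 + ‖k‖) ^ N) := by
        intro r hr h2 k
        have hr0 : 0 < r := hr.1
        rw [norm_mul, Complex.norm_real, Real.norm_of_nonneg (by positivity)]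
        refine (mul_le_of_le_one_left (norm_nonneg _) ?_).trans (hE r hr h2 k)
        exact Real.rpow_le_one hr0.le (hr.2.trans hT1) (by norm_num)
      have hlim := tendsto_sobSq_sub hd (p := d + 2) (l := 𝓝[Ioc 0 T] t) (by omega)
        (y := fun r k => ((r ^ (1 / 4 : ℝ) : ℝ) : ℂ) * a r k)
        (z := fun k => ((t ^ (1 / 4 : ℝ) : ℝ) : ℂ) * a t k) (fun k => ?_)
        ((hnear t ht).mono fun r hr => hw r hr.1 hr.2) (hw t ht (by linarith [ht.1]))
      · refine hlim.congr' ?_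
        filter_upwards [self_mem_nhdsWithin] with r hr
        rw [sobolevNormSq_eq e2]
        congr 1
        funext k
        rw [fourierCoef_sub, hcoef r hr, hcoef t ht]
      · refine Tendsto.mul ?_ (ha.cont k t ht)
        have h1 : Continuous fun r : ℝ => ((r ^ (1 / 4 : ℝ) : ℝ) : ℂ) :=
          Complex.continuous_ofReal.comp (Real.continuous_rpow_const (by norm_num))
        exact (h1.tendsto t).mono_left nhdsWithin_le_nhds
  · intro t ht j k
    rw [fourierCoef_grad (ha.herm t ht) (tsum_gradAbs_lt_top hd (by omega : 1 ≤ N) ht.1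
      (ht.2.trans hT1) (((ha.bound t ht).trans (hL1 t ht)).trans_lt ENNReal.one_lt_top)),
      hha t ht]
  · refine ha.gradCont hd (by omega) hT1 hL1 ?_
    simpa using ENNReal.Tendsto.const_mul hL0 (a := 4) (Or.inr (by simp))
  · intro t ht k
    rw [hha t ht, hfix t ht]
    rfl

/-- Local existence, with a lifespan that depends only on the size of `lowNorm`. -/
theorem exists_isMildSolution (hd : 1 ≤ d) {ν : ℝ} (hν : 0 < ν) (m : ℕ) :
    ∃ ρ : ℝ, 0 < ρ ∧ ∀ h₀ : L2 d, MemSobolev ((d : ℝ) / 2) h₀ → ∀ T ∈ Ioc 0 ρ,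
      lowNorm (fourierCoef h₀) T ≤ ENNReal.ofReal ρ →
      ∃ h, IsMildSolution ν h₀ T h ∧ ∀ t ∈ Ioc 0 T, MemSobolev (m : ℝ) (h t) := by
  -- Decay of order N controls H^m once 2N ≥ 2m + d + 1; the fixed point and the solution class need
  -- N ≥ d + 2.
  set N := d + m + 2 with hN
  obtain ⟨K, hK, hfp⟩ := exists_picard_fixedPoint hd hν (by omega : d + 1 ≤ N)
  obtain ⟨C, hC, hlin⟩ := exists_energy_heat_le hν hd N
  -- The three summands make ρ = 1/D satisfy T ≤ 1, L T ≤ 1/4 and the contraction condition, in this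
  -- order.
  set D := 1 + 4 * C + 16 * K * (16 * C ^ 2 + 1) with hD
  have hDpos : 0 < D := by positivity
  have hD1 : D⁻¹ ≤ 1 := inv_le_one_of_one_le₀ (by
    have : 0 ≤ 4 * C + 16 * K * (16 * C ^ 2 + 1) := by positivity
    linarith)
  have hDC : C * D⁻¹ ≤ 1 / 4 := by
    rw [← div_eq_mul_inv, div_le_div_iff₀ hDpos (by norm_num)]
    have : 0 ≤ 16 * K * (16 * C ^ 2 + 1) := by positivity
    linarith
  have hDK : K * ((4 * (C * D⁻¹)) ^ 2 + D⁻¹) ≤ 1 / 16 := by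
    have h1 : K * (16 * C ^ 2 + 1) * D⁻¹ ≤ 1 / 16 := by
      rw [← div_eq_mul_inv, div_le_div_iff₀ hDpos (by norm_num)]
      linarith
    refine le_trans ?_ h1
    have h2 : D⁻¹ ^ 2 ≤ D⁻¹ := pow_le_of_le_one (by positivity) hD1 (by norm_num)
    calc _ = K * (16 * C ^ 2 * D⁻¹ ^ 2 + D⁻¹) := by ring
      _ ≤ K * (16 * C ^ 2 * D⁻¹ + D⁻¹) := by gcongr
      _ = _ := by ring
  refine ⟨D⁻¹, by positivity, fun h₀ hh₀ T hT hlow => ?_⟩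
  rw [MemSobolev, sobolevNormSq_eq (p := d) (by ring)] at hh₀
  set L : ℝ → ℝ≥0∞ := fun t => ENNReal.ofReal C * lowNorm (fourierCoef h₀) t with hL
  have hT1 : T ≤ 1 := hT.2.trans hD1
  have hLmono : MonotoneOn L (Ioc 0 T) := fun s hs t _ hst => by
    simp only [hL]
    gcongr
    exact lowNorm_mono _ hs.1.le hst
  have hL0 : Tendsto L (𝓝[>] 0) (𝓝 0) := by
    simpa using ENNReal.Tendsto.const_mul (tendsto_lowNorm hh₀) (a := ENNReal.ofReal C)
      (Or.inr ENNReal.ofReal_ne_top)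
  have hLT : L T ≤ ENNReal.ofReal (C * D⁻¹) := by
    rw [ENNReal.ofReal_mul hC.le]; simp only [hL]; gcongr
  have h4 : L T ≤ 1 / 4 := by
    refine hLT.trans ((ENNReal.ofReal_le_ofReal hDC).trans (le_of_eq ?_))
    rw [ENNReal.ofReal_div_of_pos (by norm_num)]; norm_num
  obtain ⟨a, ha, hfix⟩ := hfp T hT.1 hT1 (fourierCoef h₀) L (fun k => fourierCoef_neg h₀ k) hLmono
    hL0 (fun t ht => hlin _ t ht.1) h4 (by
      calc _ ≤ ENNReal.ofReal K * ((4 * ENNReal.ofReal (C * D⁻¹)) ^ 2 + ENNReal.ofReal D⁻¹) := by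
            gcongr; exact hT.2
        _ = ENNReal.ofReal (K * ((4 * (C * D⁻¹)) ^ 2 + D⁻¹)) := by
            rw [ENNReal.ofReal_mul hK.le, ENNReal.ofReal_add (by positivity) (by positivity),
              ENNReal.ofReal_pow (by positivity), ENNReal.ofReal_mul (p := 4) (by norm_num)]
            norm_num
        _ ≤ ENNReal.ofReal (1 / 16) := ENNReal.ofReal_le_ofReal hDK
        _ = _ := by rw [ENNReal.ofReal_div_of_pos (by norm_num)]; norm_num)
  obtain ⟨h, hm, hs⟩ := isMildSolution_of_fixedPoint hd hν (by omega : d + 2 ≤ N) hT1 hh₀ hL0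
    (fun t ht => by
      calc 4 * L t ≤ 4 * (1 / 4) := by
            gcongr
            exact (hLmono ht ⟨hT.1, le_rfl⟩ ht.2).trans h4
        _ = 1 := by rw [one_div, ENNReal.mul_inv_cancel (by simp) (by simp)])
    ha (fun t ht => (hfix t ht).1) (fun t ht => (hfix t ht).2)
  exact ⟨h, hm, hs m (by omega)⟩

end LocalExistence

/-! ### Restarting at positive times and gain of regularity -/

section Restart

variable {d : ℕ}

theorem ContInSobolev.mono {s T T' : ℝ} (hT : T' ≤ T) {u : ℝ → L2 d} (hu : ContInSobolev s T u) :
    ContInSobolev s T' u :=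
  have h : Icc 0 T' ⊆ Icc 0 T := Icc_subset_Icc_right hT
  ⟨fun t ht => hu.1 t (h ht), fun t ht => (hu.2 t (h ht)).mono_left (nhdsWithin_mono _ h)⟩

theorem ContInSobolev.congr {s T : ℝ} {u v : ℝ → L2 d} (hu : ContInSobolev s T u)
    (h : EqOn v u (Icc 0 T)) : ContInSobolev s T v := by
  refine ⟨fun t ht => by rw [h ht]; exact hu.1 t ht, fun t ht => (hu.2 t ht).congr' ?_⟩
  filter_upwards [self_mem_nhdsWithin] with r hr
  rw [h ht, h hr]

theorem ContInSobolev.comp_add {s T t₀ : ℝ} (ht₀ : 0 ≤ t₀) {u : ℝ → L2 d}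
    (hu : ContInSobolev s T u) : ContInSobolev s (T - t₀) fun r => u (t₀ + r) := by
  have hmem : ∀ r ∈ Icc 0 (T - t₀), t₀ + r ∈ Icc 0 T := fun r hr =>
    ⟨by linarith [hr.1], by linarith [hr.2]⟩
  refine ⟨fun t ht => hu.1 _ (hmem t ht), fun t ht => (hu.2 _ (hmem t ht)).comp ?_⟩
  refine tendsto_nhdsWithin_iff.mpr ⟨?_, ?_⟩
  · exact ((continuous_const_add t₀).tendsto t).mono_left nhdsWithin_le_nhds
  · filter_upwards [self_mem_nhdsWithin] with r hr using hmem r hr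

theorem sobolevNormSq_add_le {s : ℝ} {p : ℕ} (hs : 2 * s = p) (f g : L2 d) :
    sobolevNormSq s (f + g) ≤ 2 * sobolevNormSq s f + 2 * sobolevNormSq s g := by
  simp only [sobolevNormSq_eq hs]
  rw [show fourierCoef ((f + g : L2 d) : Torus d → ℝ) = fun k => fourierCoef f k + fourierCoef g k
    from funext (fourierCoef_add f g)]
  exact sobSq_add_le _ _ _

theorem sobolevNormSq_smul {s : ℝ} {p : ℕ} (hs : 2 * s = p) (a : ℝ) (f : L2 d) :
    sobolevNormSq s (a • f) = ENNReal.ofReal (a ^ 2) * sobolevNormSq s f := by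
  simp only [sobolevNormSq_eq hs]
  rw [show fourierCoef ((a • f : L2 d) : Torus d → ℝ) = fun k => (a : ℂ) * fourierCoef f k
    from funext (fourierCoef_smul a f), sobSq_smul]

theorem ContInSobolev.smul {s T : ℝ} {p : ℕ} (hs : 2 * s = p) {u : ℝ → L2 d}
    (hu : ContInSobolev s T u) {φ : ℝ → ℝ} (hφ : ContinuousOn φ (Icc 0 T)) :
    ContInSobolev s T fun r => φ r • u r := by
  refine ⟨fun t ht => ?_, fun t ht => ?_⟩
  · rw [MemSobolev, sobolevNormSq_smul hs]
    exact ENNReal.mul_lt_top ENNReal.ofReal_lt_top (hu.1 t ht)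
  · have h1 : Tendsto (fun r => 2 * (ENNReal.ofReal (φ r ^ 2) * sobolevNormSq s (u r - u t)) +
        2 * (ENNReal.ofReal ((φ r - φ t) ^ 2) * sobolevNormSq s (u t))) (𝓝[Icc 0 T] t)
        (𝓝 (2 * (ENNReal.ofReal (φ t ^ 2) * 0) +
          2 * (ENNReal.ofReal ((φ t - φ t) ^ 2) * sobolevNormSq s (u t)))) := by
      have hφt : Tendsto φ (𝓝[Icc 0 T] t) (𝓝 (φ t)) := hφ t ht
      refine Tendsto.add ?_ ?_
      · refine ENNReal.Tendsto.const_mul ?_ (Or.inr (by simp))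
        exact ENNReal.Tendsto.mul (ENNReal.tendsto_ofReal (hφt.pow 2)) (Or.inr (by simp))
          (hu.2 t ht) (Or.inr ENNReal.ofReal_ne_top)
      · refine ENNReal.Tendsto.const_mul ?_ (Or.inr (by simp))
        exact ENNReal.Tendsto.mul_const (ENNReal.tendsto_ofReal ((hφt.sub_const _).pow 2))
          (Or.inr (hu.1 t ht).ne)
    simp only [sub_self, mul_zero, ne_eq, OfNat.ofNat_ne_zero, not_false_eq_true, zero_pow,
      ENNReal.ofReal_zero, zero_mul, add_zero] at h1
    refine tendsto_of_tendsto_of_tendsto_of_le_of_le tendsto_const_nhds h1 (fun _ => zero_le) ?_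
    intro r
    simp only
    have e : φ r • u r - φ t • u t = φ r • (u r - u t) + (φ r - φ t) • u t := by
      rw [smul_sub, sub_smul]; abel
    rw [e, ← sobolevNormSq_smul hs, ← sobolevNormSq_smul hs]
    exact sobolevNormSq_add_le hs _ _

theorem IsMildSolution.mono {ν T T' : ℝ} (hν : 0 < ν) (hT : T' ≤ T) {h₀ : L2 d} {h : ℝ → L2 d}
    (hm : IsMildSolution ν h₀ T h) : IsMildSolution ν h₀ T' h := by
  rw [isMildSolution_iff hν] at hm ⊢
  obtain ⟨h1, h2, h3, p, hw, hp, hc⟩ := hm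
  have hs : Ioc 0 T' ⊆ Ioc 0 T := Ioc_subset_Ioc_right hT
  exact ⟨h1.mono hT, h2.mono hT, h3, p, fun t ht => hw t (hs ht),
    fun j => (hp j).mono (Icc_subset_Icc_right hT), fun t ht => hc t (hs ht)⟩

theorem IsMildSolution.congr {ν T : ℝ} (hν : 0 < ν) (hT : 0 ≤ T) {h₀ : L2 d} {h g : ℝ → L2 d}
    (hm : IsMildSolution ν h₀ T h) (hg : EqOn g h (Icc 0 T)) : IsMildSolution ν h₀ T g := by
  rw [isMildSolution_iff hν] at hm ⊢
  obtain ⟨h1, h2, h3, p, hw, hp, hc⟩ := hm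
  refine ⟨h1.congr hg, h2.congr fun t ht => ?_, by rw [hg ⟨le_rfl, hT⟩, h3], p,
    fun t ht j => ?_, hp, fun t ht k => ?_⟩
  · simp only [hg ht]
  · rw [hg (Ioc_subset_Icc_self ht)]; exact hw t ht j
  · rw [hg (Ioc_subset_Icc_self ht)]; exact hc t ht k

/-- The semigroup law: the integral up to t₀ + r is split at t₀, and on the first piece the factor
e^{-rν|k|⁴} comes out, so it combines with the linear term into the evolution of h(t₀). -/
theorem CoefMild.restart {ν T : ℝ} (hν : 0 < ν) {h₀ : L2 d} {h : ℝ → L2 d}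
    {p : ℝ → Fin d → C(Torus d, ℝ)} (hp : GradCont T p) (hc : ∀ t ∈ Ioc 0 T, CoefMild ν h₀ h p t)
    {t₀ : ℝ} (ht₀ : 0 < t₀) {r : ℝ} (hr : r ∈ Ioc 0 (T - t₀)) :
    CoefMild ν (h t₀) (fun r => h (t₀ + r)) (fun r => p (t₀ + r)) r := by
  intro k
  have hr0 : 0 < r := hr.1
  have hmem : t₀ + r ∈ Ioc 0 T := ⟨by linarith, by linarith [hr.2]⟩
  have hmem0 : t₀ ∈ Ioc 0 T := ⟨ht₀, by linarith [hr.2]⟩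
  set E := fun τ : ℝ => (Real.exp (-(τ * ν * freqNorm k ^ 4)) : ℂ) with hE
  have hEadd : ∀ a b, E (a + b) = E a * E b := by
    intro a b
    simp only [hE]
    rw [← Complex.ofReal_mul, ← Real.exp_add]
    ring_nf
  have hsym : ∀ j a b, derivSymbol ν j (a + b) k = E a * derivSymbol ν j b k := by
    intro j a b
    have h1 := hEadd a b
    simp only [hE] at h1
    simp only [derivSymbol, hE]
    rw [h1]; ring
  have hsplit : ∀ j, ∫ s in Ioo 0 (t₀ + r),
      derivSymbol ν j (t₀ + r - s) k * fourierCoef (flux (p s) j) k =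
      E r * (∫ s in Ioo 0 t₀, derivSymbol ν j (t₀ - s) k * fourierCoef (flux (p s) j) k) +
      ∫ s in Ioo 0 r, derivSymbol ν j (r - s) k * fourierCoef (flux (p (t₀ + s)) j) k := by
    intro j
    have hint : IntervalIntegrable (fun s => derivSymbol ν j (t₀ + r - s) k *
        fourierCoef (flux (p s) j) k) volume 0 (t₀ + r) :=
      (intervalIntegrable_iff_integrableOn_Ioo_of_le hmem.1.le).mpr (hp.integrable hν hmem j k)
    have hi1 := hint.mono_set (c := 0) (d := t₀)
      (by rw [uIcc_of_le ht₀.le, uIcc_of_le hmem.1.le]; exact Icc_subset_Icc_right (by linarith))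
    have hi2 := hint.mono_set (c := t₀) (d := t₀ + r)
      (by rw [uIcc_of_le (by linarith), uIcc_of_le hmem.1.le]; exact Icc_subset_Icc_left ht₀.le)
    have hadd := intervalIntegral.integral_add_adjacent_intervals hi1 hi2
    have htr := intervalIntegral.integral_comp_add_left (a := 0) (b := r)
      (fun s => derivSymbol ν j (t₀ + r - s) k * fourierCoef (flux (p s) j) k) t₀
    simp only [add_sub_add_left_eq_sub, add_zero] at htr
    rw [← htr, intervalIntegral.integral_of_le ht₀.le, intervalIntegral.integral_of_le hr0.le,
      intervalIntegral.integral_of_le hmem.1.le, integral_Ioc_eq_integral_Ioo,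
      integral_Ioc_eq_integral_Ioo, integral_Ioc_eq_integral_Ioo] at hadd
    rw [← hadd, ← integral_const_mul]
    congr 2 with s
    rw [← mul_assoc, ← hsym]
    ring_nf
  have h1 := hc _ hmem k
  have h2 := hc _ hmem0 k
  change fourierCoef (h (t₀ + r)) k = E r * fourierCoef (h t₀) k + _
  change fourierCoef (h (t₀ + r)) k = E (t₀ + r) * fourierCoef h₀ k + _ at h1
  change fourierCoef (h t₀) k = E t₀ * fourierCoef h₀ k + _ at h2
  rw [h1, h2, hEadd]
  simp only [hsplit, Finset.sum_add_distrib, ← Finset.mul_sum]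
  ring

theorem IsMildSolution.restart {ν T : ℝ} (hν : 0 < ν) {h₀ : L2 d} {h : ℝ → L2 d}
    (hm : IsMildSolution ν h₀ T h) {t₀ : ℝ} (ht₀ : 0 < t₀) :
    IsMildSolution ν (h t₀) (T - t₀) fun r => h (t₀ + r) := by
  rw [isMildSolution_iff hν] at hm ⊢
  obtain ⟨h1, h2, h3, p, hw, hp, hc⟩ := hm
  have hmem : ∀ r, 0 ≤ r → r ≤ T - t₀ → t₀ + r ∈ Ioc 0 T := fun r h0 h1 =>
    ⟨by linarith, by linarith⟩
  refine ⟨h1.comp_add ht₀.le, ?_, by simp, fun r => p (t₀ + r), fun t ht => hw _ (hmem t ht.1.le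
    ht.2), fun j => ?_, fun r hr => CoefMild.restart hν hp hc ht₀ hr⟩
  -- The new weight r^{1/4} is this function times the old weight (t₀+r)^{1/4}; the quotient is
  -- continuous because t₀ is positive.
  · have hφ : ContinuousOn (fun r : ℝ => r ^ (1 / 4 : ℝ) * (t₀ + r) ^ (-(1 / 4) : ℝ))
        (Icc 0 (T - t₀)) := by
      refine (Real.continuous_rpow_const (by norm_num)).continuousOn.mul fun r hr => ?_
      refine ContinuousAt.continuousWithinAt ?_
      refine ContinuousAt.rpow_const (by fun_prop) (Or.inl ?_)
      have := hr.1
      linarith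
    refine (ContInSobolev.smul (p := d + 2) (by push_cast; ring) (h2.comp_add ht₀.le) hφ).congr ?_
    intro r hr
    have : 0 < t₀ + r := by linarith [hr.1]
    simp only
    rw [smul_smul, mul_assoc, ← Real.rpow_add this]
    simp
  · refine (Real.continuous_rpow_const (by norm_num)).continuousOn.smul ?_
    have h4 : ContinuousOn (fun r => p (t₀ + r)) (Icc 0 (T - t₀)) :=
      hp.continuousOn.comp (continuous_const_add t₀).continuousOn fun r hr => hmem r hr.1 hr.2
    exact (continuous_apply j).comp_continuousOn h4

/-- Just before t the H^{d/2+1} norm of h is bounded, so a restart at some t₀ < t close to t yields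
a solution of high regularity that still exists at t. Uniqueness identifies it with h, so no higher
norm has to be propagated along the solution. -/
theorem IsMildSolution.memSobolev (hd : 1 ≤ d) {ν T : ℝ} (hν : 0 < ν) {h₀ : L2 d} {h : ℝ → L2 d}
    (hm : IsMildSolution ν h₀ T h) {t : ℝ} (ht : t ∈ Ioc 0 T) (m : ℕ) :
    MemSobolev (m : ℝ) (h t) := by
  obtain ⟨ρ, hρ, hloc⟩ := exists_isMildSolution hd hν m
  have ht0 : 0 < t := ht.1
  have e1 : 2 * ((d : ℝ) / 2) = (d : ℕ) := by ring
  have e2 : 2 * ((d : ℝ) / 2 + 1) = (d + 2 : ℕ) := by push_cast; ring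
  have hc1 := hm.1
  have hc2 := hm.2.1
  set u : ℝ → L2 d := fun r => r ^ (1 / 4 : ℝ) • h r with hu
  -- Near t the weighted solution is within 1 of its value at t in squared norm; the factors 2 come
  -- from squaring a sum.
  set B := 2 * 1 + 2 * sobolevNormSq ((d : ℝ) / 2 + 1) (u t) with hB
  have hBt : B < ⊤ := by
    have := hc2.1 t (Ioc_subset_Icc_self ht)
    rw [MemSobolev] at this
    finiteness
  have hBt' : ENNReal.ofReal (((t / 2) ^ (-(1 / 4) : ℝ)) ^ 2) * B ≠ ⊤ :=
    ENNReal.mul_ne_top ENNReal.ofReal_ne_top hBt.ne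
  have hlt : 𝓝[Ioo 0 t] t ≤ 𝓝[Icc 0 T] t :=
    nhdsWithin_mono _ fun r hr => ⟨hr.1.le, hr.2.le.trans ht.2⟩
  have hev : ∀ᶠ r in 𝓝[Ioo 0 t] t, sobolevNormSq ((d : ℝ) / 2 + 1) (u r) ≤ B := by
    filter_upwards [hlt ((hc2.2 t (Ioc_subset_Icc_self ht)).eventually
      (Iic_mem_nhds zero_lt_one))] with r hr
    have := sobolevNormSq_add_le e2 (u r - u t) (u t)
    rw [sub_add_cancel] at this
    refine this.trans ?_
    rw [hB]
    gcongr
  set B' := ENNReal.ofReal (((t / 2) ^ (-(1 / 4) : ℝ)) ^ 2) * B with hB'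
  have hev2 : ∀ᶠ r in 𝓝[Ioo 0 t] t, sobolevNormSq ((d : ℝ) / 2 + 1) (h r) ≤ B' := by
    filter_upwards [hev, nhdsWithin_le_nhds (Ici_mem_nhds (half_lt_self ht0)),
      self_mem_nhdsWithin] with r hr h2 h3
    have hr0 : 0 < r := h3.1
    have e : h r = r ^ (-(1 / 4) : ℝ) • u r := by
      simp only [hu]
      rw [smul_smul, ← Real.rpow_add hr0]
      simp
    rw [e, sobolevNormSq_smul e2, hB']
    gcongr ENNReal.ofReal (?_ ^ 2) * ?_
    · exact Real.rpow_le_rpow_of_nonpos (by positivity) h2 (by norm_num)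
  have hsub : Tendsto (fun r => t - r) (𝓝[Ioo 0 t] t) (𝓝 0) := by
    have h1 : Continuous fun r => t - r := by fun_prop
    simpa using (h1.tendsto t).mono_left (nhdsWithin_le_nhds (s := Ioo 0 t))
  have hev3 : ∀ᶠ r in 𝓝[Ioo 0 t] t, t - r ≤ ρ := hsub.eventually (Iic_mem_nhds hρ)
  have hev4 : ∀ᶠ r in 𝓝[Ioo 0 t] t, ENNReal.ofReal ((t - r) ^ (1 / 4 : ℝ)) * B' ≤
      ENNReal.ofReal ρ := by
    have h1 : Tendsto (fun r => ENNReal.ofReal ((t - r) ^ (1 / 4 : ℝ)) * B') (𝓝[Ioo 0 t] t)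
        (𝓝 (ENNReal.ofReal ((0 : ℝ) ^ (1 / 4 : ℝ)) * B')) := by
      refine ENNReal.Tendsto.mul_const (ENNReal.tendsto_ofReal ?_) (Or.inr hBt')
      exact ((Real.continuous_rpow_const (by norm_num)).tendsto 0).comp hsub
    rw [Real.zero_rpow (by norm_num), ENNReal.ofReal_zero, zero_mul] at h1
    exact h1.eventually (Iic_mem_nhds (ENNReal.ofReal_pos.mpr hρ))
  -- Nontriviality of the left neighbourhood filter allows the choice of one t₀ that meets all the
  -- conditions.
  have hne : (𝓝[Ioo 0 t] t).NeBot := by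
    rw [nhdsWithin_Ioo_eq_nhdsLT ht0]; infer_instance
  obtain ⟨t₀, h1, h2, h3, h4⟩ := (hev2.and (hev3.and (hev4.and
    eventually_mem_nhdsWithin))).exists
  have ht₀ : 0 < t₀ := h4.1
  have htt : 0 < t - t₀ := sub_pos.mpr h4.2
  obtain ⟨g, hg, hgm⟩ := hloc (h t₀) (hc1.1 t₀ ⟨h4.1.le, h4.2.le.trans ht.2⟩) (t - t₀)
    ⟨htt, h2⟩ (by
      refine (lowNorm_le _ htt.le).trans (le_trans ?_ h3)
      rw [← sobolevNormSq_eq e2]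
      gcongr)
  have hres := (hm.mono hν ht.2).restart hν ht₀
  have heq := hres.unique hν hg ⟨htt.le, le_rfl⟩
  simp only [add_sub_cancel] at heq
  rw [heq]
  exact hgm _ ⟨htt, le_rfl⟩

end Restart

/-! ### Smoothness, mean value and the maximal solution -/

section Smooth

variable {d : ℕ}

theorem iteratedDeriv_cexp_mul_I (c : ℂ) (n : ℕ) :
    iteratedDeriv n (fun s : ℝ => c * Complex.exp (Complex.I * s)) =
      fun s : ℝ => c * Complex.I ^ n * Complex.exp (Complex.I * s) := by
  induction n with
  | zero => simp
  | succ n ih =>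
    rw [iteratedDeriv_succ, ih]
    funext s
    have h1 : HasDerivAt (fun s : ℝ => Complex.I * (s : ℂ)) (Complex.I * 1) s :=
      (Complex.ofRealCLM.hasDerivAt (x := s)).const_mul Complex.I
    have h2 := (h1.cexp.const_mul (c * Complex.I ^ n)).deriv
    rw [h2]; ring

/-- The linear form `x ↦ k·x`. -/
noncomputable def dotCLM (k : Fin d → ℤ) : (Fin d → ℝ) →L[ℝ] ℝ :=
  ∑ j, (k j : ℝ) • ContinuousLinearMap.proj j

theorem dotCLM_apply (k : Fin d → ℤ) (x : Fin d → ℝ) : dotCLM k x = ∑ j, (k j : ℝ) * x j := by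
  simp [dotCLM]

theorem norm_dotCLM_le (k : Fin d → ℤ) : ‖dotCLM k‖ ≤ d * ‖k‖ := by
  refine ContinuousLinearMap.opNorm_le_bound _ (by positivity) fun x => ?_
  rw [dotCLM_apply]
  refine (norm_sum_le _ _).trans ?_
  calc ∑ j, ‖(k j : ℝ) * x j‖ ≤ ∑ _j : Fin d, ‖k‖ * ‖x‖ := by
        refine Finset.sum_le_sum fun j _ => ?_
        rw [norm_mul]
        gcongr
        · simpa [Int.norm_eq_abs] using norm_le_pi_norm k j
        · exact norm_le_pi_norm x j
    _ = _ := by simp; ring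

theorem character_coe (k : Fin d → ℤ) (x : Fin d → ℝ) :
    character k (fun j => (x j : AddCircle (2 * Real.pi))) =
      Complex.exp (Complex.I * (dotCLM k x : ℝ)) := by
  rw [character, dotCLM_apply]
  simp only [fourier_coe_apply]
  rw [← Complex.exp_sum]
  congr 1
  push_cast
  rw [Finset.mul_sum]
  refine Finset.sum_congr rfl fun j _ => ?_
  have : (Real.pi : ℂ) ≠ 0 := by exact_mod_cast Real.pi_ne_zero
  field_simp

/-- A character is e^{is} composed with the linear form s = k·x. Derivatives of e^{is} have modulus
1, so each differentiation costs only the norm of the form. -/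
theorem norm_iteratedFDeriv_character_le (c : ℂ) (k : Fin d → ℤ) (n : ℕ) (x : Fin d → ℝ) :
    ‖iteratedFDeriv ℝ n (fun x : Fin d → ℝ => c * Complex.exp (Complex.I * (dotCLM k x : ℝ))) x‖ ≤
      ‖c‖ * (d * ‖k‖) ^ n := by
  have hg : ContDiff ℝ n fun s : ℝ => c * Complex.exp (Complex.I * s) :=
    contDiff_const.mul (contDiff_const.mul Complex.ofRealCLM.contDiff).cexp
  have h1 := (dotCLM k).iteratedFDeriv_comp_right hg x le_rfl
  rw [show (fun x : Fin d → ℝ => c * Complex.exp (Complex.I * (dotCLM k x : ℝ))) =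
    (fun s : ℝ => c * Complex.exp (Complex.I * s)) ∘ dotCLM k from rfl, h1]
  refine (ContinuousMultilinearMap.norm_compContinuousLinearMap_le _ _).trans ?_
  rw [norm_iteratedFDeriv_eq_norm_iteratedDeriv, iteratedDeriv_cexp_mul_I]
  rw [norm_mul, norm_mul, norm_pow, Complex.norm_I, one_pow, mul_one, mul_comm Complex.I,
    Complex.norm_exp_ofReal_mul_I, mul_one, Finset.prod_const, Finset.card_univ,
    Fintype.card_fin]
  gcongr
  exact norm_dotCLM_le k

theorem contDiff_synth {c : (Fin d → ℤ) → ℂ}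
    (hc : ∀ n : ℕ, Summable fun k : Fin d → ℤ => ‖c k‖ * (d * ‖k‖) ^ n) :
    ContDiff ℝ ∞ fun x : Fin d → ℝ => synth c fun j => (x j : AddCircle (2 * Real.pi)) := by
  have h0 : Summable fun k => ‖c k‖ := by simpa using hc 0
  have h1 : ContDiff ℝ ∞ fun x : Fin d → ℝ =>
      ∑' k, c k * Complex.exp (Complex.I * (dotCLM k x : ℝ)) := by
    refine contDiff_tsum (N := (⊤ : ℕ∞)) (v := fun n k => ‖c k‖ * (d * ‖k‖) ^ n) (fun k => ?_)
      (fun n _ => hc n) fun n k x _ => norm_iteratedFDeriv_character_le (c k) k n x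
    have := (dotCLM k).contDiff (n := ∞)
    have h2 : ContDiff ℝ ∞ fun x : Fin d → ℝ => ((dotCLM k x : ℝ) : ℂ) :=
      Complex.ofRealCLM.contDiff.comp this
    exact contDiff_const.mul (contDiff_const.mul h2).cexp
  have h3 : ContDiff ℝ ∞ fun x : Fin d → ℝ => (torusVol d)⁻¹ *
      (∑' k, c k * Complex.exp (Complex.I * (dotCLM k x : ℝ))).re :=
    contDiff_const.mul (Complex.reCLM.contDiff.comp h1)
  convert h3 using 2 with x
  simp only [synth, ContinuousMap.coe_mk]
  rw [← ContinuousMap.tsum_apply (summable_smul_charC h0)]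
  simp only [ContinuousMap.smul_apply, charC_apply, character_coe, smul_eq_mul]

/-- Membership in H^m bounds the coefficients by (1+‖k‖)^{-m}. With m = n+d+1, after n derivatives
d+1 powers are left, enough for summability. -/
theorem MemSobolev.summable (hd : 1 ≤ d) {f : L2 d} (hf : ∀ m : ℕ, MemSobolev (m : ℝ) f) (n : ℕ) :
    Summable fun k : Fin d → ℤ => ‖fourierCoef f k‖ * (d * ‖k‖) ^ n := by
  set m := n + d + 1 with hm
  have h := hf m
  rw [MemSobolev, sobolevNormSq_eq (p := 2 * m) (by push_cast; ring)] at h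
  set S := (sobSq (2 * m) (fourierCoef f)).toReal with hS
  have hb : ∀ k : Fin d → ℤ, ‖fourierCoef f k‖ * (1 + ‖k‖) ^ m ≤ 2 ^ m * Real.sqrt S := by
    intro k
    have hn := norm_nonneg k
    have hfr := freqNorm_nonneg k
    have h1 : (1 + freqNorm k ^ (2 * m)) * ‖fourierCoef f k‖ ^ 2 ≤ S := by
      have h2 := ENNReal.le_tsum (f := fun k => ENNReal.ofReal (1 + freqNorm k ^ (2 * m)) *
        ‖fourierCoef f k‖ₑ ^ 2) k
      rw [← ofReal_norm, ← ENNReal.ofReal_pow (norm_nonneg _),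
        ← ENNReal.ofReal_mul (by positivity)] at h2
      exact (ENNReal.ofReal_le_iff_le_toReal h.ne).mp h2
    have h3 : (1 + ‖k‖) ^ (2 * m) ≤ (2 ^ m) ^ 2 * (1 + freqNorm k ^ (2 * m)) := by
      rw [← pow_mul, mul_comm m 2]
      by_cases hk : k = 0
      · subst hk
        have : (1 : ℝ) ≤ 2 ^ (2 * m) := one_le_pow₀ (by norm_num)
        have h0 : (0 : ℝ) ≤ freqNorm (0 : Fin d → ℤ) ^ (2 * m) := by positivity
        simp only [norm_zero, add_zero, one_pow]
        nlinarith
      · calc (1 + ‖k‖) ^ (2 * m) ≤ (2 * freqNorm k) ^ (2 * m) := by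
              gcongr
              have := one_le_freqNorm hk
              have := norm_le_freqNorm k
              linarith
          _ = 2 ^ (2 * m) * freqNorm k ^ (2 * m) := mul_pow _ _ _
          _ ≤ _ := by gcongr; linarith
    have hS0 : 0 ≤ S := ENNReal.toReal_nonneg
    refine le_of_sq_le_sq ?_ (by positivity)
    rw [mul_pow, mul_pow, Real.sq_sqrt hS0, ← pow_mul (1 + ‖k‖), mul_comm m 2]
    calc _ ≤ ‖fourierCoef f k‖ ^ 2 * ((2 ^ m) ^ 2 * (1 + freqNorm k ^ (2 * m))) := by gcongr
      _ = (2 ^ m) ^ 2 * ((1 + freqNorm k ^ (2 * m)) * ‖fourierCoef f k‖ ^ 2) := by ring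
      _ ≤ _ := by gcongr
  refine Summable.of_nonneg_of_le (fun k => by positivity) (fun k => ?_)
    ((summable_one_div_pow hd (n := d + 1) le_rfl).mul_left ((d : ℝ) ^ n * (2 ^ m * Real.sqrt S)))
  have hn := norm_nonneg k
  rw [mul_one_div, le_div_iff₀ (by positivity)]
  calc ‖fourierCoef f k‖ * (d * ‖k‖) ^ n * (1 + ‖k‖) ^ (d + 1)
      ≤ ‖fourierCoef f k‖ * (d * (1 + ‖k‖)) ^ n * (1 + ‖k‖) ^ (d + 1) := by gcongr; linarith
    _ = (d : ℝ) ^ n * (‖fourierCoef f k‖ * (1 + ‖k‖) ^ m) := by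
        rw [hm, mul_pow (d : ℝ), add_assoc, pow_add (1 + ‖k‖)]; ring
    _ ≤ _ := mul_le_mul_of_nonneg_left (hb k) (by positivity)

theorem isSmooth_of_memSobolev (hd : 1 ≤ d) {f : L2 d} (hf : ∀ m : ℕ, MemSobolev (m : ℝ) f) :
    IsSmooth f := by
  have h0 : Summable fun k => ‖fourierCoef f k‖ := by simpa using MemSobolev.summable hd hf 0
  have e : ContinuousMap.toLp (E := ℝ) 2 volume ℝ (synth (fourierCoef f)) = f :=
    ext_fourierCoef fun k => by
      rw [fourierCoef_toLp, fourierCoef_synth h0 (fourierCoef_neg f)]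
  refine ⟨synth (fourierCoef f), ?_, contDiff_synth (MemSobolev.summable hd hf)⟩
  have h1 := ContinuousMap.coeFn_toLp (p := 2) (𝕜 := ℝ) (volume : Measure (Torus d))
    (synth (fourierCoef f))
  rwa [e] at h1

theorem meanZero_iff (f : L2 d) : MeanZero f ↔ fourierCoef f 0 = 0 := by
  have : fourierCoef f 0 = ((∫ x, f x : ℝ) : ℂ) := by
    simp only [fourierCoef, neg_zero, character_zero, mul_one]
    exact integral_complex_ofReal
  rw [this, MeanZero, Complex.ofReal_eq_zero]

theorem IsMildSolution.meanZero {ν T : ℝ} (hν : 0 < ν) {h₀ : L2 d} {h : ℝ → L2 d}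
    (hm : IsMildSolution ν h₀ T h) (h0 : MeanZero h₀) {t : ℝ} (ht : t ∈ Ioc 0 T) :
    MeanZero (h t) := by
  rw [isMildSolution_iff hν] at hm
  obtain ⟨-, -, -, p, -, -, hc⟩ := hm
  rw [meanZero_iff] at h0 ⊢
  rw [hc t ht 0, h0]
  simp [derivSymbol]

theorem exists_isMildSolution_of_lt_lifespan {ν : ℝ} {h₀ : L2 d} {t : ℝ}
    (ht : ENNReal.ofReal t < lifespan ν h₀) : ∃ T, t < T ∧ ∃ h, IsMildSolution ν h₀ T h := by
  obtain ⟨τ, ⟨T, hT, rfl, hex⟩, hlt⟩ := lt_sSup_iff.mp ht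
  exact ⟨T, (ENNReal.ofReal_lt_ofReal_iff hT).mp hlt, hex⟩

/-- The mild solutions on all shorter intervals fit together. -/
theorem exists_maximal_isMildSolution {ν : ℝ} (hν : 0 < ν) (h₀ : L2 d) :
    ∃ h : ℝ → L2 d, ∀ T : ℝ, 0 < T → ENNReal.ofReal T < lifespan ν h₀ →
      IsMildSolution ν h₀ T h := by
  have hex : ∀ t : ℝ, ∃ g : ℝ → L2 d, ENNReal.ofReal t < lifespan ν h₀ →
      IsMildSolution ν h₀ t g := by
    intro t
    by_cases ht : ENNReal.ofReal t < lifespan ν h₀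
    · obtain ⟨T, hT, g, hg⟩ := exists_isMildSolution_of_lt_lifespan ht
      exact ⟨g, fun _ => hg.mono hν hT.le⟩
    · exact ⟨0, fun h => absurd h ht⟩
  choose g hg using hex
  -- Diagonal choice: the value at t is that of a solution on [0,t], and by uniqueness it agrees
  -- with every solution on a longer interval.
  refine ⟨fun t => g t t, fun T hT hlt => ?_⟩
  refine (hg T hlt).congr hν hT.le fun t ht => ?_
  have h1 := hg t ((ENNReal.ofReal_le_ofReal ht.2).trans_lt hlt)
  exact h1.unique hν ((hg T hlt).mono hν ht.2) ⟨ht.1, le_rfl⟩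

end Smooth

end ThinFilm

theorem theorem1p2 (d : ℕ) (hd : 1 ≤ d) (ν : ℝ) (hν : 0 < ν) (h₀ : ThinFilm.L2 d)
    (hh₀ : ThinFilm.MemSobolev ((d : ℝ) / 2) h₀) :
    (∃ T₀ : ℝ, 0 < T₀ ∧ ∃ h, ThinFilm.IsMildSolution ν h₀ T₀ h) ∧
    (∀ T : ℝ, 0 < T → ∀ h₁ h₂, ThinFilm.IsMildSolution ν h₀ T h₁ →
      ThinFilm.IsMildSolution ν h₀ T h₂ → Set.EqOn h₁ h₂ (Set.Icc 0 T)) ∧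
    ∃ h : ℝ → ThinFilm.L2 d,
      (∀ T : ℝ, 0 < T → ENNReal.ofReal T < ThinFilm.lifespan ν h₀ →
        ThinFilm.IsMildSolution ν h₀ T h) ∧
      (∀ t : ℝ, 0 < t → ENNReal.ofReal t < ThinFilm.lifespan ν h₀ →
        (∀ m : ℕ, ThinFilm.MemSobolev (m : ℝ) (h t)) ∧ ThinFilm.IsSmooth (h t)) ∧
      (ThinFilm.MeanZero h₀ → ∀ t : ℝ, 0 < t → ENNReal.ofReal t < ThinFilm.lifespan ν h₀ →
        ThinFilm.MeanZero (h t)) := by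
  refine ⟨?_, fun T _ h₁ h₂ hm₁ hm₂ => hm₁.unique hν hm₂, ?_⟩
  -- Only existence matters here, so the least regularity m = 0 is enough; T is chosen with
  -- `lowNorm` below the threshold.
  · obtain ⟨ρ, hρ, hloc⟩ := ThinFilm.exists_isMildSolution hd hν 0
    have hfin : ThinFilm.sobSq d (ThinFilm.fourierCoef h₀) < ⊤ := by
      rwa [← ThinFilm.sobolevNormSq_eq (s := (d : ℝ) / 2) (by ring)]
    have h1 := (ThinFilm.tendsto_lowNorm hfin).eventually
      (Iic_mem_nhds (ENNReal.ofReal_pos.mpr hρ))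
    have h2 : ∀ᶠ t in 𝓝[>] (0 : ℝ), t ∈ Ioc 0 ρ := Ioc_mem_nhdsGT hρ
    obtain ⟨T, hlow, hT⟩ := (h1.and h2).exists
    obtain ⟨h, hm, -⟩ := hloc h₀ hh₀ T hT hlow
    exact ⟨T, hT.1, h, hm⟩
  · obtain ⟨h, hm⟩ := ThinFilm.exists_maximal_isMildSolution hν h₀
    refine ⟨h, hm, fun t ht hlt => ?_, fun h0 t ht hlt => (hm t ht hlt).meanZero hν h0 ⟨ht, le_rfl⟩⟩
    have hs := fun m => (hm t ht hlt).memSobolev hd hν ⟨ht, le_rfl⟩ m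
    exact ⟨hs, ThinFilm.isSmooth_of_memSobolev hd hs⟩
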